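/- **Notation.** For $f$ on $\mathbb R^2$ let $\hat f(\xi)=(2\pi)^{-1}\int_{\mathbb R^2}e^{-ix\cdot\xi}f(x)\,dx$, let $\langle s\rangle=(1+|s|^2)^{1/2}$, and let $e^{it\Delta}$ be the operator on $L^2(\mathbb R^2)$ with $\widehat{e^{it\Delta}f}(\xi)=e^{-it|\xi|^2}\hat f(\xi)$. Let $\varphi:\mathbb R^2\to\mathbb R$ be a smooth radial function that equals $1$ for $|\xi|\le1$ and vanishes for $|\xi|>\frac{11}{10}$; for $N>0$ let $P_N$ be the Fourier multiplier $\widehat{P_Nf}(\xi)=\bigl(\varphi(\xi/N)-\varphi(2\xi/N)\bigr)\hat f(\xi)$. Let $H^{(1)}_0=J_0+iY_0$ be the Hankel function of the first kind and order zero and $H^{(2)}_0=\overline{H^{(1)}_0}$ (on $(0,\infty)$). For Schwartz functions $f$ and almost every $x$ set $$[P^+f](x)=\tfrac12(2\pi)^{-1}\int_{\mathbb R^2}H^{(1)}_0(|\xi||x|)\,\hat f(\xi)\,d\xi,\qquad [P^-f](x)=\tfrac12(2\pi)^{-1}\int_{\mathbb R^2}H^{(2)}_0(|\xi||x|)\,\hat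 f(\xi)\,d\xi .$$ **Proposition (Properties of $P^\pm$).** 1. The integrals defining $P^\pm f$ converge absolutely for almost every $x$, and $P^\pm$ extend (uniquely) to bounded operators on $L^2(\mathbb R^2)$. 2. $P^++P^-$ is the orthogonal projection from $L^2(\mathbb R^2)$ onto the subspace $L^2_{\rm rad}(\mathbb R^2)$ of radial functions. 3. For all $N>0$ and $t\in\mathbb R$ the operators $P_N^\pm e^{\mp it\Delta}:=P^\pm P_Ne^{\mp it\Delta}$ have integral kernels $[P_N^\pm e^{\mp it\Delta}](x,y)$, continuous in $(x,y)$ for $x\neq0$. Let $c>0$, $0<a<1$ and $b>\frac{11}5$. There is a constant $C_1=C_1(\varphi,c,a,b)$ and, for every real $m\ge0$, a constant $C_2=C_2(\varphi,c,a,b,m)$ such that for all $N>0$, all $t\ge cN^{-2}$ and all $x,y\in\mathbb R^2$ with $|x|\ge cN^{-1}$, $$\bigl|[P_N^\pm e^{\mp it\Delta}](x,y)\bigr|\le\begin{cases}C_1\bigl(|x||y||t|\bigr)^{-1/2}&\text{if } aNt\le|y|-|x|\le bNt,\\[1ex] C_2\,\dfrac{N^2}{(N|x|)^{1/2}\langle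 N|y|\rangle^{1/2}}\,\bigl\langle N^2t+N|x|-N|y|\bigr\rangle^{-m}&\text{otherwise.}\end{cases}$$ 4. For all $c,c'>0$ and all real $m\ge0$ there is a constant $C=C(\varphi,c,c',m)$ such that for all $N>0$, all $t\in\mathbb R$ with $|t|\le c'N^{-2}$ and all $x,y\in\mathbb R^2$ with $|x|\ge cN^{-1}$, $$\bigl|[P_N^\pm e^{\mp it\Delta}](x,y)\bigr|\le C\,\frac{N^2}{(N|x|)^{1/2}\langle N|y|\rangle^{1/2}}\,\bigl\langle N|x|-N|y|\bigr\rangle^{-m}.$$ -/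

import Mathlib

open MeasureTheory
open scoped ENNReal ContDiff FourierTransform SchwartzMap InnerProductSpace

noncomputable section

namespace InOut

/-- The Euclidean plane. -/
abbrev Plane : Type := EuclideanSpace ℝ (Fin 2)

/-- The space `L²(ℝ²)` of complex-valued functions. -/
abbrev L2 : Type := Lp ℂ 2 (volume : Measure Plane)

/-- The Japanese bracket `⟨s⟩ = (1 + |s|²)^{1/2}`. -/
def bracket (s : ℝ) : ℝ := Real.sqrt (1 + s ^ 2)

/-- The Fourier transform `f̂(ξ) = (2π)⁻¹ ∫ e^{-i x·ξ} f(x) dx` on the plane. -/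
def fourierHat (f : Plane → ℂ) (ξ : Plane) : ℂ :=
  (2 * Real.pi : ℂ)⁻¹ * ∫ x : Plane, Complex.exp (-Complex.I * (⟪x, ξ⟫_ℝ : ℝ)) * f x

/-- The Bessel function of the first kind `J₀(r) = (2π)⁻¹ ∫₀^{2π} e^{i r cos θ} dθ`. -/
def besselJ0 (r : ℝ) : ℂ :=
  (2 * Real.pi : ℂ)⁻¹ *
    ∫ θ in (0 : ℝ)..(2 * Real.pi), Complex.exp (Complex.I * (r * Real.cos θ : ℝ))

/-- The Bessel function of the second kind `Y₀`, for `r > 0`, by Schläfli's integral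
`Y₀(r) = π⁻¹ ∫₀^π sin(r sin θ) dθ - 2 π⁻¹ ∫₀^∞ e^{-r sinh s} ds`. -/
def besselY0 (r : ℝ) : ℝ :=
  Real.pi⁻¹ * (∫ θ in (0 : ℝ)..Real.pi, Real.sin (r * Real.sin θ))
    - 2 * Real.pi⁻¹ * ∫ s in Set.Ioi (0 : ℝ), Real.exp (-(r * Real.sinh s))

/-- The Hankel function of the first kind, `H₀⁽¹⁾ = J₀ + i Y₀`, for `r > 0`. -/
def hankel1 (r : ℝ) : ℂ := besselJ0 r + Complex.I * (besselY0 r : ℂ)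

/-- The Hankel function of the second kind; for `r > 0` it is the conjugate of `H₀⁽¹⁾`. -/
def hankel2 (r : ℝ) : ℂ := starRingEnd ℂ (hankel1 r)

/-- `P` is the bounded operator on `L²(ℝ²)` which on Schwartz functions is given by
`[P f](x) = ½ (2π)⁻¹ ∫ H(|ξ||x|) f̂(ξ) dξ`, the integral being absolutely convergent for almost
every `x`. As Schwartz functions are dense, there is at most one such `P`. -/
def IsHankelProjection (H : ℝ → ℂ) (P : L2 →L[ℂ] L2) : Prop :=
  ∀ f : 𝓢(Plane, ℂ), ∀ᵐ x : Plane,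
    Integrable (fun ξ : Plane => H (‖ξ‖ * ‖x‖) * fourierHat f ξ) ∧
    P (f.toLp 2) x =
      (1 / 2 : ℂ) * (2 * Real.pi : ℂ)⁻¹ * ∫ ξ : Plane, H (‖ξ‖ * ‖x‖) * fourierHat f ξ

/-- The subspace `L²_rad` of `L²(ℝ²)` of (classes of) spherically symmetric functions. -/
def radialL2 : Submodule ℂ L2 where
  carrier := {f | ∃ g : ℝ → ℂ, Measurable g ∧ ∀ᵐ x : Plane, f x = g ‖x‖}
  add_mem' := by
    rintro f₁ f₂ ⟨g₁, m₁, h₁⟩ ⟨g₂, m₂, h₂⟩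
    refine ⟨fun r => g₁ r + g₂ r, m₁.add m₂, ?_⟩
    filter_upwards [h₁, h₂, Lp.coeFn_add f₁ f₂] with x e₁ e₂ e
    rw [e, Pi.add_apply, e₁, e₂]
  zero_mem' := by
    refine ⟨fun _ => 0, measurable_const, ?_⟩
    filter_upwards [Lp.coeFn_zero ℂ 2 (volume : Measure Plane)] with x e
    rw [e, Pi.zero_apply]
  smul_mem' := by
    rintro c f ⟨g, m, h⟩
    refine ⟨fun r => c • g r, m.const_smul c, ?_⟩
    filter_upwards [h, Lp.coeFn_smul c f] with x e₁ e
    rw [e, Pi.smul_apply, e₁]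

theorem memLp_dilate {m : Plane → ℂ} (hc : Continuous m) (hb : ∃ C : ℝ, ∀ ξ, ‖m ξ‖ ≤ C) :
    MemLp (fun ξ : Plane => m ((2 * Real.pi) • ξ)) ∞ (volume : Measure Plane) := by
  obtain ⟨C, hC⟩ := hb
  exact memLp_top_of_bound (by fun_prop) C (Filter.Eventually.of_forall fun ξ => hC _)

/-- The operator `T` on `L²(ℝ²)` with `(T f)^(ξ) = m(ξ) f̂(ξ)`, for a bounded continuous symbol `m`.
Mathlib's transform is `𝓕 f(ξ) = ∫ e^{-2π i x·ξ} f(x) dx = 2π f̂(2πξ)`, hence the dilation. -/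
def fourierMultiplier (m : Plane → ℂ) (hc : Continuous m) (hb : ∃ C : ℝ, ∀ ξ, ‖m ξ‖ ≤ C) :
    L2 →L[ℂ] L2 :=
  ((Lp.fourierTransformₗᵢ Plane ℂ).symm.toContinuousLinearEquiv : L2 →L[ℂ] L2) ∘L
    ((ContinuousLinearMap.mul ℂ ℂ).holderL volume ∞ 2 2 ((memLp_dilate hc hb).toLp _)) ∘L
    ((Lp.fourierTransformₗᵢ Plane ℂ).toContinuousLinearEquiv : L2 →L[ℂ] L2)

/-- The free Schrödinger propagator `e^{itΔ}`, with symbol `e^{-it|ξ|²}`. -/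
def propagator (t : ℝ) : L2 →L[ℂ] L2 :=
  fourierMultiplier (fun ξ => Complex.exp (-Complex.I * (t * ‖ξ‖ ^ 2 : ℝ))) (by fun_prop)
    ⟨1, fun ξ => le_of_eq (by
      rw [neg_mul, mul_comm, ← neg_mul, ← Complex.ofReal_neg, Complex.norm_exp_ofReal_mul_I])⟩

/-- `φ` is an admissible Littlewood-Paley cutoff: a smooth radial function which is `1` on
`|ξ| ≤ 1` and is supported in `|ξ| ≤ 11/10`. -/
structure IsCutoff (φ : Plane → ℝ) : Prop where
  smooth : ContDiff ℝ ∞ φ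
  radial : ∀ ξ η : Plane, ‖ξ‖ = ‖η‖ → φ ξ = φ η
  eq_one : ∀ ξ : Plane, ‖ξ‖ ≤ 1 → φ ξ = 1
  eq_zero : ∀ ξ : Plane, 11 / 10 < ‖ξ‖ → φ ξ = 0

theorem IsCutoff.bounded {φ : Plane → ℝ} (hφ : IsCutoff φ) : ∃ C : ℝ, ∀ ξ, ‖φ ξ‖ ≤ C := by
  refine hφ.smooth.continuous.bounded_above_of_compact_support ?_
  refine HasCompactSupport.intro (isCompact_closedBall (0 : Plane) (11 / 10)) fun ξ hξ => ?_
  exact hφ.eq_zero ξ (by simpa using hξ)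

/-- The Littlewood-Paley projection `P_N`, with symbol `ψ(ξ/N) = φ(ξ/N) - φ(2ξ/N)`. -/
def littlewoodPaley (φ : Plane → ℝ) (hφ : IsCutoff φ) (N : ℝ) : L2 →L[ℂ] L2 :=
  fourierMultiplier (fun ξ => ((φ (N⁻¹ • ξ) - φ ((2 * N⁻¹) • ξ) : ℝ) : ℂ))
    (by
      have := hφ.smooth.continuous
      fun_prop)
    (by
      obtain ⟨C, hC⟩ := hφ.bounded
      refine ⟨C + C, fun ξ => ?_⟩
      rw [Complex.norm_real]
      exact (norm_sub_le _ _).trans (add_le_add (hC _) (hC _)))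

/-- `K` is the integral kernel of `T`: it is continuous in `(x, y)` for `x ≠ 0`, and for every
`f ∈ L²` one has `[T f](x) = ∫ K(x, y) f(y) dy` (absolutely convergent) for almost every `x`.
These conditions determine `K(x, y)` for all `x ≠ 0` and all `y`. -/
def IsIntegralKernel (T : L2 →L[ℂ] L2) (K : Plane → Plane → ℂ) : Prop :=
  ContinuousOn (fun p : Plane × Plane => K p.1 p.2) {p | p.1 ≠ 0} ∧
  ∀ f : L2, ∀ᵐ x : Plane,
    Integrable (fun y : Plane => K x y * f y) ∧ T f x = ∫ y : Plane, K x y * f y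

end InOut

end

namespace InOut

open Filter Topology Set

/-! ### The Hankel function as a Laplace transform -/

/-! Everything rests on one representation. Shifting the contour in Schläfli's integrals gives
H₀⁽¹⁾(r) = e^{ir} a(r), where a is the Laplace transform of a weight w with |w(u)| ≤ u^{-1/2}
(`hankel1_eq`, `norm_hankelWeight_le`). By scaling, σ ↦ a(σX) and each of its derivatives are
O(X^{-1/2}) on bounded intervals away from 0, uniformly in X > 0 (`exists_symbolBound_laplace_mul`).
Taking real parts writes J₀ as a sum of two terms of the same kind with phases e^{±ir}.

Kernel bounds. In polar coordinates the kernel of P⁺P_N e^{-itΔ} is N²/(4π) times ∫ H₀⁽¹⁾(σX) J₀(σY)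
e^{iTσ²} ψ(σ) σ dσ with X = N|x|, Y = N|y|, T = N²t (`hankelKernel_eq`), and the minus kernels are
complex conjugates of the plus kernels (`hankelKernel_hankel2`). Splitting J₀ produces the quadratic
phases Tσ² + (X ± Y)σ with amplitudes of size (XY)^{-1/2}. For T > 0 the phase with X + Y has no
stationary point. The other has derivative 2Tσ - (Y - X), which can vanish on the support 1/2 ≤ σ ≤
11/10 of ψ only if T ≤ Y - X ≤ 11T/5; hence the conditions a < 1 and b > 11/5. Off the enlarged
region repeated integration by parts gives any power of decay (`exists_nonstationary_bound`); van
der Corput's estimate costs T^{-1/2} (`stationary_bound`). For Y ≤ 1 the factor J₀(σY) is itself a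
harmless amplitude, and for bounded |T| so is e^{iTσ²}.

Boundedness on L². The operators see a function only through its circular integrals, so the question
is one on the half-line, for the kernel (rρ)^{1/2} H₀⁽¹⁾(rρ). Since s^{1/2} H₀⁽¹⁾(s) = c e^{is} +
O(min(1, 1/s)) (`exists_norm_hankel1_sub_le`), Plancherel handles the main term and Schur's test the
remainder (`lintegral_sq_schur`). Density of Schwartz functions then defines P^±.

Sum of the operators. H₀⁽¹⁾ + H₀⁽²⁾ = 2J₀, and J₀(|ξ|r) is the mean of e^{iz·ξ} over |z| = r. Fubini
and Fourier inversion turn (P⁺ + P⁻)f into the circular mean of f, which is its orthogonal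
projection onto the radial functions.

The integral formula holds on Schwartz functions by Fubini. It passes to all of L² because the
kernel is square integrable in y for each x ≠ 0 (`memLp_hankelKernel`), which the bounded-time
estimate with two powers of decay supplies. -/

theorem integrableOn_exp_mul_rpow {r s : ℝ} (hr : 0 < r) (hs : -1 < s) :
    IntegrableOn (fun u : ℝ => Real.exp (-(r * u)) * u ^ s) (Ioi 0) := by
  have := integrableOn_rpow_mul_exp_neg_mul_rpow (p := 1) hs one_pos hr
  refine this.congr_fun (fun u _ => ?_) measurableSet_Ioi
  simp only [Real.rpow_one, neg_mul]
  ring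

/-- The integrand `e^{irz} (1 - z²)^{-1/2}` of the contour integrals for `H₀⁽¹⁾(r)`. -/
noncomputable def contourIntegrand (r : ℝ) (z : ℂ) : ℂ :=
  Complex.exp (Complex.I * r * z) * (1 - z ^ 2) ^ ((-(1 / 2) : ℝ) : ℂ)

theorem re_one_sub_sq (x y : ℝ) :
    (1 - ((x : ℂ) + y * Complex.I) ^ 2).re = 1 - x ^ 2 + y ^ 2 := by
  simp [pow_two]; ring

/-- The real part 1 - x² + y² is positive, so the principal power is holomorphic on the closed
half-strip 0 ≤ x ≤ 1, y ≥ 0, except at the branch point z = 1. -/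
theorem one_sub_sq_mem_slitPlane {x y : ℝ} (hx0 : 0 ≤ x) (hx : x ≤ 1) (h : x < 1 ∨ 0 < y) :
    (1 - ((x : ℂ) + y * Complex.I) ^ 2) ∈ Complex.slitPlane := by
  refine Or.inl ?_
  rw [re_one_sub_sq]
  rcases h with h | h <;> nlinarith [sq_nonneg y]

/-- In 1 - z² = (1 - z)(1 + z) the first factor is at least its imaginary part y in size and the
second at least its real part, which is at least 1. This makes the majorant e^{-ry} y^{-1/2} of the
contour integrand uniform in x. -/
theorem le_norm_one_sub_sq {x y : ℝ} (hx0 : 0 ≤ x) (hy : 0 ≤ y) :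
    y ≤ ‖1 - ((x : ℂ) + y * Complex.I) ^ 2‖ := by
  have e : 1 - ((x : ℂ) + y * Complex.I) ^ 2
      = (1 - ((x : ℂ) + y * Complex.I)) * (1 + ((x : ℂ) + y * Complex.I)) := by ring
  rw [e, norm_mul]
  have h1 : y ≤ ‖1 - ((x : ℂ) + y * Complex.I)‖ := by
    refine le_trans ?_ (Complex.abs_im_le_norm _)
    simp [abs_of_nonneg hy]
  have h2 : 1 ≤ ‖1 + ((x : ℂ) + y * Complex.I)‖ := by
    refine le_trans ?_ (Complex.re_le_norm _)
    simp [hx0]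
  nlinarith

theorem norm_contourIntegrand_le {r x y : ℝ} (hx0 : 0 ≤ x) (hy : 0 < y) :
    ‖contourIntegrand r (x + y * Complex.I)‖ ≤ Real.exp (-(r * y)) * y ^ (-(1 / 2) : ℝ) := by
  rw [contourIntegrand, norm_mul, Complex.norm_cpow_real, Complex.norm_exp]
  have : (Complex.I * r * ((x : ℂ) + y * Complex.I)).re = -(r * y) := by simp
  rw [this]
  gcongr ?_ * ?_
  exact Real.rpow_le_rpow_of_nonpos hy (le_norm_one_sub_sq hx0 hy.le) (by norm_num)

theorem differentiableAt_contourIntegrand (r : ℝ) {z : ℂ} (hz : 1 - z ^ 2 ∈ Complex.slitPlane) :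
    DifferentiableAt ℂ (contourIntegrand r) z := by
  unfold contourIntegrand
  refine DifferentiableAt.mul (by fun_prop) ?_
  exact DifferentiableAt.cpow (by fun_prop) (by fun_prop) hz

theorem continuousOn_contourIntegrand_vertical (r : ℝ) {x : ℝ} (hx0 : 0 ≤ x) (hx : x ≤ 1) :
    ContinuousOn (fun y : ℝ => contourIntegrand r (x + y * Complex.I)) (Ioi 0) := by
  intro y hy
  have h := (differentiableAt_contourIntegrand r
    (one_sub_sq_mem_slitPlane hx0 hx (Or.inr hy))).continuousAt
  exact (ContinuousAt.comp (f := fun y : ℝ => (x : ℂ) + y * Complex.I) h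
    (by fun_prop)).continuousWithinAt

theorem integrableOn_contourIntegrand_vertical {r x : ℝ} (hr : 0 < r) (hx0 : 0 ≤ x) (hx : x ≤ 1) :
    IntegrableOn (fun y : ℝ => contourIntegrand r (x + y * Complex.I)) (Ioi 0) := by
  refine Integrable.mono' (integrableOn_exp_mul_rpow hr (s := -(1 / 2)) (by norm_num))
    ((continuousOn_contourIntegrand_vertical r hx0 hx).aestronglyMeasurable measurableSet_Ioi) ?_
  exact (ae_restrict_iff' measurableSet_Ioi).2
    (Eventually.of_forall fun y hy => norm_contourIntegrand_le hx0 hy)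

/-- Cauchy's theorem on the rectangle with corners 0 and x + iR, with R → ∞. Taking x < 1 keeps the
branch point z = 1 outside. -/
theorem integral_contourIntegrand_horizontal {r x : ℝ} (hr : 0 < r) (hx0 : 0 ≤ x) (hx : x < 1) :
    ∫ s in (0 : ℝ)..x, contourIntegrand r s =
      Complex.I * ((∫ y in Ioi (0 : ℝ), contourIntegrand r (((0 : ℝ) : ℂ) + y * Complex.I)) -
        ∫ y in Ioi (0 : ℝ), contourIntegrand r (x + y * Complex.I)) := by
  have hrect : ∀ R : ℝ, 0 < R →
      (∫ s in (0 : ℝ)..x, contourIntegrand r s) -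
        (∫ s in (0 : ℝ)..x, contourIntegrand r (s + R * Complex.I)) +
        Complex.I * (∫ y in (0 : ℝ)..R, contourIntegrand r (x + y * Complex.I)) -
        Complex.I * (∫ y in (0 : ℝ)..R, contourIntegrand r (((0 : ℝ) : ℂ) + y * Complex.I)) = 0 := by
    intro R hR
    have := Complex.integral_boundary_rect_eq_zero_of_differentiableOn (contourIntegrand r)
      0 (x + R * Complex.I) (by
        intro z hz
        simp only [Complex.zero_re, Complex.add_re, Complex.ofReal_re, Complex.mul_re,
          Complex.I_re, mul_zero, Complex.ofReal_im, Complex.I_im, mul_one, sub_self, add_zero,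
          Complex.zero_im, Complex.add_im, Complex.mul_im, zero_add, uIcc_of_le hx0,
          uIcc_of_le hR.le, Complex.mem_reProdIm, mem_Icc] at hz
        have h := one_sub_sq_mem_slitPlane (x := z.re) (y := z.im) hz.1.1 (hz.1.2.trans hx.le)
          (Or.inl (hz.1.2.trans_lt hx))
        rw [Complex.re_add_im] at h
        exact (differentiableAt_contourIntegrand r h).differentiableWithinAt)
    simpa using this
  -- The top edge decays like e^{-rR}; for R ≥ 1 the factor R^{-1/2} can be dropped.
  have htop : Tendsto (fun R : ℝ => ∫ s in (0 : ℝ)..x, contourIntegrand r (s + R * Complex.I))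
      atTop (𝓝 0) := by
    have hlim : Tendsto (fun R : ℝ => Real.exp (-(r * R)) * |x - 0|) atTop (𝓝 0) := by
      have : Tendsto (fun R : ℝ => Real.exp (-(r * R))) atTop (𝓝 0) :=
        Real.tendsto_exp_neg_atTop_nhds_zero.comp (tendsto_id.const_mul_atTop hr)
      simpa using this.mul_const |x - 0|
    refine squeeze_zero_norm' ?_ hlim
    filter_upwards [eventually_ge_atTop 1] with R hR
    refine intervalIntegral.norm_integral_le_of_norm_le_const fun s hs => ?_
    rw [uIoc_of_le hx0] at hs
    refine (norm_contourIntegrand_le hs.1.le (by linarith)).trans ?_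
    have : R ^ (-(1 / 2) : ℝ) ≤ 1 := Real.rpow_le_one_of_one_le_of_nonpos hR (by norm_num)
    nlinarith [Real.exp_pos (-(r * R))]
  have hA := fun (x : ℝ) (h0 : 0 ≤ x) (h1 : x ≤ 1) => intervalIntegral_tendsto_integral_Ioi 0
    (integrableOn_contourIntegrand_vertical hr h0 h1) tendsto_id
  have hl := ((tendsto_const_nhds (x := ∫ s in (0 : ℝ)..x, contourIntegrand r s)).sub htop).add
    ((hA x hx0 hx.le).const_mul Complex.I) |>.sub
    ((hA 0 le_rfl zero_le_one).const_mul Complex.I)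
  have h0 := tendsto_nhds_unique (hl.congr' (f₂ := fun _ => 0) (by
    filter_upwards [eventually_gt_atTop 0] with R hR
    exact hrect R hR)) tendsto_const_nhds
  linear_combination h0

/-- Since the rectangles must avoid z = 1, the right edge reaches it only in the limit. Dominated
convergence applies because the majorant e^{-ry} y^{-1/2} does not depend on the abscissa. -/
theorem tendsto_integral_contourIntegrand_vertical {r : ℝ} (hr : 0 < r) :
    Tendsto (fun θ : ℝ => ∫ y in Ioi (0 : ℝ), contourIntegrand r (Real.sin θ + y * Complex.I))
      (𝓝[<] (Real.pi / 2))
      (𝓝 (∫ y in Ioi (0 : ℝ), contourIntegrand r (((1 : ℝ) : ℂ) + y * Complex.I))) := by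
  have hmem : ∀ᶠ θ in 𝓝[<] (Real.pi / 2), 0 ≤ Real.sin θ := by
    have : Ioo 0 (Real.pi / 2) ∈ 𝓝[<] (Real.pi / 2) := Ioo_mem_nhdsLT (by positivity)
    filter_upwards [this] with θ hθ
    exact Real.sin_nonneg_of_nonneg_of_le_pi hθ.1.le (by linarith [hθ.2, Real.pi_pos])
  refine tendsto_integral_filter_of_dominated_convergence
    (fun y => Real.exp (-(r * y)) * y ^ (-(1 / 2) : ℝ)) ?_ ?_
    (integrableOn_exp_mul_rpow hr (by norm_num)) ?_
  · filter_upwards [hmem] with θ hθ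
    exact (continuousOn_contourIntegrand_vertical r hθ (Real.sin_le_one θ)).aestronglyMeasurable
      measurableSet_Ioi
  · filter_upwards [hmem] with θ hθ
    exact (ae_restrict_iff' measurableSet_Ioi).2
      (Eventually.of_forall fun y hy => norm_contourIntegrand_le hθ hy)
  · refine (ae_restrict_iff' measurableSet_Ioi).2 (Eventually.of_forall fun y hy => ?_)
    have h := (differentiableAt_contourIntegrand r (one_sub_sq_mem_slitPlane zero_le_one le_rfl
      (Or.inr hy))).continuousAt
    have h2 : Tendsto (fun θ : ℝ => (Real.sin θ : ℂ) + y * Complex.I) (𝓝 (Real.pi / 2))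
        (𝓝 (((1 : ℝ) : ℂ) + y * Complex.I)) := by
      have hc : Continuous fun θ : ℝ => (Real.sin θ : ℂ) + y * Complex.I := by fun_prop
      have := hc.tendsto (Real.pi / 2)
      simpa only [Real.sin_pi_div_two] using this
    exact (h.tendsto.comp h2).mono_left nhdsWithin_le_nhds

/-- Substitution x = sin s: the factor (1 - x²)^{-1/2} = 1/cos s cancels the Jacobian. -/
theorem integral_exp_sin {r θ : ℝ} (h0 : 0 ≤ θ) (hθ : θ < Real.pi / 2) :
    ∫ s in (0 : ℝ)..θ, Complex.exp (Complex.I * (r * Real.sin s : ℝ)) =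
      ∫ x in (0 : ℝ)..Real.sin θ, contourIntegrand r x := by
  have hsub := intervalIntegral.integral_deriv_smul_comp_of_deriv_nonneg (a := 0) (b := θ)
    (f := Real.sin) (f' := Real.cos) (g := fun x : ℝ => contourIntegrand r x)
    Real.continuous_sin.continuousOn (fun x _ => Real.hasDerivAt_sin x) (fun x hx => by
      rw [min_eq_left h0, max_eq_right h0] at hx
      exact Real.cos_nonneg_of_mem_Icc ⟨by linarith [hx.1, Real.pi_pos], by linarith [hx.2]⟩)
  rw [Real.sin_zero] at hsub
  rw [← hsub]
  refine intervalIntegral.integral_congr fun s hs => ?_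
  rw [uIcc_of_le h0] at hs
  have hc : 0 < Real.cos s :=
    Real.cos_pos_of_mem_Ioo ⟨by linarith [hs.1, Real.pi_pos], by linarith [hs.2]⟩
  have e : (1 - (Real.sin s : ℂ) ^ 2) = ((Real.cos s ^ 2 : ℝ) : ℂ) := by
    rw [Real.cos_sq']; push_cast; ring
  simp only [Function.comp, contourIntegrand]
  rw [e, ← Complex.ofReal_cpow (by positivity), ← Real.rpow_natCast, ← Real.rpow_mul hc.le]
  norm_num
  have hc' : Complex.cos s ≠ 0 := by exact_mod_cast hc.ne'
  rw [Real.rpow_neg_one, Complex.ofReal_inv, Complex.ofReal_cos, mul_comm (Complex.cos s),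
    inv_mul_cancel_right₀ hc']
  ring_nf

/-- Substitution y = sinh s, with 1 - (iy)² = cosh² s. The left edge of the contour is thus the
exponential integral in Schläfli's formula for Y₀. -/
theorem integral_exp_neg_sinh {r : ℝ} :
    ∫ y in Ioi (0 : ℝ), contourIntegrand r (((0 : ℝ) : ℂ) + y * Complex.I) =
      ((∫ s in Ioi (0 : ℝ), Real.exp (-(r * Real.sinh s)) : ℝ) : ℂ) := by
  have himg : Real.sinh '' Ioi 0 = Ioi 0 := by
    ext y
    simp only [mem_image, mem_Ioi]
    constructor
    · rintro ⟨x, hx, rfl⟩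
      exact Real.sinh_pos_iff.2 hx
    · intro hy
      exact ⟨Real.arsinh y, Real.arsinh_pos_iff.2 hy, Real.sinh_arsinh y⟩
  have h := integral_image_eq_integral_abs_deriv_smul (s := Ioi (0 : ℝ)) measurableSet_Ioi
    (fun x _ => (Real.hasDerivAt_sinh x).hasDerivWithinAt) Real.sinh_injective.injOn
    (fun y : ℝ => contourIntegrand r (((0 : ℝ) : ℂ) + y * Complex.I))
  rw [himg] at h
  rw [h, ← integral_complex_ofReal]
  refine setIntegral_congr_fun measurableSet_Ioi fun s hs => ?_
  have hc : 0 < Real.cosh s := Real.cosh_pos s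
  have e : (1 - (((0 : ℝ) : ℂ) + Real.sinh s * Complex.I) ^ 2) = ((Real.cosh s ^ 2 : ℝ) : ℂ) := by
    rw [Real.cosh_sq, Complex.ofReal_zero, zero_add, mul_pow, Complex.I_sq]; push_cast; ring
  simp only [contourIntegrand]
  rw [e, ← Complex.ofReal_cpow (by positivity), ← Real.rpow_natCast, ← Real.rpow_mul hc.le]
  norm_num
  rw [Real.rpow_neg_one, mul_left_comm, ← Complex.ofReal_mul, abs_of_pos hc, mul_inv_cancel₀ hc.ne', Complex.ofReal_one, mul_one]
  congr 1
  linear_combination (r : ℂ) * Complex.sinh s * Complex.I_mul_I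

theorem integral_exp_sin_half (r : ℝ) (hr : 0 < r) :
    ∫ s in (0 : ℝ)..(Real.pi / 2), Complex.exp (Complex.I * (r * Real.sin s : ℝ)) =
      Complex.I * (((∫ s in Ioi (0 : ℝ), Real.exp (-(r * Real.sinh s)) : ℝ) : ℂ) -
        ∫ y in Ioi (0 : ℝ), contourIntegrand r (((1 : ℝ) : ℂ) + y * Complex.I)) := by
  have hcont : Continuous fun s : ℝ => Complex.exp (Complex.I * (r * Real.sin s : ℝ)) := by
    fun_prop
  have h1 : Tendsto (fun θ : ℝ => ∫ s in (0 : ℝ)..θ, Complex.exp (Complex.I * (r * Real.sin s : ℝ)))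
      (𝓝[<] (Real.pi / 2)) (𝓝 (∫ s in (0 : ℝ)..(Real.pi / 2),
        Complex.exp (Complex.I * (r * Real.sin s : ℝ)))) :=
    ((intervalIntegral.continuous_primitive (fun a b => hcont.intervalIntegrable a b) 0).tendsto
      _).mono_left nhdsWithin_le_nhds
  have h2 := ((tendsto_const_nhds (x := ((∫ s in Ioi (0 : ℝ), Real.exp (-(r * Real.sinh s)) : ℝ) :
    ℂ))).sub (tendsto_integral_contourIntegrand_vertical hr)).const_mul Complex.I
  refine tendsto_nhds_unique h1 (h2.congr' ?_)
  filter_upwards [Ioo_mem_nhdsLT (a := 0) (b := Real.pi / 2) (by positivity)] with θ hθ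
  rw [integral_exp_sin hθ.1.le hθ.2, integral_contourIntegrand_horizontal hr
    (Real.sin_nonneg_of_nonneg_of_le_pi hθ.1.le (by linarith [hθ.2, Real.pi_pos])) ?_,
    integral_exp_neg_sinh]
  rw [← Real.sin_pi_div_two]
  exact Real.sin_lt_sin_of_lt_of_le_pi_div_two (by linarith [hθ.1, Real.pi_pos]) le_rfl hθ.2

theorem integral_exp_sin_reflect (r : ℝ) :
    ∫ s in (0 : ℝ)..Real.pi, Complex.exp (Complex.I * (r * Real.sin s : ℝ)) =
      2 * ∫ s in (0 : ℝ)..(Real.pi / 2), Complex.exp (Complex.I * (r * Real.sin s : ℝ)) := by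
  have hcont : Continuous fun s : ℝ => Complex.exp (Complex.I * (r * Real.sin s : ℝ)) := by
    fun_prop
  rw [← intervalIntegral.integral_add_adjacent_intervals (hcont.intervalIntegrable 0 (Real.pi / 2))
    (hcont.intervalIntegrable (Real.pi / 2) Real.pi)]
  have h := intervalIntegral.integral_comp_sub_left (a := 0) (b := Real.pi / 2)
    (fun s : ℝ => Complex.exp (Complex.I * (r * Real.sin s : ℝ))) Real.pi
  simp only [Real.sin_pi_sub, sub_zero] at h
  rw [show Real.pi - Real.pi / 2 = Real.pi / 2 by ring] at h
  rw [← h]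
  ring

/-- Integrals over a full period do not see the phase. -/
theorem integral_exp_cos_add (r γ : ℝ) :
    ∫ θ in (-Real.pi)..Real.pi, Complex.exp (Complex.I * (r * Real.cos (θ + γ) : ℝ)) =
      2 * Real.pi * besselJ0 r := by
  have hper : Function.Periodic
      (fun θ : ℝ => Complex.exp (Complex.I * (r * Real.cos θ : ℝ))) (2 * Real.pi) := by
    intro θ
    simp only [Real.cos_add_two_pi]
  rw [intervalIntegral.integral_comp_add_right
    (fun θ : ℝ => Complex.exp (Complex.I * (r * Real.cos θ : ℝ)))]
  have := hper.intervalIntegral_add_eq (-Real.pi + γ) 0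
  rw [show -Real.pi + γ + 2 * Real.pi = Real.pi + γ by ring, zero_add] at this
  rw [this, besselJ0]
  have : (2 * Real.pi : ℂ) ≠ 0 := by exact_mod_cast (by positivity : (2 * Real.pi : ℝ) ≠ 0)
  field_simp

theorem besselJ0_eq (r : ℝ) :
    besselJ0 r = (((Real.pi)⁻¹ * ∫ θ in (0 : ℝ)..Real.pi, Real.cos (r * Real.sin θ) : ℝ) : ℂ) := by
  have hcont : Continuous fun s : ℝ => Complex.exp (Complex.I * (r * Real.sin s : ℝ)) := by
    fun_prop
  have hpi : (Real.pi : ℂ) ≠ 0 := by exact_mod_cast Real.pi_ne_zero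
  have h := integral_exp_cos_add r (-(Real.pi / 2))
  simp only [← sub_eq_add_neg, Real.cos_sub_pi_div_two] at h
  rw [← intervalIntegral.integral_add_adjacent_intervals (hcont.intervalIntegrable _ 0)
    (hcont.intervalIntegrable 0 Real.pi)] at h
  have h2 := intervalIntegral.integral_comp_neg (a := 0) (b := Real.pi)
    (fun s : ℝ => Complex.exp (Complex.I * (r * Real.sin s : ℝ)))
  rw [neg_zero] at h2
  rw [← h2, ← intervalIntegral.integral_add
    ((by fun_prop : Continuous fun s : ℝ =>
      Complex.exp (Complex.I * (r * Real.sin (-s) : ℝ))).intervalIntegrable _ _) (hcont.intervalIntegrable _ _)] at h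
  have h3 : ∫ s in (0 : ℝ)..Real.pi, (Complex.exp (Complex.I * (r * Real.sin (-s) : ℝ)) +
      Complex.exp (Complex.I * (r * Real.sin s : ℝ))) =
      2 * ((∫ θ in (0 : ℝ)..Real.pi, Real.cos (r * Real.sin θ) : ℝ) : ℂ) := by
    rw [← intervalIntegral.integral_ofReal, ← intervalIntegral.integral_const_mul]
    refine intervalIntegral.integral_congr fun s _ => ?_
    simp only [Real.sin_neg, Complex.ofReal_cos, Complex.cos]
    push_cast
    ring_nf
  rw [h3] at h
  push_cast
  field_simp
  linear_combination (-1 / 2) * h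

theorem besselJ0_im (r : ℝ) : (besselJ0 r).im = 0 := by
  rw [besselJ0_eq, Complex.ofReal_im]

/-- The weight `w` in `H₀⁽¹⁾(r) = e^{ir} ∫₀^∞ e^{-ru} w(u) du`. -/
noncomputable def hankelWeight (u : ℝ) : ℂ :=
  -(2 * Complex.I / Real.pi) *
    (1 - (((1 : ℝ) : ℂ) + u * Complex.I) ^ 2) ^ ((-(1 / 2) : ℝ) : ℂ)

/-- The amplitude `a` in `H₀⁽¹⁾(r) = e^{ir} a(r)`. -/
noncomputable def laplace (w : ℝ → ℂ) (r : ℝ) : ℂ := ∫ u in Ioi (0 : ℝ), (Real.exp (-(r * u)) : ℂ) * w u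

theorem hankel1_eq {r : ℝ} (hr : 0 < r) :
    hankel1 r = Complex.exp (Complex.I * r) * laplace hankelWeight r := by
  have hpi : (Real.pi : ℂ) ≠ 0 := by exact_mod_cast Real.pi_ne_zero
  have hcs : (∫ s in (0 : ℝ)..Real.pi, Complex.exp (Complex.I * (r * Real.sin s : ℝ))) =
      ((∫ θ in (0 : ℝ)..Real.pi, Real.cos (r * Real.sin θ) : ℝ) : ℂ) +
      Complex.I * ((∫ θ in (0 : ℝ)..Real.pi, Real.sin (r * Real.sin θ) : ℝ) : ℂ) := by
    rw [← intervalIntegral.integral_ofReal, ← intervalIntegral.integral_ofReal,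
      ← intervalIntegral.integral_const_mul, ← intervalIntegral.integral_add]
    · refine intervalIntegral.integral_congr fun s _ => ?_
      rw [mul_comm Complex.I, Complex.exp_mul_I, Complex.ofReal_cos, Complex.ofReal_sin]
      ring
    · exact (by fun_prop : Continuous fun θ : ℝ => ((Real.cos (r * Real.sin θ) : ℝ) : ℂ)).intervalIntegrable _ _
    · exact (by fun_prop : Continuous fun θ : ℝ => Complex.I * ((Real.sin (r * Real.sin θ) : ℝ) : ℂ)).intervalIntegrable _ _
  have hA : (∫ y in Ioi (0 : ℝ), contourIntegrand r (((1 : ℝ) : ℂ) + y * Complex.I)) =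
      Complex.exp (Complex.I * r) * (Real.pi * Complex.I / 2) * laplace hankelWeight r := by
    rw [laplace, ← integral_const_mul]
    refine integral_congr_ae (Eventually.of_forall fun y => ?_)
    simp only [contourIntegrand, hankelWeight]
    have : Complex.exp (Complex.I * r * (((1 : ℝ) : ℂ) + y * Complex.I)) =
        Complex.exp (Complex.I * r) * (Real.exp (-(r * y)) : ℂ) := by
      rw [Complex.ofReal_exp, ← Complex.exp_add]
      congr 1
      push_cast
      linear_combination (r : ℂ) * y * Complex.I_mul_I
    rw [this]
    field_simp
    rw [Complex.I_sq]
    ring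
  rw [hankel1, besselJ0_eq, besselY0]
  -- With S the exponential integral and A the integral over the right edge, `hcs` becomes 2i(S - A)
  -- = ∫cos + i∫sin. The term -2iS/π from Y₀ cancels S, and H₀⁽¹⁾ = -2iA/π remains.
  rw [integral_exp_sin_reflect, integral_exp_sin_half r hr, hA] at hcs
  push_cast at hcs ⊢
  field_simp
  linear_combination (-1 : ℂ) * hcs - Real.pi * Complex.exp (Complex.I * r) * laplace hankelWeight r * Complex.I_mul_I

/-! ### Amplitudes and oscillatory integrals -/

/-- `f` is `n` times continuously differentiable on `(p, q)`, and its derivatives of order at most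
`n` are bounded by `M` there. -/
def SymbolBound (p q : ℝ) : ℕ → ℝ → (ℝ → ℂ) → Prop
  | 0, M, f => (∀ σ ∈ Ioo p q, ‖f σ‖ ≤ M) ∧ ContinuousOn f (Ioo p q)
  | n + 1, M, f => (∀ σ ∈ Ioo p q, ‖f σ‖ ≤ M) ∧
      ∃ f' : ℝ → ℂ, (∀ σ ∈ Ioo p q, HasDerivAt f (f' σ) σ) ∧ SymbolBound p q n M f'

namespace SymbolBound

variable {p q M M₁ M₂ : ℝ} {n : ℕ} {f g : ℝ → ℂ}

theorem norm_le (h : SymbolBound p q n M f) : ∀ σ ∈ Ioo p q, ‖f σ‖ ≤ M := by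
  cases n <;> exact h.1

theorem continuousOn (h : SymbolBound p q n M f) : ContinuousOn f (Ioo p q) := by
  cases n with
  | zero => exact h.2
  | succ n =>
    obtain ⟨-, f', hf, -⟩ := h
    exact fun σ hσ => (hf σ hσ).continuousAt.continuousWithinAt

theorem mono (h : SymbolBound p q n M₁ f) (hM : M₁ ≤ M₂) : SymbolBound p q n M₂ f := by
  induction n generalizing f with
  | zero => exact ⟨fun σ hσ => (h.1 σ hσ).trans hM, h.2⟩
  | succ n ih =>
    obtain ⟨h1, f', hf, h'⟩ := h
    exact ⟨fun σ hσ => (h1 σ hσ).trans hM, f', hf, ih h'⟩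

theorem of_succ (h : SymbolBound p q (n + 1) M f) : SymbolBound p q n M f := by
  induction n generalizing f with
  | zero => exact ⟨h.norm_le, h.continuousOn⟩
  | succ n ih =>
    obtain ⟨h1, f', hf, h'⟩ := h
    exact ⟨h1, f', hf, ih h'⟩

theorem congr (h : SymbolBound p q n M f) (hfg : EqOn f g (Ioo p q)) : SymbolBound p q n M g := by
  cases n with
  | zero => exact ⟨fun σ hσ => hfg hσ ▸ h.1 σ hσ, h.2.congr hfg.symm⟩
  | succ n =>
    obtain ⟨h1, f', hf, h'⟩ := h
    refine ⟨fun σ hσ => hfg hσ ▸ h1 σ hσ, f', fun σ hσ => ?_, h'⟩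
    refine (hf σ hσ).congr_of_eventuallyEq ?_
    filter_upwards [isOpen_Ioo.mem_nhds hσ] with τ hτ using (hfg hτ).symm

theorem add (hf : SymbolBound p q n M₁ f) (hg : SymbolBound p q n M₂ g) :
    SymbolBound p q n (M₁ + M₂) (fun σ => f σ + g σ) := by
  induction n generalizing f g with
  | zero =>
    exact ⟨fun σ hσ => (norm_add_le _ _).trans (add_le_add (hf.1 σ hσ) (hg.1 σ hσ)), hf.2.add hg.2⟩
  | succ n ih =>
    obtain ⟨hf1, f', hfd, hf'⟩ := hf
    obtain ⟨hg1, g', hgd, hg'⟩ := hg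
    exact ⟨fun σ hσ => (norm_add_le _ _).trans (add_le_add (hf1 σ hσ) (hg1 σ hσ)), _,
      fun σ hσ => (hfd σ hσ).add (hgd σ hσ), ih hf' hg'⟩

/-- Leibniz' rule doubles the number of terms with each derivative, whence 2^n. -/
theorem mul (hM₁ : 0 ≤ M₁) (hM₂ : 0 ≤ M₂) (hf : SymbolBound p q n M₁ f)
    (hg : SymbolBound p q n M₂ g) :
    SymbolBound p q n (2 ^ n * (M₁ * M₂)) (fun σ => f σ * g σ) := by
  have key : ∀ {n : ℕ} {f g : ℝ → ℂ}, (∀ σ ∈ Ioo p q, ‖f σ‖ ≤ M₁) → (∀ σ ∈ Ioo p q, ‖g σ‖ ≤ M₂) →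
      ∀ σ ∈ Ioo p q, ‖f σ * g σ‖ ≤ 2 ^ n * (M₁ * M₂) := fun {n f g} hf hg σ hσ => by
    rw [norm_mul]
    have h1 := mul_le_mul (hf σ hσ) (hg σ hσ) (norm_nonneg _) hM₁
    have h2 : (1 : ℝ) ≤ 2 ^ n := one_le_pow₀ (by norm_num)
    nlinarith [mul_nonneg hM₁ hM₂]
  induction n generalizing f g with
  | zero => exact ⟨key hf.1 hg.1, hf.2.mul hg.2⟩
  | succ n ih =>
    have hf0 := hf.of_succ
    have hg0 := hg.of_succ
    obtain ⟨hf1, f', hfd, hf'⟩ := hf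
    obtain ⟨hg1, g', hgd, hg'⟩ := hg
    refine ⟨key hf1 hg1, _, fun σ hσ => (hfd σ hσ).mul (hgd σ hσ), ?_⟩
    have := (ih hf' hg0).add (ih hf0 hg')
    rwa [← two_mul, ← mul_assoc, ← pow_succ'] at this

theorem const_mul (c : ℂ) (hf : SymbolBound p q n M f) :
    SymbolBound p q n (‖c‖ * M) (fun σ => c * f σ) := by
  have key : ∀ {f : ℝ → ℂ}, (∀ σ ∈ Ioo p q, ‖f σ‖ ≤ M) → ∀ σ ∈ Ioo p q, ‖c * f σ‖ ≤ ‖c‖ * M :=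
    fun {f} hf σ hσ => by
      rw [norm_mul]
      exact mul_le_mul_of_nonneg_left (hf σ hσ) (norm_nonneg _)
  induction n generalizing f with
  | zero => exact ⟨key hf.1, continuousOn_const.mul hf.2⟩
  | succ n ih =>
    obtain ⟨hf1, f', hfd, hf'⟩ := hf
    exact ⟨key hf1, _, fun σ hσ => (hfd σ hσ).const_mul c, ih hf'⟩

end SymbolBound

/-! ### Model amplitudes: smooth functions, Gaussian phases, Bessel functions, reciprocals of linear
functions -/

theorem exists_symbolBound_of_contDiff (p q : ℝ) (n : ℕ) {f : ℝ → ℂ} (hf : ContDiff ℝ ∞ f) :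
    ∃ M : ℝ, 0 ≤ M ∧ SymbolBound p q n M f := by
  have key : ∀ f : ℝ → ℂ, Continuous f → ∃ M : ℝ, 0 ≤ M ∧ ∀ σ ∈ Ioo p q, ‖f σ‖ ≤ M := by
    intro f hf
    obtain ⟨M, hM⟩ := (isCompact_Icc (a := p) (b := q)).exists_bound_of_continuousOn hf.continuousOn
    exact ⟨max M 0, le_max_right _ _, fun σ hσ =>
      (hM σ (Ioo_subset_Icc_self hσ)).trans (le_max_left _ _)⟩
  induction n generalizing f with
  | zero =>
    obtain ⟨M, h0, hM⟩ := key f hf.continuous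
    exact ⟨M, h0, hM, hf.continuous.continuousOn⟩
  | succ n ih =>
    obtain ⟨M, h0, hM⟩ := key f hf.continuous
    obtain ⟨M', h0', hM'⟩ := ih (f := deriv f) (by
      exact ((contDiff_infty_iff_deriv).1 hf).2)
    refine ⟨max M M', le_max_of_le_left h0, fun σ hσ => (hM σ hσ).trans (le_max_left _ _), deriv f,
      fun σ _ => ?_, hM'.mono (le_max_right _ _)⟩
    exact (hf.differentiable (by simp) σ).hasDerivAt

/-- Each derivative brings down 2iTσ, which is bounded for bounded T. This lets e^{iTσ²} be counted
as part of the amplitude at small times. -/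
theorem exists_symbolBound_exp_sq (p q c : ℝ) (n : ℕ) :
    ∃ M : ℝ, 0 ≤ M ∧ ∀ T : ℝ, |T| ≤ c →
      SymbolBound p q n M (fun σ => Complex.exp (Complex.I * (T * σ ^ 2 : ℝ))) := by
  have hnorm : ∀ T σ : ℝ, ‖Complex.exp (Complex.I * (T * σ ^ 2 : ℝ))‖ = 1 := fun T σ => by
    rw [mul_comm, Complex.norm_exp_ofReal_mul_I]
  induction n with
  | zero =>
    exact ⟨1, zero_le_one, fun T _ => ⟨fun σ _ => (hnorm T σ).le, by fun_prop⟩⟩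
  | succ n ih =>
    obtain ⟨M, h0, hM⟩ := ih
    obtain ⟨L, hL0, hL⟩ := exists_symbolBound_of_contDiff p q n
      (f := fun σ : ℝ => (2 * Complex.I) * (σ : ℂ))
      (contDiff_const.mul Complex.ofRealCLM.contDiff)
    refine ⟨max 1 (2 ^ n * (|c| * L * M)), by positivity, fun T hT =>
      ⟨fun σ _ => (hnorm T σ).le.trans (le_max_left _ _), _, fun σ _ => ?_,
      (SymbolBound.mul (mul_nonneg (abs_nonneg c) hL0) h0
        ((hL.const_mul (T : ℂ)).mono ?_) (hM T hT)).mono (le_max_right _ _)⟩⟩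
    · have h1 : HasDerivAt (fun σ : ℝ => Complex.I * (T * σ ^ 2 : ℝ))
          (Complex.I * (T * (2 * σ) : ℝ)) σ := by
        refine HasDerivAt.const_mul _ ?_
        simpa using (((hasDerivAt_pow 2 σ).const_mul T)).ofReal_comp
      refine h1.cexp.congr_deriv ?_
      push_cast
      ring
    · rw [Complex.norm_real]
      exact mul_le_mul_of_nonneg_right (hT.trans (le_abs_self c)) hL0

/-- Differentiation under the integral replaces g by iY cos θ · g, again continuous and bounded by G
because Y ≤ 1. The general density g is there to make the induction close. -/
theorem symbolBound_integral_exp_cos {p q Y G : ℝ} (n : ℕ) (hY0 : 0 ≤ Y) (hY : Y ≤ 1)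
    {g : ℝ → ℂ} (hg : Continuous g) (hG : ∀ θ, ‖g θ‖ ≤ G) :
    SymbolBound p q n (2 * Real.pi * G) (fun σ => ∫ θ in (0 : ℝ)..(2 * Real.pi),
      Complex.exp (Complex.I * (σ * Y * Real.cos θ : ℝ)) * g θ) := by
  have hnorm : ∀ σ θ : ℝ, ‖Complex.exp (Complex.I * (σ * Y * Real.cos θ : ℝ))‖ = 1 := fun T σ => by
    rw [mul_comm, Complex.norm_exp_ofReal_mul_I]
  have hbd : ∀ (g : ℝ → ℂ), (∀ θ, ‖g θ‖ ≤ G) → ∀ σ ∈ Ioo p q, ‖∫ θ in (0 : ℝ)..(2 * Real.pi),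
      Complex.exp (Complex.I * (σ * Y * Real.cos θ : ℝ)) * g θ‖ ≤ 2 * Real.pi * G := by
    intro g hG σ _
    refine (intervalIntegral.norm_integral_le_of_norm_le_const (C := G) fun θ _ => ?_).trans ?_
    · rw [norm_mul, hnorm, one_mul]; exact hG θ
    · rw [sub_zero, abs_of_pos (by positivity), mul_comm]
  have hder : ∀ (g : ℝ → ℂ), Continuous g → (∀ θ, ‖g θ‖ ≤ G) → ∀ σ : ℝ,
      HasDerivAt (fun σ : ℝ => ∫ θ in (0 : ℝ)..(2 * Real.pi),
        Complex.exp (Complex.I * (σ * Y * Real.cos θ : ℝ)) * g θ)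
      (∫ θ in (0 : ℝ)..(2 * Real.pi),
        Complex.exp (Complex.I * (σ * Y * Real.cos θ : ℝ)) * ((Y * Real.cos θ : ℝ) * Complex.I * g θ)) σ := by
    intro g hg hG σ
    refine (intervalIntegral.hasDerivAt_integral_of_dominated_loc_of_deriv_le
      (𝕜 := ℝ) (μ := volume) (a := 0) (b := 2 * Real.pi) (x₀ := σ)
      (F := fun τ θ : ℝ => Complex.exp (Complex.I * (τ * Y * Real.cos θ : ℝ)) * g θ)
      (F' := fun τ θ : ℝ => Complex.exp (Complex.I * (τ * Y * Real.cos θ : ℝ)) *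
        ((Y * Real.cos θ : ℝ) * Complex.I * g θ))
      (s := univ) (bound := fun _ => G) univ_mem (Eventually.of_forall fun τ => ?_) ?_ ?_
      (Eventually.of_forall fun θ _ τ _ => ?_)
      (continuous_const.intervalIntegrable _ _)
      (Eventually.of_forall fun θ _ τ _ => ?_)).2
    · exact (by fun_prop : Continuous fun θ : ℝ =>
        Complex.exp (Complex.I * (τ * Y * Real.cos θ : ℝ)) * g θ).aestronglyMeasurable
    · exact (by fun_prop : Continuous fun θ : ℝ =>
        Complex.exp (Complex.I * (σ * Y * Real.cos θ : ℝ)) * g θ).intervalIntegrable _ _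
    · exact (by fun_prop : Continuous fun θ : ℝ => Complex.exp (Complex.I * (σ * Y * Real.cos θ : ℝ)) *
        ((Y * Real.cos θ : ℝ) * Complex.I * g θ)).aestronglyMeasurable
    · rw [norm_mul, hnorm, one_mul, norm_mul, norm_mul, Complex.norm_I, Complex.norm_real, mul_one]
      have h1 : ‖Y * Real.cos θ‖ ≤ 1 := by
        rw [Real.norm_eq_abs, abs_mul, abs_of_nonneg hY0]
        exact mul_le_one₀ hY (abs_nonneg _) (Real.abs_cos_le_one θ)
      nlinarith [hG θ, norm_nonneg (g θ)]
    · have h1 : HasDerivAt (fun σ : ℝ => Complex.I * (σ * Y * Real.cos θ : ℝ))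
          (Complex.I * (1 * Y * Real.cos θ : ℝ)) τ :=
        HasDerivAt.const_mul _ (((hasDerivAt_id τ).mul_const Y).mul_const _).ofReal_comp
      refine (h1.cexp.mul_const (g θ)).congr_deriv ?_
      push_cast
      ring
  induction n generalizing g with
  | zero => exact ⟨hbd g hG, fun σ _ => (hder g hg hG σ).continuousAt.continuousWithinAt⟩
  | succ n ih =>
    refine ⟨hbd g hG, _, fun σ _ => hder g hg hG σ, ih (by fun_prop) fun θ => ?_⟩
    rw [norm_mul, norm_mul, Complex.norm_I, Complex.norm_real, mul_one]
    have h1 : ‖Y * Real.cos θ‖ ≤ 1 := by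
      rw [Real.norm_eq_abs, abs_mul, abs_of_nonneg hY0]
      exact mul_le_one₀ hY (abs_nonneg _) (Real.abs_cos_le_one θ)
    nlinarith [hG θ, norm_nonneg (g θ)]

theorem symbolBound_besselJ0 {p q Y : ℝ} (n : ℕ) (hY0 : 0 ≤ Y) (hY : Y ≤ 1) :
    SymbolBound p q n 1 (fun σ => besselJ0 (σ * Y)) := by
  have h := (symbolBound_integral_exp_cos (p := p) (q := q) (G := 1) n hY0 hY (g := fun _ => 1)
    continuous_const (by simp)).const_mul (2 * Real.pi : ℂ)⁻¹
  refine (h.mono ?_).congr fun σ _ => ?_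
  · rw [norm_inv, norm_mul, Complex.norm_real, Real.norm_of_nonneg Real.pi_pos.le]
    have := Real.pi_pos
    norm_num
    field_simp
    exact le_rfl
  · simp only [mul_one, besselJ0]

/-- The function f = l/(2Tσ + β) is bounded by 1 and satisfies f' = -(2T/l) f², where |T|/l ≤ c. All
derivatives are therefore controlled by c alone. -/
theorem exists_symbolBound_inv (p q c : ℝ) (n : ℕ) :
    ∃ Q : ℝ, 0 ≤ Q ∧ ∀ T β l : ℝ, 0 < l → |T| ≤ c * l →
      (∀ σ ∈ Ioo p q, l ≤ |2 * T * σ + β|) →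
      SymbolBound p q n Q (fun σ => ((l / (2 * T * σ + β) : ℝ) : ℂ)) := by
  have hbd : ∀ T β l : ℝ, 0 < l → (∀ σ ∈ Ioo p q, l ≤ |2 * T * σ + β|) →
      ∀ σ ∈ Ioo p q, ‖((l / (2 * T * σ + β) : ℝ) : ℂ)‖ ≤ 1 := by
    intro T β l hl h σ hσ
    rw [Complex.norm_real, Real.norm_eq_abs, abs_div, abs_of_pos hl]
    exact div_le_one_of_le₀ (h σ hσ) (abs_nonneg _)
  have hder : ∀ T β l : ℝ, 0 < l → (∀ σ ∈ Ioo p q, l ≤ |2 * T * σ + β|) →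
      ∀ σ ∈ Ioo p q, HasDerivAt (fun σ : ℝ => ((l / (2 * T * σ + β) : ℝ) : ℂ))
        (((-(2 * T / l) : ℝ) : ℂ) * (((l / (2 * T * σ + β) : ℝ) : ℂ) *
          ((l / (2 * T * σ + β) : ℝ) : ℂ))) σ := by
    intro T β l hl h σ hσ
    have hne : 2 * T * σ + β ≠ 0 := fun h0 => by
      have := h σ hσ
      rw [h0, abs_zero] at this
      linarith
    have h1 : HasDerivAt (fun σ : ℝ => 2 * T * σ + β) (2 * T) σ := by
      simpa using ((hasDerivAt_id σ).const_mul (2 * T)).add_const β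
    have h2 := ((hasDerivAt_const σ l).div h1 hne).ofReal_comp
    refine h2.congr_deriv ?_
    rw [← Complex.ofReal_mul, ← Complex.ofReal_mul]
    congr 1
    field_simp
    ring
  induction n with
  | zero =>
    exact ⟨1, zero_le_one, fun T β l hl _ h => ⟨hbd T β l hl h, fun σ hσ =>
      (hder T β l hl h σ hσ).continuousAt.continuousWithinAt⟩⟩
  | succ n ih =>
    obtain ⟨Q, hQ0, hQ⟩ := ih
    refine ⟨max 1 (2 * |c| * (2 ^ n * (Q * Q))), by positivity, fun T β l hl hT h =>
      ⟨fun σ hσ => (hbd T β l hl h σ hσ).trans (le_max_left _ _), _, hder T β l hl h, ?_⟩⟩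
    have h1 := hQ T β l hl hT h
    refine ((SymbolBound.mul hQ0 hQ0 h1 h1).const_mul _).mono (le_max_of_le_right ?_)
    refine mul_le_mul_of_nonneg_right ?_ (by positivity)
    rw [Complex.norm_real, norm_neg, Real.norm_eq_abs, abs_div, abs_mul, abs_two, abs_of_pos hl,
      div_le_iff₀ hl]
    nlinarith [le_abs_self c]

/-! ### Oscillatory integrals with quadratic phase -/

/-- The amplitude vanishes on `(p, q)` outside `(p₁, q₁)`. -/
theorem deriv_eq_zero_of_vanishing {p p₁ q₁ q : ℝ} {f f' : ℝ → ℂ}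
    (hd : ∀ σ ∈ Ioo p q, HasDerivAt f (f' σ) σ)
    (hf : ∀ σ ∈ Ioo p q, σ ∉ Ioo p₁ q₁ → f σ = 0) :
    ∀ σ ∈ Ioo p q, σ ∉ Ioo p₁ q₁ → f' σ = 0 := by
  intro σ hσ hn
  have hcase : σ ≤ p₁ ∨ q₁ ≤ σ := by
    by_contra! h
    exact hn ⟨h.1, h.2⟩
  -- A derivative taken within a set on which f vanishes is zero. Half-open intervals ending at p₁
  -- or q₁ are used so that the endpoints themselves are covered, where boundary terms will be
  -- evaluated.
  have key : ∀ s : Set ℝ, UniqueDiffOn ℝ s → σ ∈ s → s ⊆ Ioo p q → (∀ τ ∈ s, τ ∉ Ioo p₁ q₁) →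
      f' σ = 0 := by
    intro s hs hσs hsub hs'
    have h1 : HasDerivWithinAt f (f' σ) s σ := (hd σ hσ).hasDerivWithinAt
    have h2 : HasDerivWithinAt f 0 s σ :=
      (hasDerivWithinAt_const σ s (0 : ℂ)).congr (fun τ hτ => hf τ (hsub hτ) (hs' τ hτ))
        (hf σ hσ hn)
    exact (hs σ hσs).eq_deriv s h1 h2
  rcases hcase with h | h
  · by_cases h' : p₁ < q
    · exact key (Ioc p p₁) (uniqueDiffOn_Ioc p p₁) ⟨hσ.1, h⟩
        (fun τ hτ => ⟨hτ.1, hτ.2.trans_lt h'⟩) fun τ hτ hτ' => absurd hτ'.1 (not_lt.2 hτ.2)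
    · exact key (Ioo p q) (uniqueDiffOn_Ioo p q) hσ subset_rfl
        fun τ hτ hτ' => absurd (hτ'.1.trans hτ.2) h'
  · by_cases h' : p < q₁
    · exact key (Ico q₁ q) (uniqueDiffOn_Ico q₁ q) ⟨h, hσ.2⟩
        (fun τ hτ => ⟨h'.trans_le hτ.1, hτ.2⟩) fun τ hτ hτ' => absurd hτ'.2 (not_lt.2 hτ.1)
    · exact key (Ioo p q) (uniqueDiffOn_Ioo p q) hσ subset_rfl
        fun τ hτ hτ' => absurd (hτ.1.trans hτ'.2) h'

theorem hasDerivAt_quadratic_phase (T β σ : ℝ) :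
    HasDerivAt (fun σ : ℝ => Complex.exp (Complex.I * (T * σ ^ 2 + β * σ : ℝ)))
      (Complex.exp (Complex.I * (T * σ ^ 2 + β * σ : ℝ)) * (Complex.I * (2 * T * σ + β : ℝ))) σ := by
  have h1 : HasDerivAt (fun σ : ℝ => Complex.I * (T * σ ^ 2 + β * σ : ℝ))
      (Complex.I * (T * (2 * σ) + β : ℝ)) σ := by
    refine HasDerivAt.const_mul _ (HasDerivAt.ofReal_comp ?_)
    exact (((hasDerivAt_pow 2 σ).const_mul T).add ((hasDerivAt_id σ).const_mul β)).congr_deriv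
      (by simp)
  refine h1.cexp.congr_deriv ?_
  push_cast
  ring

theorem norm_quadratic_phase (T β σ : ℝ) :
    ‖Complex.exp (Complex.I * (T * σ ^ 2 + β * σ : ℝ))‖ = 1 := by
  rw [mul_comm, Complex.norm_exp_ofReal_mul_I]

/-- Non-stationary phase for quadratic phases. -/
theorem exists_nonstationary_bound {p p₁ q₁ q : ℝ} (hp : p < p₁) (hpq : p₁ < q₁) (hq : q₁ < q)
    (c : ℝ) (m : ℕ) :
    ∃ D : ℝ, 0 ≤ D ∧ ∀ (T β l M : ℝ) (A : ℝ → ℂ), 0 < l → |T| ≤ c * l →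
      (∀ σ ∈ Ioo p q, l ≤ |2 * T * σ + β|) → 0 ≤ M → SymbolBound p q m M A →
      (∀ σ ∈ Ioo p q, σ ∉ Ioo p₁ q₁ → A σ = 0) →
      ‖∫ σ in p₁..q₁, Complex.exp (Complex.I * (T * σ ^ 2 + β * σ : ℝ)) * A σ‖ ≤ D * M / l ^ m := by
  have hsub : Icc p₁ q₁ ⊆ Ioo p q := fun σ hσ => ⟨hp.trans_le hσ.1, hσ.2.trans_lt hq⟩
  induction m with
  | zero =>
    refine ⟨q₁ - p₁, by linarith, fun T β l M A hl _ _ hM hA _ => ?_⟩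
    refine (intervalIntegral.norm_integral_le_of_norm_le_const (C := M) fun σ hσ => ?_).trans ?_
    · rw [norm_mul, norm_quadratic_phase, one_mul]
      rw [uIoc_of_le hpq.le] at hσ
      exact hA.norm_le σ (hsub (Ioc_subset_Icc_self hσ))
    · rw [abs_of_pos (by linarith), pow_zero, div_one, mul_comm]
  | succ m ih =>
    obtain ⟨D, hD0, hD⟩ := ih
    obtain ⟨Q, hQ0, hQ⟩ := exists_symbolBound_inv p q c (m + 1)
    refine ⟨D * (2 ^ (m + 1) * Q), by positivity, fun T β l M A hl hT hΦ hM hA hv => ?_⟩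
    have hg := hQ T β l hl hT hΦ
    have hG := SymbolBound.mul hQ0 hM hg hA
    obtain ⟨-, h, hd, hh⟩ := hG
    have hvG : ∀ σ ∈ Ioo p q, σ ∉ Ioo p₁ q₁ → ((l / (2 * T * σ + β) : ℝ) : ℂ) * A σ = 0 :=
      fun σ hσ hn => by rw [hv σ hσ hn, mul_zero]
    have hvh := deriv_eq_zero_of_vanishing hd hvG
    have hIH := hD T β l _ h hl hT hΦ (by positivity) hh hvh
    have hne : ∀ σ ∈ Ioo p q, 2 * T * σ + β ≠ 0 := fun σ hσ h0 => by
      have := hΦ σ hσ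
      rw [h0, abs_zero] at this
      linarith
    have hu : uIcc p₁ q₁ ⊆ Ioo p q := by rw [uIcc_of_le hpq.le]; exact hsub
    have hcA : ContinuousOn (fun σ : ℝ => Complex.exp (Complex.I * (T * σ ^ 2 + β * σ : ℝ)) * A σ)
        (uIcc p₁ q₁) := ContinuousOn.mul (by fun_prop) (hA.continuousOn.mono hu)
    have hch : ContinuousOn (fun σ : ℝ => Complex.exp (Complex.I * (T * σ ^ 2 + β * σ : ℝ)) * h σ)
        (uIcc p₁ q₁) := ContinuousOn.mul (by fun_prop) (hh.continuousOn.mono hu)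
    -- One integration by parts: with Φ' = 2Tσ + β, the derivative of e^{iΦ}(l/Φ')A is il e^{iΦ}A +
    -- e^{iΦ}h. The boundary values vanish, so one factor 1/l is gained and h is again an amplitude
    -- of the same kind.
    have hparts := intervalIntegral.integral_eq_sub_of_hasDerivAt (a := p₁) (b := q₁)
      (f := fun σ : ℝ => Complex.exp (Complex.I * (T * σ ^ 2 + β * σ : ℝ)) *
        (((l / (2 * T * σ + β) : ℝ) : ℂ) * A σ))
      (f' := fun σ : ℝ => (Complex.I * l) * (Complex.exp (Complex.I * (T * σ ^ 2 + β * σ : ℝ)) * A σ)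
        + Complex.exp (Complex.I * (T * σ ^ 2 + β * σ : ℝ)) * h σ)
      (fun σ hσ => by
        refine ((hasDerivAt_quadratic_phase T β σ).mul (hd σ (hu hσ))).congr_deriv ?_
        congr 1
        have hc : ((2 * T * σ + β : ℝ) : ℂ) * ((l / (2 * T * σ + β) : ℝ) : ℂ) = l := by
          rw [← Complex.ofReal_mul, mul_div_cancel₀ _ (hne σ (hu hσ))]
        linear_combination (Complex.exp (Complex.I * (T * σ ^ 2 + β * σ : ℝ)) * Complex.I * A σ) * hc)
      ((hcA.const_smul (Complex.I * (l : ℂ))).add hch).intervalIntegrable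
    rw [hvG q₁ (hsub ⟨hpq.le, le_rfl⟩) (fun h => lt_irrefl _ h.2),
      hvG p₁ (hsub ⟨le_rfl, hpq.le⟩) (fun h => lt_irrefl _ h.1), mul_zero, mul_zero, sub_zero,
      intervalIntegral.integral_add ((hcA.intervalIntegrable).const_mul _) hch.intervalIntegrable,
      intervalIntegral.integral_const_mul] at hparts
    have heq : ‖(Complex.I * l) * ∫ σ in p₁..q₁, Complex.exp (Complex.I * (T * σ ^ 2 + β * σ : ℝ)) * A σ‖ =
        ‖∫ σ in p₁..q₁, Complex.exp (Complex.I * (T * σ ^ 2 + β * σ : ℝ)) * h σ‖ := by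
      rw [eq_neg_of_add_eq_zero_left hparts, norm_neg]
    rw [norm_mul, norm_mul, Complex.norm_I, one_mul, Complex.norm_real,
      Real.norm_of_nonneg hl.le] at heq
    rw [← heq] at hIH
    rw [pow_succ l, ← div_div, le_div_iff₀ hl, mul_comm]
    refine hIH.trans (le_of_eq ?_)
    ring

/-- After rescaling by √T the integral is an increment of arctan, hence at most π. -/
theorem integral_inv_one_add_le {p₁ q₁ T σ₀ : ℝ} (hT : 0 < T) :
    ∫ σ in p₁..q₁, (1 + T * (σ - σ₀) ^ 2)⁻¹ ≤ Real.pi / Real.sqrt T := by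
  have hs : 0 < Real.sqrt T := Real.sqrt_pos.2 hT
  have h := intervalIntegral.integral_comp_mul_sub (a := p₁) (b := q₁)
    (fun x : ℝ => (1 + x ^ 2)⁻¹) hs.ne' (Real.sqrt T * σ₀)
  rw [integral_inv_one_add_sq] at h
  have e : ∀ σ : ℝ, (1 + (Real.sqrt T * σ - Real.sqrt T * σ₀) ^ 2)⁻¹ = (1 + T * (σ - σ₀) ^ 2)⁻¹ := by
    intro σ
    rw [← mul_sub, mul_pow, Real.sq_sqrt hT.le]
  simp only [e] at h
  rw [h, smul_eq_mul, div_eq_inv_mul]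
  refine mul_le_mul_of_nonneg_left ?_ (by positivity)
  linarith [Real.arctan_lt_pi_div_two (Real.sqrt T * q₁ - Real.sqrt T * σ₀),
    Real.neg_pi_div_two_lt_arctan (Real.sqrt T * p₁ - Real.sqrt T * σ₀)]

/-- Van der Corput's bound for quadratic phases. -/
theorem stationary_bound {p p₁ q₁ q T β M : ℝ} {A : ℝ → ℂ} (hp : p < p₁) (hpq : p₁ < q₁)
    (hq : q₁ < q) (hT : 0 < T) (hM : 0 ≤ M) (hA : SymbolBound p q 1 M A)
    (hv : ∀ σ ∈ Ioo p q, σ ∉ Ioo p₁ q₁ → A σ = 0) :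
    ‖∫ σ in p₁..q₁, Complex.exp (Complex.I * (T * σ ^ 2 + β * σ : ℝ)) * A σ‖ ≤
      ((q₁ - p₁) + 3 * Real.pi) * M / Real.sqrt T := by
  have hs : 0 < Real.sqrt T := Real.sqrt_pos.2 hT
  have hsub : Icc p₁ q₁ ⊆ Ioo p q := fun σ hσ => ⟨hp.trans_le hσ.1, hσ.2.trans_lt hq⟩
  have hu : uIcc p₁ q₁ ⊆ Ioo p q := by rw [uIcc_of_le hpq.le]; exact hsub
  have hAc := hA.continuousOn
  obtain ⟨hA1, A', hd, hA'⟩ := hA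
  set σ₀ : ℝ := -β / (2 * T) with hσ₀
  have hβ : ∀ σ : ℝ, 2 * T * σ + β = 2 * T * (σ - σ₀) := fun σ => by
    rw [hσ₀]; field_simp; ring
  -- With multiplier (σ - σ₀)/R one integration by parts works through the stationary point. Since
  -- iΦ'·(σ - σ₀) = R - 1, differentiating e^{iΦ}(σ - σ₀)/R gives e^{iΦ}(1 - 4iT(σ - σ₀)²/R²), and
  -- Re R = 1 prevents any division by zero.
  obtain ⟨R, hRdef⟩ : ∃ R : ℝ → ℂ, ∀ σ, R σ = 1 + 2 * Complex.I * T * ((σ - σ₀ : ℝ) : ℂ) ^ 2 :=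
    ⟨_, fun _ => rfl⟩
  have hRre : ∀ σ, (R σ).re = 1 := fun σ => by
    simp [hRdef, pow_two]
  have hRim : ∀ σ, (R σ).im = 2 * (T * (σ - σ₀) ^ 2) := fun σ => by
    simp [hRdef, pow_two]; ring
  have hR0 : ∀ σ, R σ ≠ 0 := fun σ h => by
    have := hRre σ
    rw [h] at this
    simp at this
  have hRn : ∀ σ, ‖R σ‖ ^ 2 = 1 + 4 * (T * (σ - σ₀) ^ 2) ^ 2 := fun σ => by
    rw [← Complex.normSq_eq_norm_sq, Complex.normSq_apply, hRre, hRim]; ring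
  have hRd : ∀ σ : ℝ, HasDerivAt R (4 * Complex.I * T * ((σ - σ₀ : ℝ) : ℂ)) σ := fun σ => by
    have h0 : HasDerivAt (fun σ : ℝ => ((σ - σ₀ : ℝ) : ℂ)) ((1 : ℝ) : ℂ) σ :=
      ((hasDerivAt_id σ).sub_const σ₀).ofReal_comp
    rw [funext hRdef]
    refine (((h0.pow 2).const_mul (2 * Complex.I * (T : ℂ))).const_add 1).congr_deriv ?_
    push_cast
    ring
  have hRc : Continuous R := by
    rw [funext hRdef]
    fun_prop
  have hcA : ContinuousOn (fun σ : ℝ => Complex.exp (Complex.I * (T * σ ^ 2 + β * σ : ℝ)) * A σ)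
      (uIcc p₁ q₁) := ContinuousOn.mul (by fun_prop) (hAc.mono hu)
  let rem : ℝ → ℂ := fun σ => Complex.exp (Complex.I * (T * σ ^ 2 + β * σ : ℝ)) *
    (((σ - σ₀ : ℝ) : ℂ) / R σ * A' σ -
      4 * Complex.I * T * ((σ - σ₀ : ℝ) : ℂ) ^ 2 / R σ ^ 2 * A σ)
  have hcr : ContinuousOn rem (uIcc p₁ q₁) := by
    refine ContinuousOn.mul (by fun_prop) (ContinuousOn.sub
      (ContinuousOn.mul (ContinuousOn.div (by fun_prop) hRc.continuousOn fun σ _ => hR0 σ)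
        (hA'.continuousOn.mono hu))
      (ContinuousOn.mul (ContinuousOn.div (by fun_prop) (hRc.pow 2).continuousOn
        fun σ _ => pow_ne_zero 2 (hR0 σ)) (hAc.mono hu)))
  have hparts := intervalIntegral.integral_eq_sub_of_hasDerivAt (a := p₁) (b := q₁)
    (f := fun σ : ℝ => Complex.exp (Complex.I * (T * σ ^ 2 + β * σ : ℝ)) *
      (((σ - σ₀ : ℝ) : ℂ) / R σ * A σ))
    (f' := fun σ : ℝ => Complex.exp (Complex.I * (T * σ ^ 2 + β * σ : ℝ)) * A σ + rem σ)
    (fun σ hσ => by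
      have h0 : HasDerivAt (fun σ : ℝ => ((σ - σ₀ : ℝ) : ℂ)) ((1 : ℝ) : ℂ) σ :=
        ((hasDerivAt_id σ).sub_const σ₀).ofReal_comp
      refine ((hasDerivAt_quadratic_phase T β σ).mul
        ((h0.div (hRd σ) (hR0 σ)).mul (hd σ (hu hσ)))).congr_deriv ?_
      simp only [rem]
      rw [hβ]
      have hR := hR0 σ
      have e := hRdef σ
      simp only [Pi.div_apply, Pi.mul_apply]
      generalize R σ = r at *
      have e2 : Complex.I * ((2 * T * (σ - σ₀) : ℝ) : ℂ) * ((σ - σ₀ : ℝ) : ℂ) = r - 1 := by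
        rw [e]; push_cast; ring
      field_simp
      push_cast at e2 ⊢
      linear_combination A σ * r * e2)
    (hcA.add hcr).intervalIntegrable
  rw [hv q₁ (hsub ⟨hpq.le, le_rfl⟩) (fun h => lt_irrefl _ h.2),
      hv p₁ (hsub ⟨le_rfl, hpq.le⟩) (fun h => lt_irrefl _ h.1), mul_zero, mul_zero, mul_zero, mul_zero,
      sub_zero, intervalIntegral.integral_add hcA.intervalIntegrable hcr.intervalIntegrable] at hparts
  rw [eq_neg_of_add_eq_zero_left hparts, norm_neg]
  have hci : Continuous fun σ : ℝ => 3 * M * (1 + T * (σ - σ₀) ^ 2)⁻¹ := by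
    refine continuous_const.mul (Continuous.inv₀ (by fun_prop) fun σ => ?_)
    positivity
  have hcb : Continuous fun σ : ℝ => M / Real.sqrt T + 3 * M * (1 + T * (σ - σ₀) ^ 2)⁻¹ :=
    continuous_const.add hci
  refine (intervalIntegral.norm_integral_le_of_norm_le hpq.le
    (g := fun σ => M / Real.sqrt T + 3 * M * (1 + T * (σ - σ₀) ^ 2)⁻¹)
    (Eventually.of_forall fun σ hσ => ?_) (hcb.intervalIntegrable _ _)).trans ?_
  · have hσ' := hsub (Ioc_subset_Icc_self hσ)
    simp only [rem]
    rw [norm_mul, norm_quadratic_phase, one_mul]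
    have hn0 : 0 < ‖R σ‖ := norm_pos_iff.2 (hR0 σ)
    set v : ℝ := T * (σ - σ₀) ^ 2 with hvdef
    have hv0 : 0 ≤ v := by positivity
    refine (norm_sub_le _ _).trans (add_le_add ?_ ?_)
    · rw [norm_mul, norm_div, Complex.norm_real, Real.norm_eq_abs]
      -- Squared, this says v ≤ 1 + 4v² for v = T(σ - σ₀)².
      have h1 : |σ - σ₀| / ‖R σ‖ ≤ 1 / Real.sqrt T := by
        rw [div_le_div_iff₀ hn0 hs, one_mul]
        refine abs_le_of_sq_le_sq' ?_ hn0.le |>.2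
        rw [mul_pow, sq_abs, Real.sq_sqrt hT.le, hRn σ, mul_comm]
        nlinarith [sq_nonneg (2 * v - 1 / 2)]
      have h2 := hA'.norm_le σ hσ'
      calc _ ≤ 1 / Real.sqrt T * M := mul_le_mul h1 h2 (norm_nonneg _) (by positivity)
        _ = _ := by ring
    · rw [norm_mul, norm_div, norm_pow, hRn σ]
      have h1 : ‖4 * Complex.I * (T : ℂ) * ((σ - σ₀ : ℝ) : ℂ) ^ 2‖ = 4 * v := by
        rw [norm_mul, norm_mul, norm_mul, norm_pow, Complex.norm_I, Complex.norm_real,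
          Complex.norm_real, Real.norm_of_nonneg hT.le, Real.norm_eq_abs, sq_abs]
        norm_num [hvdef]
        ring
      -- The other remainder is reduced to a Lorentzian of width T^{-1/2}, whose integral is at most
      -- π/√T.
      have h3 : 4 * v / (1 + 4 * v ^ 2) ≤ 3 * (1 + v)⁻¹ := by
        rw [← div_eq_mul_inv, div_le_div_iff₀ (by positivity) (by positivity)]
        nlinarith [sq_nonneg (v - 1 / 4)]
      rw [h1]
      calc _ ≤ 3 * (1 + v)⁻¹ * M := mul_le_mul h3 (hA1 σ hσ') (norm_nonneg _) (by positivity)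
        _ = _ := by ring
  · rw [intervalIntegral.integral_add intervalIntegrable_const
      (hci.intervalIntegrable _ _), intervalIntegral.integral_const, intervalIntegral.integral_const_mul,
      smul_eq_mul]
    have := mul_le_mul_of_nonneg_left (integral_inv_one_add_le (p₁ := p₁) (q₁ := q₁) (σ₀ := σ₀) hT)
      (by positivity : 0 ≤ 3 * M)
    calc _ ≤ (q₁ - p₁) * (M / Real.sqrt T) + 3 * M * (Real.pi / Real.sqrt T) := by linarith
      _ = _ := by ring

/-! ### Laplace transforms as amplitudes -/

section Laplace

variable {w : ℝ → ℂ} {C s r : ℝ}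

theorem norm_exp_mul_weight_le (hw : ∀ u, 0 < u → ‖w u‖ ≤ C * u ^ s) (r : ℝ) {u : ℝ} (hu : 0 < u) :
    ‖(Real.exp (-(r * u)) : ℂ) * w u‖ ≤ C * (Real.exp (-(r * u)) * u ^ s) := by
  rw [norm_mul, Complex.norm_real, Real.norm_of_nonneg (Real.exp_pos _).le]
  calc _ ≤ Real.exp (-(r * u)) * (C * u ^ s) :=
        mul_le_mul_of_nonneg_left (hw u hu) (Real.exp_pos _).le
    _ = _ := by ring

theorem integrableOn_laplace (hs : -1 < s) (hwm : Measurable w)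
    (hw : ∀ u, 0 < u → ‖w u‖ ≤ C * u ^ s) (hr : 0 < r) :
    IntegrableOn (fun u : ℝ => (Real.exp (-(r * u)) : ℂ) * w u) (Ioi 0) := by
  refine Integrable.mono' ((integrableOn_exp_mul_rpow hr hs).const_mul C)
    (by fun_prop) ?_
  exact (ae_restrict_iff' measurableSet_Ioi).2
    (Eventually.of_forall fun u hu => norm_exp_mul_weight_le hw r hu)

theorem norm_laplace_le (hs : -1 < s) (hw : ∀ u, 0 < u → ‖w u‖ ≤ C * u ^ s) (hr : 0 < r) :
    ‖laplace w r‖ ≤ C * ∫ u in Ioi (0 : ℝ), Real.exp (-(r * u)) * u ^ s := by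
  rw [← integral_const_mul]
  refine norm_integral_le_of_norm_le ((integrableOn_exp_mul_rpow hr hs).const_mul C) ?_
  exact (ae_restrict_iff' measurableSet_Ioi).2
    (Eventually.of_forall fun u hu => norm_exp_mul_weight_le hw r hu)

theorem integral_exp_mul_rpow_anti {p : ℝ} (hs : -1 < s) (hp : 0 < p) (hr : p ≤ r) :
    ∫ u in Ioi (0 : ℝ), Real.exp (-(r * u)) * u ^ s ≤
      ∫ u in Ioi (0 : ℝ), Real.exp (-(p * u)) * u ^ s := by
  refine setIntegral_mono_on (integrableOn_exp_mul_rpow (hp.trans_le hr) hs)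
    (integrableOn_exp_mul_rpow hp hs) measurableSet_Ioi fun u hu => ?_
  have hu' : (0 : ℝ) < u := hu
  gcongr

theorem norm_neg_mul_weight_le (hw : ∀ u, 0 < u → ‖w u‖ ≤ C * u ^ s) :
    ∀ u : ℝ, 0 < u → ‖(-(u : ℂ)) * w u‖ ≤ C * u ^ (s + 1) := fun u hu => by
  rw [norm_mul, norm_neg, Complex.norm_real, Real.norm_of_nonneg hu.le, Real.rpow_add_one hu.ne']
  nlinarith [hw u hu]

theorem hasDerivAt_laplace (hs : -1 < s) (hwm : Measurable w)
    (hw : ∀ u, 0 < u → ‖w u‖ ≤ C * u ^ s) (hr : 0 < r) :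
    HasDerivAt (laplace w) (laplace (fun u => -(u : ℂ) * w u) r) r := by
  have hw' := norm_neg_mul_weight_le hw
  have hC : 0 ≤ C := by
    have := hw 1 one_pos
    rw [Real.one_rpow, mul_one] at this
    exact (norm_nonneg _).trans this
  -- On the neighbourhood τ > r/2 of r, the derivatives in τ are dominated by C e^{-ru/2} u^{s+1}.
  refine (hasDerivAt_integral_of_dominated_loc_of_deriv_le (𝕜 := ℝ) (μ := volume.restrict (Ioi 0))
    (x₀ := r) (s := Ioi (r / 2))
    (F := fun τ u : ℝ => (Real.exp (-(τ * u)) : ℂ) * w u)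
    (F' := fun τ u : ℝ => (Real.exp (-(τ * u)) : ℂ) * (-(u : ℂ) * w u))
    (bound := fun u => C * (Real.exp (-(r / 2 * u)) * u ^ (s + 1)))
    (Ioi_mem_nhds (by linarith)) (Eventually.of_forall fun τ => ?_)
    (integrableOn_laplace hs hwm hw hr) ?_ ?_
    ((integrableOn_exp_mul_rpow (by linarith) (by linarith)).const_mul C) ?_).2
  · exact Measurable.aestronglyMeasurable (by fun_prop)
  · exact Measurable.aestronglyMeasurable (by fun_prop)
  · refine (ae_restrict_iff' measurableSet_Ioi).2 (Eventually.of_forall fun u hu τ hτ => ?_)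
    refine (norm_exp_mul_weight_le hw' τ hu).trans ?_
    have hu' : (0 : ℝ) < u := hu
    have hτ' : r / 2 < τ := hτ
    gcongr
  · refine (ae_restrict_iff' measurableSet_Ioi).2 (Eventually.of_forall fun u hu τ hτ => ?_)
    have h1 : HasDerivAt (fun τ : ℝ => Real.exp (-(τ * u))) (Real.exp (-(τ * u)) * (-(1 * u))) τ :=
      (((hasDerivAt_id τ).mul_const u).neg).exp
    refine (h1.ofReal_comp.mul_const (w u)).congr_deriv ?_
    push_cast
    ring

/-- Differentiating multiplies the weight by -u and raises s to s + 1, so the induction runs over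
all s > -1. For σ > p the majorant e^{-σu} u^s is largest at σ = p, which makes the constant
independent of w and of σ. -/
theorem exists_symbolBound_laplace {p : ℝ} (q : ℝ) {s : ℝ} (hp : 0 < p) (hs : -1 < s) (n : ℕ) :
    ∃ D : ℝ, 0 ≤ D ∧ ∀ (C : ℝ) (w : ℝ → ℂ), 0 ≤ C → Measurable w →
      (∀ u, 0 < u → ‖w u‖ ≤ C * u ^ s) → SymbolBound p q n (C * D) (laplace w) := by
  have hbd : ∀ s : ℝ, -1 < s → ∀ (C : ℝ) (w : ℝ → ℂ), 0 ≤ C → (∀ u, 0 < u → ‖w u‖ ≤ C * u ^ s) →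
      ∀ σ ∈ Ioo p q, ‖laplace w σ‖ ≤ C * ∫ u in Ioi (0 : ℝ), Real.exp (-(p * u)) * u ^ s := by
    intro s hs C w hC hw σ hσ
    exact (norm_laplace_le hs hw (hp.trans hσ.1)).trans
      (mul_le_mul_of_nonneg_left (integral_exp_mul_rpow_anti hs hp hσ.1.le) hC)
  have h0 : ∀ s : ℝ, 0 ≤ ∫ u in Ioi (0 : ℝ), Real.exp (-(p * u)) * u ^ s := fun s =>
    setIntegral_nonneg measurableSet_Ioi fun u hu =>
      mul_nonneg (Real.exp_pos _).le (Real.rpow_nonneg (le_of_lt hu) s)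
  induction n generalizing s with
  | zero =>
    exact ⟨_, h0 s, fun C w hC hwm hw => ⟨hbd s hs C w hC hw, fun σ hσ =>
      (hasDerivAt_laplace hs hwm hw (hp.trans hσ.1)).continuousAt.continuousWithinAt⟩⟩
  | succ n ih =>
    obtain ⟨D, hD0, hD⟩ := ih (s := s + 1) (by linarith)
    refine ⟨max (∫ u in Ioi (0 : ℝ), Real.exp (-(p * u)) * u ^ s) D, le_max_of_le_right hD0,
      fun C w hC hwm hw => ⟨fun σ hσ => (hbd s hs C w hC hw σ hσ).trans
        (mul_le_mul_of_nonneg_left (le_max_left _ _) hC), _,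
        fun σ hσ => hasDerivAt_laplace hs hwm hw (hp.trans hσ.1),
        (hD C _ hC (by fun_prop) (norm_neg_mul_weight_le hw)).mono
          (mul_le_mul_of_nonneg_left (le_max_right _ _) hC)⟩⟩

theorem laplace_mul {X : ℝ} (hX : 0 < X) (w : ℝ → ℂ) (σ : ℝ) :
    laplace w (σ * X) = laplace (fun v => (X : ℂ)⁻¹ * w (v / X)) σ := by
  have h := integral_comp_mul_left_Ioi
    (fun v : ℝ => (Real.exp (-(σ * v)) : ℂ) * w (v / X)) 0 hX
  rw [mul_zero] at h
  have e : laplace w (σ * X) =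
      ∫ u in Ioi (0 : ℝ), (Real.exp (-(σ * (X * u))) : ℂ) * w (X * u / X) := by
    rw [laplace]
    refine integral_congr_ae (Eventually.of_forall fun u => ?_)
    simp only [mul_assoc, mul_div_cancel_left₀ _ hX.ne']
  rw [e, h, laplace, Complex.real_smul, ← integral_const_mul]
  refine integral_congr_ae (Eventually.of_forall fun u => ?_)
  simp only [Complex.ofReal_inv]
  ring

/-- The dilation by X passes to the weight, which becomes X⁻¹w(u/X), bounded by X^{-1/2} u^{-1/2}.
Derivatives in σ thus cost no powers of X: the oscillation e^{iσX} has been removed. -/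
theorem exists_symbolBound_laplace_mul {p : ℝ} (q : ℝ) (hp : 0 < p) (n : ℕ) :
    ∃ D : ℝ, 0 ≤ D ∧ ∀ (X : ℝ) (w : ℝ → ℂ), 0 < X → Measurable w →
      (∀ u, 0 < u → ‖w u‖ ≤ u ^ (-(1 / 2) : ℝ)) →
      SymbolBound p q n (X ^ (-(1 / 2) : ℝ) * D) (fun σ => laplace w (σ * X)) := by
  obtain ⟨D, hD0, hD⟩ := exists_symbolBound_laplace q (s := -(1 / 2)) hp (by norm_num) n
  refine ⟨D, hD0, fun X w hX hwm hw => ?_⟩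
  refine (hD (X ^ (-(1 / 2) : ℝ)) (fun v => (X : ℂ)⁻¹ * w (v / X)) (by positivity) (by fun_prop)
    fun u hu => ?_).congr fun σ _ => (laplace_mul hX w σ).symm
  rw [norm_mul, norm_inv, Complex.norm_real, Real.norm_of_nonneg hX.le]
  calc _ ≤ X⁻¹ * (u / X) ^ (-(1 / 2) : ℝ) :=
        mul_le_mul_of_nonneg_left (hw _ (by positivity)) (by positivity)
    _ = _ := by
      rw [Real.div_rpow hu.le hX.le, ← Real.rpow_neg_one X, div_eq_mul_inv,
        ← Real.rpow_neg hX.le, mul_left_comm, ← Real.rpow_add hX, mul_comm]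
      norm_num

theorem conj_laplace (w : ℝ → ℂ) (r : ℝ) :
    starRingEnd ℂ (laplace w r) = laplace (fun u => starRingEnd ℂ (w u)) r := by
  rw [laplace, ← integral_conj, laplace]
  refine integral_congr_ae (Eventually.of_forall fun u => ?_)
  simp only [map_mul, Complex.conj_ofReal]

end Laplace

/-! ### The Hankel and Bessel functions -/

theorem measurable_hankelWeight : Measurable hankelWeight := by
  unfold hankelWeight
  fun_prop

theorem norm_hankelWeight_le (u : ℝ) (hu : 0 < u) :
    ‖hankelWeight u‖ ≤ u ^ (-(1 / 2) : ℝ) := by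
  rw [hankelWeight, norm_mul, Complex.norm_cpow_real, norm_neg, norm_div, norm_mul, Complex.norm_I,
    Complex.norm_real, Real.norm_of_nonneg Real.pi_pos.le, Complex.norm_ofNat, mul_one]
  have h1 := Real.rpow_le_rpow_of_nonpos hu (le_norm_one_sub_sq (x := 1) zero_le_one hu.le)
    (by norm_num : (-(1 / 2) : ℝ) ≤ 0)
  have h2 : 2 / Real.pi ≤ 1 := (div_le_one Real.pi_pos).2 Real.two_le_pi
  have h3 : 0 ≤ ‖1 - (((1 : ℝ) : ℂ) + u * Complex.I) ^ 2‖ ^ (-(1 / 2) : ℝ) := by positivity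
  nlinarith

/-- The conjugate of the weight of `H₀⁽¹⁾` is the weight of `H₀⁽²⁾`. -/
noncomputable def conjHankelWeight (u : ℝ) : ℂ := starRingEnd ℂ (hankelWeight u)

theorem measurable_conjHankelWeight : Measurable conjHankelWeight :=
  Complex.continuous_conj.measurable.comp measurable_hankelWeight

theorem norm_conjHankelWeight_le (u : ℝ) (hu : 0 < u) :
    ‖conjHankelWeight u‖ ≤ u ^ (-(1 / 2) : ℝ) := by
  rw [conjHankelWeight, RCLike.norm_conj]
  exact norm_hankelWeight_le u hu

theorem besselJ0_eq_laplace {r : ℝ} (hr : 0 < r) :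
    besselJ0 r = (1 / 2) * (Complex.exp (Complex.I * r) * laplace hankelWeight r +
      Complex.exp (-(Complex.I * r)) * laplace conjHankelWeight r) := by
  have h1 := hankel1_eq hr
  have h2 := congrArg (starRingEnd ℂ) h1
  rw [map_mul, conj_laplace, ← Complex.exp_conj, map_mul, Complex.conj_I, Complex.conj_ofReal] at h2
  have hJ : starRingEnd ℂ (besselJ0 r) = besselJ0 r := Complex.conj_eq_iff_im.2 (besselJ0_im r)
  rw [hankel1, map_add, map_mul, hJ, Complex.conj_I, Complex.conj_ofReal] at h2
  rw [hankel1] at h1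
  have e : laplace conjHankelWeight r = laplace (fun u => starRingEnd ℂ (hankelWeight u)) r := rfl
  rw [e, ← h1, ← neg_mul, ← h2]
  ring

/-- The amplitude bound of order zero at σ = 1 with X = r. Near r = 0 this is weaker than the true
logarithm, but a single power for all r is what the later integrals need. -/
theorem exists_norm_hankel1_le : ∃ C : ℝ, 0 ≤ C ∧ ∀ r : ℝ, 0 < r →
    ‖hankel1 r‖ ≤ C * r ^ (-(1 / 2) : ℝ) := by
  obtain ⟨D, hD0, hD⟩ := exists_symbolBound_laplace_mul (p := 1 / 2) 2 (by norm_num) 0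
  refine ⟨D, hD0, fun r hr => ?_⟩
  have := (hD r hankelWeight hr measurable_hankelWeight norm_hankelWeight_le).norm_le 1 (by norm_num)
  rw [hankel1_eq hr, norm_mul, mul_comm Complex.I, Complex.norm_exp_ofReal_mul_I, one_mul]
  rw [one_mul] at this
  rwa [mul_comm]

theorem norm_hankel2 (r : ℝ) : ‖hankel2 r‖ = ‖hankel1 r‖ := RCLike.norm_conj _

theorem continuousOn_hankel1 : ContinuousOn hankel1 (Ioi 0) := by
  have h : ContinuousOn (fun r : ℝ => Complex.exp (Complex.I * r) * laplace hankelWeight r)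
      (Ioi 0) := ContinuousOn.mul (by fun_prop) fun r hr =>
    (hasDerivAt_laplace (C := 1) (s := -(1 / 2)) (by norm_num) measurable_hankelWeight
      (fun u hu => by rw [one_mul]; exact norm_hankelWeight_le u hu) hr).continuousAt.continuousWithinAt
  exact h.congr fun r hr => hankel1_eq hr

theorem continuous_besselJ0 : Continuous besselJ0 := by
  unfold besselJ0
  refine continuous_const.mul ?_
  exact intervalIntegral.continuous_parametric_intervalIntegral_of_continuous' (by fun_prop) _ _

/-! ### Estimates for the radial kernel -/

/-- A radial Littlewood-Paley profile, smooth and supported in `1/2 ≤ σ ≤ 11/10`. -/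
structure IsProfile (ψ : ℝ → ℝ) : Prop where
  smooth : ContDiff ℝ ∞ ψ
  eq_zero_low : ∀ σ, 0 ≤ σ → σ ≤ 1 / 2 → ψ σ = 0
  eq_zero_high : ∀ σ, 11 / 10 ≤ σ → ψ σ = 0

theorem IsProfile.eq_zero {ψ : ℝ → ℝ} (hψ : IsProfile ψ) {σ : ℝ} (h0 : 0 ≤ σ)
    (h : σ ∉ Ioo (1 / 2 : ℝ) (11 / 10)) : ψ σ = 0 := by
  by_cases h1 : σ ≤ 1 / 2
  · exact hψ.eq_zero_low σ h0 h1
  · exact hψ.eq_zero_high σ (by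
      by_contra h2
      exact h ⟨not_le.1 h1, not_le.1 h2⟩)

/-- Oscillatory integrals with quadratic phase over the support of the profile. -/
noncomputable def phaseIntegral (T β : ℝ) (A : ℝ → ℂ) : ℂ :=
  ∫ σ in (1 / 2 : ℝ)..(11 / 10), Complex.exp (Complex.I * (T * σ ^ 2 + β * σ : ℝ)) * A σ

/-- The rescaled kernel of `P⁺ P_N e^{-itΔ}`, in terms of `X = N|x|`, `Y = N|y|`, `T = N²t`. -/
noncomputable def radialKernel (ψ : ℝ → ℝ) (X Y T : ℝ) : ℂ :=
  ∫ σ in (1 / 2 : ℝ)..(11 / 10), hankel1 (σ * X) * besselJ0 (σ * Y) *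
    (Complex.exp (Complex.I * (T * σ ^ 2 : ℝ)) * (ψ σ * σ : ℝ))

/-- The amplitude after the Bessel function has been split into its two oscillating parts. -/
noncomputable def splitAmplitude (ψ : ℝ → ℝ) (w : ℝ → ℂ) (X Y σ : ℝ) : ℂ :=
  laplace hankelWeight (σ * X) * (laplace w (σ * Y) * (1 / 2 * (ψ σ * σ) : ℝ))

/-- The amplitude when the Bessel function does not oscillate. -/
noncomputable def plainAmplitude (ψ : ℝ → ℝ) (X Y σ : ℝ) : ℂ :=
  laplace hankelWeight (σ * X) * (besselJ0 (σ * Y) * (ψ σ * σ : ℝ))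

section

variable {ψ : ℝ → ℝ}

theorem exists_symbolBound_splitAmplitude (hψ : IsProfile ψ) {p : ℝ} (q : ℝ) (hp : 0 < p) (n : ℕ) :
    ∃ M : ℝ, 0 ≤ M ∧ ∀ (w : ℝ → ℂ) (X Y : ℝ), Measurable w →
      (∀ u, 0 < u → ‖w u‖ ≤ u ^ (-(1 / 2) : ℝ)) → 0 < X → 0 < Y →
      SymbolBound p q n (M * (X ^ (-(1 / 2) : ℝ) * Y ^ (-(1 / 2) : ℝ))) (splitAmplitude ψ w X Y) := by
  obtain ⟨D, hD0, hD⟩ := exists_symbolBound_laplace_mul q hp n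
  obtain ⟨L, hL0, hL⟩ := exists_symbolBound_of_contDiff p q n
    (f := fun σ : ℝ => ((1 / 2 * (ψ σ * σ) : ℝ) : ℂ))
    (Complex.ofRealCLM.contDiff.comp (contDiff_const.mul (hψ.smooth.mul contDiff_id)))
  refine ⟨2 ^ n * (D * (2 ^ n * (D * L))), by positivity, fun w X Y hwm hw hX hY => ?_⟩
  have hX' : 0 ≤ X ^ (-(1 / 2) : ℝ) := by positivity
  have hY' : 0 ≤ Y ^ (-(1 / 2) : ℝ) := by positivity
  refine (SymbolBound.mul (by positivity) (by positivity)
    (hD X hankelWeight hX measurable_hankelWeight norm_hankelWeight_le)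
    (SymbolBound.mul (by positivity) hL0 (hD Y w hY hwm hw) hL)).mono (le_of_eq ?_)
  ring

theorem exists_symbolBound_plainAmplitude (hψ : IsProfile ψ) {p : ℝ} (q : ℝ) (hp : 0 < p) (n : ℕ) :
    ∃ M : ℝ, 0 ≤ M ∧ ∀ (X Y : ℝ), 0 < X → 0 ≤ Y → Y ≤ 1 →
      SymbolBound p q n (M * X ^ (-(1 / 2) : ℝ)) (plainAmplitude ψ X Y) := by
  obtain ⟨D, hD0, hD⟩ := exists_symbolBound_laplace_mul q hp n
  obtain ⟨L, hL0, hL⟩ := exists_symbolBound_of_contDiff p q n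
    (f := fun σ : ℝ => ((ψ σ * σ : ℝ) : ℂ))
    (Complex.ofRealCLM.contDiff.comp (hψ.smooth.mul contDiff_id))
  refine ⟨2 ^ n * (D * (2 ^ n * L)), by positivity, fun X Y hX hY0 hY => ?_⟩
  have hX' : 0 ≤ X ^ (-(1 / 2) : ℝ) := by positivity
  refine (SymbolBound.mul (by positivity) (by positivity)
    (hD X hankelWeight hX measurable_hankelWeight norm_hankelWeight_le)
    (SymbolBound.mul zero_le_one hL0 (symbolBound_besselJ0 n hY0 hY) hL)).mono (le_of_eq ?_)
  ring

theorem splitAmplitude_eq_zero (hψ : IsProfile ψ) (w : ℝ → ℂ) (X Y : ℝ) {p q : ℝ} (hp : 0 ≤ p) :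
    ∀ σ ∈ Ioo p q, σ ∉ Ioo (1 / 2 : ℝ) (11 / 10) → splitAmplitude ψ w X Y σ = 0 := fun σ hσ hn => by
  rw [splitAmplitude, hψ.eq_zero (hp.trans hσ.1.le) hn]
  simp

theorem plainAmplitude_eq_zero (hψ : IsProfile ψ) (X Y : ℝ) {p q : ℝ} (hp : 0 ≤ p) :
    ∀ σ ∈ Ioo p q, σ ∉ Ioo (1 / 2 : ℝ) (11 / 10) → plainAmplitude ψ X Y σ = 0 := fun σ hσ hn => by
  rw [plainAmplitude, hψ.eq_zero (hp.trans hσ.1.le) hn]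
  simp

theorem continuousOn_mul_amplitude {A e : ℝ → ℂ} {p q M : ℝ} {n : ℕ} (hp : p < 1 / 2)
    (hq : 11 / 10 < q) (hA : SymbolBound p q n M A) (he : Continuous e) :
    IntervalIntegrable (fun σ => e σ * A σ) volume (1 / 2) (11 / 10) := by
  refine ContinuousOn.intervalIntegrable (he.continuousOn.mul (hA.continuousOn.mono ?_))
  rw [uIcc_of_le (by norm_num)]
  exact fun σ hσ => ⟨hp.trans_le hσ.1, hσ.2.trans_lt hq⟩

theorem radialKernel_eq_split (hψ : IsProfile ψ) {X Y : ℝ} (T : ℝ) (hX : 0 < X) (hY : 0 < Y) :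
    radialKernel ψ X Y T = phaseIntegral T (X + Y) (splitAmplitude ψ hankelWeight X Y) +
      phaseIntegral T (X - Y) (splitAmplitude ψ conjHankelWeight X Y) := by
  obtain ⟨M, -, hM⟩ := exists_symbolBound_splitAmplitude hψ (p := 1 / 4) 2 (by norm_num) 0
  rw [radialKernel, phaseIntegral, phaseIntegral, ← intervalIntegral.integral_add
    (continuousOn_mul_amplitude (by norm_num) (by norm_num)
      (hM _ X Y measurable_hankelWeight norm_hankelWeight_le hX hY) (by fun_prop))
    (continuousOn_mul_amplitude (by norm_num) (by norm_num)
      (hM _ X Y measurable_conjHankelWeight norm_conjHankelWeight_le hX hY) (by fun_prop))]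
  refine intervalIntegral.integral_congr fun σ hσ => ?_
  rw [uIcc_of_le (by norm_num)] at hσ
  have hσ0 : 0 < σ := by linarith [hσ.1]
  simp only [splitAmplitude]
  rw [hankel1_eq (by positivity), besselJ0_eq_laplace (by positivity)]
  have e1 : Complex.exp (Complex.I * (T * σ ^ 2 + (X + Y) * σ : ℝ)) =
      Complex.exp (Complex.I * (T * σ ^ 2 : ℝ)) * Complex.exp (Complex.I * (σ * X : ℝ)) *
        Complex.exp (Complex.I * (σ * Y : ℝ)) := by
    rw [← Complex.exp_add, ← Complex.exp_add]
    congr 1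
    push_cast
    ring
  have e2 : Complex.exp (Complex.I * (T * σ ^ 2 + (X - Y) * σ : ℝ)) =
      Complex.exp (Complex.I * (T * σ ^ 2 : ℝ)) * Complex.exp (Complex.I * (σ * X : ℝ)) *
        Complex.exp (-(Complex.I * (σ * Y : ℝ))) := by
    rw [← Complex.exp_add, ← Complex.exp_add]
    congr 1
    push_cast
    ring
  rw [e1, e2]
  push_cast
  ring

/-- The form for Y ≤ 1, where splitting J₀ would lose a factor Y^{-1/2} that is unbounded as Y → 0.
-/
theorem radialKernel_eq_plain {X Y : ℝ} (T : ℝ) (hX : 0 < X) :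
    radialKernel ψ X Y T = phaseIntegral T X (plainAmplitude ψ X Y) := by
  refine intervalIntegral.integral_congr fun σ hσ => ?_
  rw [uIcc_of_le (by norm_num)] at hσ
  have hσ0 : 0 < σ := by linarith [hσ.1]
  simp only [plainAmplitude]
  rw [hankel1_eq (by positivity)]
  have e1 : Complex.exp (Complex.I * (T * σ ^ 2 + X * σ : ℝ)) =
      Complex.exp (Complex.I * (T * σ ^ 2 : ℝ)) * Complex.exp (Complex.I * (σ * X : ℝ)) := by
    rw [← Complex.exp_add]
    congr 1
    push_cast
    ring
  rw [e1]
  ring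

/-! ### The three regimes of the rescaled kernel -/

/-- The stationary regime. -/
theorem exists_radialKernel_stationary (hψ : IsProfile ψ) :
    ∃ C : ℝ, 0 ≤ C ∧ ∀ X Y T : ℝ, 0 < X → 0 < Y → 0 < T →
      ‖radialKernel ψ X Y T‖ ≤ C * (X * Y * T) ^ (-(1 / 2) : ℝ) := by
  obtain ⟨M, hM0, hM⟩ := exists_symbolBound_splitAmplitude hψ (p := 1 / 4) 2 (by norm_num) 1
  refine ⟨2 * ((11 / 10 - 1 / 2 + 3 * Real.pi) * M), ?_, fun X Y T hX hY hT => ?_⟩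
  · have := Real.pi_pos
    have h : 0 ≤ (11 / 10 - 1 / 2 + 3 * Real.pi) := by linarith
    positivity
  have hX' : 0 ≤ X ^ (-(1 / 2) : ℝ) := by positivity
  have hY' : 0 ≤ Y ^ (-(1 / 2) : ℝ) := by positivity
  have h1 := stationary_bound (β := X + Y) (by norm_num) (by norm_num) (by norm_num) hT
    (by positivity) (hM _ X Y measurable_hankelWeight norm_hankelWeight_le hX hY)
    (splitAmplitude_eq_zero hψ _ X Y (by norm_num))
  have h2 := stationary_bound (β := X - Y) (by norm_num) (by norm_num) (by norm_num) hT
    (by positivity) (hM _ X Y measurable_conjHankelWeight norm_conjHankelWeight_le hX hY)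
    (splitAmplitude_eq_zero hψ _ X Y (by norm_num))
  rw [radialKernel_eq_split hψ T hX hY]
  refine (norm_add_le _ _).trans ((add_le_add h1 h2).trans (le_of_eq ?_))
  rw [Real.mul_rpow (by positivity) hT.le, Real.mul_rpow hX.le hY.le, Real.sqrt_eq_rpow,
    Real.rpow_neg hT.le]
  ring

theorem one_le_bracket (s : ℝ) : 1 ≤ bracket s := by
  rw [bracket, Real.one_le_sqrt]
  nlinarith [sq_nonneg s]

theorem bracket_pos (s : ℝ) : 0 < bracket s := one_pos.trans_le (one_le_bracket s)

theorem bracket_le (s : ℝ) : bracket s ≤ 1 + |s| := by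
  rw [bracket, Real.sqrt_le_left (by positivity)]
  nlinarith [sq_abs s, abs_nonneg s]

/-- Rapid decay away from the stationary points, with real exponents. -/
theorem exists_phaseIntegral_le {p q : ℝ} (hp : p < 1 / 2) (hq : 11 / 10 < q) {κ : ℝ} (hκ : 0 < κ)
    (m : ℝ) :
    ∃ D : ℝ, 0 ≤ D ∧ ∀ (T β L M : ℝ) (A : ℝ → ℂ), 1 ≤ L → |T| ≤ L →
      (∀ σ ∈ Ioo p q, κ * L ≤ |2 * T * σ + β|) → 0 ≤ M → SymbolBound p q ⌈m⌉₊ M A →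
      (∀ σ ∈ Ioo p q, σ ∉ Ioo (1 / 2 : ℝ) (11 / 10) → A σ = 0) →
      ‖phaseIntegral T β A‖ ≤ D * M * L ^ (-m) := by
  obtain ⟨D, hD0, hD⟩ := exists_nonstationary_bound hp (by norm_num : (1 / 2 : ℝ) < 11 / 10) hq κ⁻¹ ⌈m⌉₊
  refine ⟨D / κ ^ ⌈m⌉₊, by positivity, fun T β L M A hL hT hΦ hM hA hv => ?_⟩
  have hL0 : 0 < L := by linarith
  refine (hD T β (κ * L) M A (by positivity) (by rwa [inv_mul_cancel_left₀ hκ.ne']) hΦ hM hA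
    hv).trans ?_
  rw [mul_pow, ← div_div, div_eq_mul_inv (D * M / κ ^ ⌈m⌉₊), div_mul_eq_mul_div D]
  refine mul_le_mul_of_nonneg_left ?_ (by positivity)
  rw [← Real.rpow_natCast, ← Real.rpow_neg hL0.le]
  exact Real.rpow_le_rpow_of_exponent_le hL (neg_le_neg (Nat.le_ceil m))

theorem rpow_neg_half_le_bracket {Y : ℝ} (hY : 1 ≤ Y) :
    Y ^ (-(1 / 2) : ℝ) ≤ 2 * bracket Y ^ (-(1 / 2) : ℝ) := by
  have h1 : bracket Y / 4 ≤ Y := by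
    have := bracket_le Y
    rw [abs_of_pos (by linarith)] at this
    linarith
  have h0 := bracket_pos Y
  refine (Real.rpow_le_rpow_of_nonpos (by positivity) h1 (by norm_num)).trans (le_of_eq ?_)
  rw [Real.div_rpow h0.le (by norm_num), show (4 : ℝ) = 2 ^ (2 : ℝ) by norm_num,
    ← Real.rpow_mul (by norm_num)]
  norm_num [Real.rpow_neg_one]
  ring

theorem one_le_bracket_rpow {Y : ℝ} (hY0 : 0 ≤ Y) (hY : Y ≤ 1) :
    1 ≤ 2 * bracket Y ^ (-(1 / 2) : ℝ) := by
  have h1 : bracket Y ≤ 4 := by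
    have := bracket_le Y
    rw [abs_of_nonneg hY0] at this
    linarith
  have h2 := Real.rpow_le_rpow_of_nonpos (bracket_pos Y) h1 (by norm_num : (-(1 / 2) : ℝ) ≤ 0)
  rw [show (4 : ℝ) = 2 ^ (2 : ℝ) by norm_num, ← Real.rpow_mul (by norm_num)] at h2
  norm_num [Real.rpow_neg_one] at h2 ⊢
  linarith

/-- Lower bound for the derivative of the phase away from the stationary region. -/
theorem le_abs_phase_sub {a b κ T D σ : ℝ} (hT0 : 0 < T) (ha0 : 0 < a) (ha : a < 1)
    (hb : 11 / 5 < b) (hκ0 : 0 < κ) (hκ2 : κ ≤ (1 - a) / 4) (hκ3 : κ ≤ (b - 11 / 5) / (4 * b))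
    (hσp : (1 + a) / 4 ≤ σ) (hσq : σ ≤ (b + 11 / 5) / 4) (h : D < a * T ∨ b * T < D) :
    κ * (T + |D|) ≤ |2 * T * σ - D| := by
  have hb0 : 0 < b := by linarith
  -- If D < aT, then 2Tσ exceeds D by at least (1 - a)T/2. If D > bT, then D exceeds 2Tσ by at least
  -- D(b - 11/5)/(2b), and T ≤ D/b ≤ D bounds T + |D| by 2D.
  rcases h with h | h
  · refine le_trans ?_ (le_abs_self _)
    have h1 : T * (1 + a) / 2 ≤ 2 * T * σ := by
      have := mul_le_mul_of_nonneg_left hσp hT0.le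
      linarith
    have hD0 : 0 ≤ T + |D| := by positivity
    refine (mul_le_mul_of_nonneg_right hκ2 hD0).trans ?_
    rcases le_total 0 D with h0 | h0
    · rw [abs_of_nonneg h0]
      have hDT : D ≤ T := h.le.trans (mul_le_of_le_one_left hT0.le ha.le)
      have := mul_le_mul_of_nonneg_left hDT (by linarith : 0 ≤ (1 - a) / 4)
      linarith
    · rw [abs_of_nonpos h0]
      nlinarith
  · have hDpos : 0 < D := lt_trans (by positivity) h
    rw [abs_sub_comm, abs_of_pos hDpos]
    refine le_trans ?_ (le_abs_self _)
    have h1 : 2 * T * σ ≤ T * (b + 11 / 5) / 2 := by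
      have := mul_le_mul_of_nonneg_left hσq hT0.le
      linarith
    have h2 : T ≤ D / b := by rw [le_div_iff₀ hb0]; linarith
    have h4 : κ * (T + D) ≤ κ * (2 * D) := by
      refine mul_le_mul_of_nonneg_left ?_ hκ0.le
      nlinarith
    have h5 : κ * (2 * D) ≤ (b - 11 / 5) / (4 * b) * (2 * D) := by gcongr
    have h6 : T * (b + 11 / 5) / 2 ≤ D / b * (b + 11 / 5) / 2 := by gcongr
    have h7 : D / b * (b + 11 / 5) / 2 = D - (b - 11 / 5) / (4 * b) * (2 * D) := by
      field_simp
      ring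
    linarith

/-- The non-stationary regime for large times. -/
theorem exists_radialKernel_nonstationary (hψ : IsProfile ψ) {c a b m : ℝ} (hc : 0 < c)
    (ha0 : 0 < a) (ha : a < 1) (hb : 11 / 5 < b) (hm : 0 ≤ m) :
    ∃ C : ℝ, 0 ≤ C ∧ ∀ X Y T : ℝ, 0 < X → 0 ≤ Y → c ≤ T →
      ¬ (a * T ≤ Y - X ∧ Y - X ≤ b * T) →
      ‖radialKernel ψ X Y T‖ ≤ C * (X ^ (-(1 / 2) : ℝ) * bracket Y ^ (-(1 / 2) : ℝ) *
        bracket (T + X - Y) ^ (-m)) := by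
  -- The working interval ends halfway between a/2 and 1/2 and halfway between 11/10 and b/2. It
  -- contains the support of the profile in its interior and still keeps away from the stationary
  -- points σ = D/(2T) with D < aT or D > bT.
  obtain ⟨p, hpdef⟩ : ∃ p : ℝ, p = (1 + a) / 4 := ⟨_, rfl⟩
  obtain ⟨q, hqdef⟩ : ∃ q : ℝ, q = (b + 11 / 5) / 4 := ⟨_, rfl⟩
  have hp : p < 1 / 2 := by linarith
  have hp4 : 1 / 4 < p := by linarith
  have hq : 11 / 10 < q := by linarith
  have hp0 : 0 < p := by linarith
  obtain ⟨M₁, hM₁0, hM₁⟩ := exists_symbolBound_splitAmplitude hψ q hp0 ⌈m⌉₊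
  obtain ⟨M₀, hM₀0, hM₀⟩ := exists_symbolBound_plainAmplitude hψ q hp0 ⌈m⌉₊
  have hb0 : 0 < b := by linarith
  obtain ⟨κ, hκ0, hκ1, hκ2, hκ3⟩ : ∃ κ : ℝ, 0 < κ ∧ κ ≤ 1 / 2 ∧ κ ≤ (1 - a) / 4 ∧
      κ ≤ (b - 11 / 5) / (4 * b) := by
    have h1 : 0 < (1 - a) / 4 := by linarith
    have h2 : 0 < (b - 11 / 5) / (4 * b) := div_pos (by linarith) (by linarith)
    exact ⟨min (1 / 2) (min ((1 - a) / 4) ((b - 11 / 5) / (4 * b))),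
      lt_min (by norm_num) (lt_min h1 h2), min_le_left _ _,
      (min_le_right _ _).trans (min_le_left _ _), (min_le_right _ _).trans (min_le_right _ _)⟩
  -- For T ≥ c, replacing T + |D| by L = 1 + T + |D| costs the factor c/(1 + c).
  have hκc : 0 < κ * (c / (1 + c)) := by positivity
  obtain ⟨D₁, hD₁0, hD₁⟩ := exists_phaseIntegral_le hp hq hκc m
  -- For Y ≤ 1 the phase derivative is at least T/2 + X, while L ≤ 2 + T + X; the summand 4/c
  -- absorbs the 2 by means of T ≥ c.
  obtain ⟨D₀, hD₀0, hD₀⟩ := exists_phaseIntegral_le hp hq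
    (by positivity : 0 < (4 / c + 2)⁻¹) m
  refine ⟨4 * (D₁ * M₁) + 2 * (D₀ * M₀), by positivity, fun X Y T hX hY0 hT hreg => ?_⟩
  have hT0 : 0 < T := hc.trans_le hT
  obtain ⟨D, hDdef⟩ : ∃ D : ℝ, D = Y - X := ⟨_, rfl⟩
  obtain ⟨L, hLdef⟩ : ∃ L : ℝ, L = 1 + T + |D| := ⟨_, rfl⟩
  have hD0 := abs_nonneg D
  have hL1 : 1 ≤ L := by linarith
  have hTL : |T| ≤ L := by rw [abs_of_pos hT0]; linarith
  have hXr : 0 ≤ X ^ (-(1 / 2) : ℝ) := by positivity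
  have hbr : 0 ≤ bracket Y ^ (-(1 / 2) : ℝ) := Real.rpow_nonneg (bracket_pos Y).le _
  have hL : L ^ (-m) ≤ bracket (T + X - Y) ^ (-m) := by
    refine Real.rpow_le_rpow_of_nonpos (bracket_pos _) ((bracket_le _).trans ?_) (by linarith)
    have : |T + X - Y| ≤ |T| + |D| := by
      rw [show T + X - Y = T - D by rw [hDdef]; ring]
      exact abs_sub _ _
    rw [abs_of_pos hT0] at this
    linarith
  have hLm : 0 ≤ L ^ (-m) := by positivity
  have hBm : 0 ≤ bracket (T + X - Y) ^ (-m) := hLm.trans hL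
  rcases le_total Y 1 with hY | hY
  · rw [radialKernel_eq_plain T hX]
    have h := hD₀ T X L _ _ hL1 hTL (fun σ hσ => ?_) (by positivity) (hM₀ X Y hX hY0 hY)
      (plainAmplitude_eq_zero hψ X Y hp0.le)
    · calc _ ≤ D₀ * (M₀ * X ^ (-(1 / 2) : ℝ)) * L ^ (-m) := h
        _ = (D₀ * M₀) * (X ^ (-(1 / 2) : ℝ) * 1 * L ^ (-m)) := by ring
        _ ≤ (D₀ * M₀) * (X ^ (-(1 / 2) : ℝ) * (2 * bracket Y ^ (-(1 / 2) : ℝ)) *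
              bracket (T + X - Y) ^ (-m)) := by
            have := one_le_bracket_rpow hY0 hY
            gcongr
        _ = 0 + 2 * (D₀ * M₀) * (X ^ (-(1 / 2) : ℝ) * bracket Y ^ (-(1 / 2) : ℝ) *
              bracket (T + X - Y) ^ (-m)) := by ring
        _ ≤ 4 * (D₁ * M₁) * (X ^ (-(1 / 2) : ℝ) * bracket Y ^ (-(1 / 2) : ℝ) *
              bracket (T + X - Y) ^ (-m)) + 2 * (D₀ * M₀) *
              (X ^ (-(1 / 2) : ℝ) * bracket Y ^ (-(1 / 2) : ℝ) *
              bracket (T + X - Y) ^ (-m)) := by gcongr; positivity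
        _ = _ := by ring
    · have hσp := hσ.1
      have hDX : |D| ≤ X + 1 := by
        rw [hDdef, abs_le]; constructor <;> linarith
      have h1 : T / 2 ≤ 2 * T * σ := by
        have := mul_le_mul_of_nonneg_left (hp4.trans hσp).le hT0.le
        linarith
      rw [abs_of_pos (by linarith)]
      refine le_trans ?_ (by linarith : T / 2 + X ≤ 2 * T * σ + X)
      rw [inv_mul_le_iff₀ (by positivity), add_mul, mul_add]
      have h2 : 2 ≤ 4 / c * (T / 2) := by
        rw [div_mul_eq_mul_div, le_div_iff₀ hc]; linarith
      have h3 : 0 ≤ 4 / c * X := by positivity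
      linarith
  · have hY1 : 0 < Y := by linarith
    have hkey : κ * (c / (1 + c)) * L ≤ κ * (T + |D|) := by
      rw [mul_assoc]
      refine mul_le_mul_of_nonneg_left ?_ hκ0.le
      rw [div_mul_eq_mul_div, div_le_iff₀ (by positivity), hLdef]
      linarith
    rw [radialKernel_eq_split hψ T hX hY1]
    have h1 := hD₁ T (X + Y) L _ _ hL1 hTL (fun σ hσ => ?_) (by positivity)
      (hM₁ _ X Y measurable_hankelWeight norm_hankelWeight_le hX hY1)
      (splitAmplitude_eq_zero hψ _ X Y hp0.le)
    have h2 := hD₁ T (X - Y) L _ _ hL1 hTL (fun σ hσ => ?_) (by positivity)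
      (hM₁ _ X Y measurable_conjHankelWeight norm_conjHankelWeight_le hX hY1)
      (splitAmplitude_eq_zero hψ _ X Y hp0.le)
    · refine (norm_add_le _ _).trans ((add_le_add h1 h2).trans ?_)
      calc _ = 2 * (D₁ * M₁) * (X ^ (-(1 / 2) : ℝ) * Y ^ (-(1 / 2) : ℝ) * L ^ (-m)) := by ring
        _ ≤ 2 * (D₁ * M₁) * (X ^ (-(1 / 2) : ℝ) * (2 * bracket Y ^ (-(1 / 2) : ℝ)) *
              bracket (T + X - Y) ^ (-m)) := by
            have := rpow_neg_half_le_bracket hY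
            gcongr
        _ = 4 * (D₁ * M₁) * (X ^ (-(1 / 2) : ℝ) * bracket Y ^ (-(1 / 2) : ℝ) *
              bracket (T + X - Y) ^ (-m)) + 0 := by ring
        _ ≤ 4 * (D₁ * M₁) * (X ^ (-(1 / 2) : ℝ) * bracket Y ^ (-(1 / 2) : ℝ) *
              bracket (T + X - Y) ^ (-m)) + 2 * (D₀ * M₀) *
              (X ^ (-(1 / 2) : ℝ) * bracket Y ^ (-(1 / 2) : ℝ) *
              bracket (T + X - Y) ^ (-m)) := by gcongr; positivity
        _ = _ := by ring
    · refine hkey.trans ?_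
      have hreg' : D < a * T ∨ b * T < D := by
        by_contra! h
        exact hreg ⟨hDdef ▸ h.1, hDdef ▸ h.2⟩
      rw [show 2 * T * σ + (X - Y) = 2 * T * σ - D by rw [hDdef]; ring]
      exact le_abs_phase_sub hT0 ha0 ha hb hκ0 hκ2 hκ3 (hpdef ▸ hσ.1.le) (hqdef ▸ hσ.2.le) hreg'
    -- For the phase with X + Y both terms of the derivative are nonnegative and σ > 1/4, so it is
    -- at least T/2 + |D| in every region.
    · have hDXY : |D| ≤ X + Y := by
        rw [hDdef, abs_le]; constructor <;> linarith
      have hσp := hσ.1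
      have h1 : T / 2 ≤ 2 * T * σ := by
        have := mul_le_mul_of_nonneg_left (hp4.trans hσp).le hT0.le
        linarith
      rw [abs_of_pos (by linarith)]
      refine hkey.trans ?_
      have := mul_le_mul_of_nonneg_right hκ1 (by positivity : 0 ≤ T + |D|)
      linarith

/-- The regime of small times. -/
theorem exists_radialKernel_small (hψ : IsProfile ψ) (c : ℝ) {m : ℝ} (hm : 0 ≤ m) :
    ∃ C : ℝ, 0 ≤ C ∧ ∀ X Y T : ℝ, 0 < X → 0 ≤ Y → |T| ≤ c →
      ‖radialKernel ψ X Y T‖ ≤ C * (X ^ (-(1 / 2) : ℝ) * bracket Y ^ (-(1 / 2) : ℝ) *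
        bracket (X - Y) ^ (-m)) := by
  have hp : (1 / 4 : ℝ) < 1 / 2 := by norm_num
  have hq : (11 / 10 : ℝ) < 2 := by norm_num
  have hp0 : (0 : ℝ) < 1 / 4 := by norm_num
  obtain ⟨M₁, hM₁0, hM₁⟩ := exists_symbolBound_splitAmplitude hψ 2 hp0 ⌈m⌉₊
  obtain ⟨M₀, hM₀0, hM₀⟩ := exists_symbolBound_plainAmplitude hψ 2 hp0 ⌈m⌉₊
  obtain ⟨E, hE0, hE⟩ := exists_symbolBound_exp_sq (1 / 4) 2 c ⌈m⌉₊
  obtain ⟨D, hD0, hD⟩ := exists_phaseIntegral_le hp hq (by norm_num : (0 : ℝ) < 1 / 2) m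
  obtain ⟨P, hPdef⟩ : ∃ P : ℝ, P = 2 ^ ⌈m⌉₊ * E := ⟨_, rfl⟩
  have hP0 : 0 ≤ P := by rw [hPdef]; positivity
  -- The factor e^{iTσ²} joins the amplitude and the phase becomes linear with slope β. In each
  -- application L = 1 + |X - Y|, and |β| < L/2 happens only for L ≤ 3; then the trivial bound
  -- suffices, since 3^m L^{-m} ≥ 1.
  have key : ∀ (T β L M : ℝ) (A : ℝ → ℂ), |T| ≤ c → 1 ≤ L → (L ≤ 3 ∨ L / 2 ≤ |β|) → 0 ≤ M →
      SymbolBound (1 / 4) 2 ⌈m⌉₊ M A →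
      (∀ σ ∈ Ioo (1 / 4 : ℝ) 2, σ ∉ Ioo (1 / 2 : ℝ) (11 / 10) → A σ = 0) →
      ‖phaseIntegral T β A‖ ≤ (D + 3 ^ m) * (P * M) * L ^ (-m) := by
    intro T β L M A hT hL hβ hM hA hv
    have hL0 : 0 < L := by linarith
    have hB : SymbolBound (1 / 4) 2 ⌈m⌉₊ (P * M)
        (fun σ => Complex.exp (Complex.I * (T * σ ^ 2 : ℝ)) * A σ) :=
      ((hE T hT).mul hE0 hM hA).mono (by rw [hPdef, mul_assoc])
    have hvB : ∀ σ ∈ Ioo (1 / 4 : ℝ) 2, σ ∉ Ioo (1 / 2 : ℝ) (11 / 10) →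
        Complex.exp (Complex.I * (T * σ ^ 2 : ℝ)) * A σ = 0 := fun σ hσ hn => by
      rw [hv σ hσ hn, mul_zero]
    have e : phaseIntegral T β A =
        phaseIntegral 0 β (fun σ => Complex.exp (Complex.I * (T * σ ^ 2 : ℝ)) * A σ) := by
      refine intervalIntegral.integral_congr fun σ _ => ?_
      simp only
      rw [← mul_assoc, ← Complex.exp_add]
      congr 2
      push_cast
      ring
    have hLm : 0 ≤ L ^ (-m) := by positivity
    rw [e, add_mul, add_mul]
    by_cases h3 : L / 2 ≤ |β|
    · have := hD 0 β L _ _ hL (by rw [abs_zero]; linarith)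
        (fun σ _ => by rw [mul_zero, zero_mul, zero_add]; linarith) (by positivity) hB hvB
      have h0 : 0 ≤ 3 ^ m * (P * M) * L ^ (-m) := by positivity
      linarith
    · have hL3 : L ≤ 3 := hβ.resolve_right h3
      have h1 : ‖phaseIntegral 0 β (fun σ => Complex.exp (Complex.I * (T * σ ^ 2 : ℝ)) * A σ)‖ ≤
          P * M * |11 / 10 - 1 / 2| := by
        refine intervalIntegral.norm_integral_le_of_norm_le_const fun σ hσ => ?_
        rw [uIoc_of_le (by norm_num)] at hσ
        rw [norm_mul, norm_quadratic_phase, one_mul]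
        exact hB.norm_le σ ⟨by linarith [hσ.1], by linarith [hσ.2]⟩
      have h2 : 1 ≤ 3 ^ m * L ^ (-m) := by
        rw [Real.rpow_neg hL0.le, ← div_eq_mul_inv, ← Real.div_rpow (by norm_num) hL0.le]
        exact Real.one_le_rpow ((one_le_div hL0).2 hL3) hm
      have h4 : 0 ≤ D * (P * M) * L ^ (-m) := by positivity
      have h5 : P * M * |11 / 10 - 1 / 2| ≤ P * M * 1 := by
        refine mul_le_mul_of_nonneg_left ?_ (by positivity)
        norm_num [abs_le]
      have h6 : P * M * 1 ≤ P * M * (3 ^ m * L ^ (-m)) :=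
        mul_le_mul_of_nonneg_left h2 (by positivity)
      calc _ ≤ P * M * (3 ^ m * L ^ (-m)) := h1.trans (h5.trans h6)
        _ = 0 + 3 ^ m * (P * M) * L ^ (-m) := by ring
        _ ≤ _ := by gcongr
  obtain ⟨B, hBdef⟩ : ∃ B : ℝ, B = (D + 3 ^ m) * P := ⟨_, rfl⟩
  have hB0 : 0 ≤ B := by rw [hBdef]; positivity
  refine ⟨4 * (B * M₁) + 2 * (B * M₀), by positivity, fun X Y T hX hY0 hT => ?_⟩
  obtain ⟨L, hLdef⟩ : ∃ L : ℝ, L = 1 + |X - Y| := ⟨_, rfl⟩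
  have hXY0 := abs_nonneg (X - Y)
  have hL1 : 1 ≤ L := by linarith
  have hXr : 0 ≤ X ^ (-(1 / 2) : ℝ) := by positivity
  have hbr : 0 ≤ bracket Y ^ (-(1 / 2) : ℝ) := Real.rpow_nonneg (bracket_pos Y).le _
  have hL : L ^ (-m) ≤ bracket (X - Y) ^ (-m) :=
    Real.rpow_le_rpow_of_nonpos (bracket_pos _) (hLdef ▸ bracket_le _) (by linarith)
  have hLm : 0 ≤ L ^ (-m) := by positivity
  have hBm : 0 ≤ bracket (X - Y) ^ (-m) := hLm.trans hL
  rcases le_total Y 1 with hY | hY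
  · rw [radialKernel_eq_plain T hX]
    have h := key T X L _ _ hT hL1 ?_ (by positivity) (hM₀ X Y hX hY0 hY)
      (plainAmplitude_eq_zero hψ X Y hp0.le)
    · calc _ ≤ (D + 3 ^ m) * (P * (M₀ * X ^ (-(1 / 2) : ℝ))) * L ^ (-m) := h
        _ = (B * M₀) * (X ^ (-(1 / 2) : ℝ) * 1 * L ^ (-m)) := by rw [hBdef]; ring
        _ ≤ (B * M₀) * (X ^ (-(1 / 2) : ℝ) * (2 * bracket Y ^ (-(1 / 2) : ℝ)) *
              bracket (X - Y) ^ (-m)) := by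
            have := one_le_bracket_rpow hY0 hY
            gcongr
        _ = 0 + 2 * (B * M₀) * (X ^ (-(1 / 2) : ℝ) * bracket Y ^ (-(1 / 2) : ℝ) *
              bracket (X - Y) ^ (-m)) := by ring
        _ ≤ 4 * (B * M₁) * (X ^ (-(1 / 2) : ℝ) * bracket Y ^ (-(1 / 2) : ℝ) *
              bracket (X - Y) ^ (-m)) + 2 * (B * M₀) *
              (X ^ (-(1 / 2) : ℝ) * bracket Y ^ (-(1 / 2) : ℝ) *
              bracket (X - Y) ^ (-m)) := by gcongr; positivity
        _ = _ := by ring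
    · by_contra! h
      rw [abs_of_pos hX] at h
      rcases abs_cases (X - Y) with ⟨h', -⟩ | ⟨h', -⟩ <;> rw [h'] at hLdef <;> linarith [h.1, h.2]
  · have hY1 : 0 < Y := by linarith
    rw [radialKernel_eq_split hψ T hX hY1]
    have h1 := key T (X + Y) L _ _ hT hL1 ?_ (by positivity)
      (hM₁ _ X Y measurable_hankelWeight norm_hankelWeight_le hX hY1)
      (splitAmplitude_eq_zero hψ _ X Y hp0.le)
    have h2 := key T (X - Y) L _ _ hT hL1 ?_ (by positivity)
      (hM₁ _ X Y measurable_conjHankelWeight norm_conjHankelWeight_le hX hY1)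
      (splitAmplitude_eq_zero hψ _ X Y hp0.le)
    · refine (norm_add_le _ _).trans ((add_le_add h1 h2).trans ?_)
      calc _ = 2 * (B * M₁) * (X ^ (-(1 / 2) : ℝ) * Y ^ (-(1 / 2) : ℝ) * L ^ (-m)) := by
              rw [hBdef]; ring
        _ ≤ 2 * (B * M₁) * (X ^ (-(1 / 2) : ℝ) * (2 * bracket Y ^ (-(1 / 2) : ℝ)) *
              bracket (X - Y) ^ (-m)) := by
            have := rpow_neg_half_le_bracket hY
            gcongr
        _ = 4 * (B * M₁) * (X ^ (-(1 / 2) : ℝ) * bracket Y ^ (-(1 / 2) : ℝ) *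
              bracket (X - Y) ^ (-m)) + 0 := by ring
        _ ≤ 4 * (B * M₁) * (X ^ (-(1 / 2) : ℝ) * bracket Y ^ (-(1 / 2) : ℝ) *
              bracket (X - Y) ^ (-m)) + 2 * (B * M₀) *
              (X ^ (-(1 / 2) : ℝ) * bracket Y ^ (-(1 / 2) : ℝ) *
              bracket (X - Y) ^ (-m)) := by gcongr; positivity
        _ = _ := by ring
    · by_contra! h
      linarith [h.1, h.2]
    · by_contra! h
      rw [abs_of_pos (by linarith)] at h
      rcases abs_cases (X - Y) with ⟨h', -⟩ | ⟨h', -⟩ <;> rw [h'] at hLdef <;> linarith [h.1, h.2]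

end

/-! ### Boundedness of the Hankel transform on the half-line -/

theorem eLpNorm_two_sq {α : Type*} [MeasurableSpace α] (μ : Measure α) (f : α → ℂ) :
    eLpNorm f 2 μ ^ 2 = ∫⁻ x, ‖f x‖ₑ ^ 2 ∂μ := by
  have := eLpNorm_nnreal_pow_eq_lintegral (μ := μ) (f := f) (p := 2) (by norm_num)
  norm_num at this
  exact_mod_cast this

theorem eLpNorm_two_le_of_sq_le {α β : Type*} [MeasurableSpace α] [MeasurableSpace β]
    {μ : Measure α} {ν : Measure β} {f : α → ℂ} {g : β → ℂ} {C : ℝ≥0∞}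
    (h : ∫⁻ x, ‖f x‖ₑ ^ 2 ∂μ ≤ C ^ 2 * ∫⁻ x, ‖g x‖ₑ ^ 2 ∂ν) :
    eLpNorm f 2 μ ≤ C * eLpNorm g 2 ν := by
  rw [← eLpNorm_two_sq, ← eLpNorm_two_sq, ← mul_pow] at h
  exact (ENNReal.pow_le_pow_left_iff two_ne_zero).1 h

/-- The `L²` Fourier transform agrees with the Fourier integral on `L¹ ∩ L²`. -/
theorem fourier_toLp_ae_eq {h : ℝ → ℂ} (h1 : Integrable h) (h2 : MemLp h 2) :
    (𝓕 (h2.toLp h) : Lp ℂ 2 (volume : Measure ℝ)) =ᵐ[volume] 𝓕 h := by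
  have hcont : Continuous (𝓕 h) :=
    VectorFourier.fourierIntegral_continuous Real.continuous_fourierChar continuous_inner h1
  refine ae_eq_of_integral_contDiff_smul_eq
    ((Lp.memLp (𝓕 (h2.toLp h))).locallyIntegrable (by norm_num)) hcont.locallyIntegrable ?_
  intro g hg hgc
  have hgc' : HasCompactSupport fun x => (g x : ℂ) := hgc.comp_left Complex.ofReal_zero
  let u : 𝓢(ℝ, ℂ) := hgc'.toSchwartzMap (Complex.ofRealCLM.contDiff.comp hg)
  have hu : ∀ x, u x = (g x : ℂ) := fun x => rfl
  have e1 := congrArg (fun T => T u) (Lp.fourier_toTemperedDistribution_eq (h2.toLp h))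
  simp only [TemperedDistribution.fourier_apply, Lp.toTemperedDistribution_apply] at e1
  have e2 := VectorFourier.integral_fourierIntegral_smul_eq_flip (L := innerₗ ℝ)
    Real.continuous_fourierChar continuous_inner
    (u.integrable (μ := volume)) h1
  simp only [flip_innerₗ] at e2
  have e3 : ∫ x, (𝓕 u) x • (h2.toLp h : ℝ → ℂ) x = ∫ x, (𝓕 u) x • h x :=
    integral_congr_ae (by filter_upwards [h2.coeFn_toLp] with x hx; rw [hx])
  calc ∫ x, g x • (𝓕 (h2.toLp h) : Lp ℂ 2 (volume : Measure ℝ)) x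
      = ∫ x, u x • (𝓕 (h2.toLp h) : Lp ℂ 2 (volume : Measure ℝ)) x := by
        simp only [hu, Complex.real_smul, smul_eq_mul]
    _ = ∫ x, (𝓕 u) x • h x := by rw [← e1, e3]
    _ = ∫ x, u x • 𝓕 h x := e2
    _ = ∫ x, g x • 𝓕 h x := by simp only [hu, Complex.real_smul, smul_eq_mul]

theorem eLpNorm_fourier_eq {h : ℝ → ℂ} (h1 : Integrable h) (h2 : MemLp h 2) :
    eLpNorm (𝓕 h) 2 volume = eLpNorm h 2 volume := by
  rw [← eLpNorm_congr_ae (fourier_toLp_ae_eq h1 h2), ← eLpNorm_congr_ae h2.coeFn_toLp,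
    ← Lp.enorm_def, ← Lp.enorm_def, ← ofReal_norm, ← ofReal_norm, Lp.norm_fourier_eq]

/-- Extended by zero, h has this integral as its Fourier transform at -r/(2π), and Plancherel
applies. -/
theorem eLpNorm_integral_exp_le {h : ℝ → ℂ} (h1 : IntegrableOn h (Ioi 0))
    (h2 : MemLp h 2 (volume.restrict (Ioi 0))) :
    eLpNorm (fun r : ℝ => ∫ ρ in Ioi (0 : ℝ), Complex.exp (Complex.I * (r * ρ : ℝ)) * h ρ) 2
      (volume.restrict (Ioi 0)) ≤
      ENNReal.ofReal (2 * Real.pi) * eLpNorm h 2 (volume.restrict (Ioi 0)) := by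
  have hi1 : Integrable ((Ioi (0 : ℝ)).indicator h) := h1.integrable_indicator measurableSet_Ioi
  have hi2 : MemLp ((Ioi (0 : ℝ)).indicator h) 2 := (memLp_indicator_iff_restrict measurableSet_Ioi).2 h2
  have hc : (-(2 * Real.pi)⁻¹ : ℝ) ≠ 0 := by
    have := Real.pi_pos
    exact neg_ne_zero.2 (by positivity)
  have hF : ∀ r : ℝ, ∫ ρ in Ioi (0 : ℝ), Complex.exp (Complex.I * (r * ρ : ℝ)) * h ρ =
      𝓕 ((Ioi (0 : ℝ)).indicator h) (-(2 * Real.pi)⁻¹ * r) := by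
    intro r
    rw [Real.fourier_real_eq_integral_exp_smul, ← integral_indicator measurableSet_Ioi]
    refine integral_congr_ae (Eventually.of_forall fun ρ => ?_)
    simp only
    by_cases hρ : ρ ∈ Ioi (0 : ℝ)
    · rw [indicator_of_mem hρ, indicator_of_mem hρ, smul_eq_mul]
      congr 2
      have := Real.pi_ne_zero
      rw [mul_comm]
      congr 2
      field_simp
    · rw [indicator_of_notMem hρ, indicator_of_notMem hρ, smul_zero]
  simp only [hF]
  have hcont : Continuous (𝓕 ((Ioi (0 : ℝ)).indicator h)) :=
    VectorFourier.fourierIntegral_continuous Real.continuous_fourierChar continuous_inner hi1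
  have hpl := eLpNorm_fourier_eq hi1 hi2
  rw [eLpNorm_indicator_eq_eLpNorm_restrict measurableSet_Ioi] at hpl
  rw [← hpl]
  refine (eLpNorm_mono_measure _ Measure.restrict_le_self).trans (eLpNorm_two_le_of_sq_le ?_)
  have hm : Measurable fun x : ℝ => ‖𝓕 ((Ioi (0 : ℝ)).indicator h) x‖ₑ ^ 2 := by
    have := hcont.measurable
    fun_prop
  have hmap := lintegral_map (μ := (volume : Measure ℝ)) hm (measurable_const_mul (-(2 * Real.pi)⁻¹))
  rw [Real.map_volume_mul_left hc, lintegral_smul_measure] at hmap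
  rw [← hmap, smul_eq_mul]
  refine mul_le_mul_left ?_ _
  -- The dilation multiplies the squared norm by 2π, which is bounded crudely by (2π)².
  rw [inv_neg, inv_inv, abs_neg, abs_of_pos (by positivity), sq]
  refine le_mul_of_one_le_left zero_le ?_
  rw [ENNReal.one_le_ofReal]
  linarith [Real.two_le_pi]

/-! ### Schur's test for kernels in the product of the variables -/

/-- The weight `s^{-1/2}` of Schur's test. -/
noncomputable def schurWeight (s : ℝ) : ℝ≥0∞ := ENNReal.ofReal (s ^ (-(1 / 2) : ℝ))

theorem measurable_schurWeight : Measurable schurWeight := by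
  unfold schurWeight
  fun_prop

/-- Substitution s = rρ. The weight is multiplicative and its square at ρ is 1/ρ, the Jacobian; the
exponent -1/2 is the one for which the weight reproduces itself. -/
theorem lintegral_schurWeight (E : ℝ → ℝ≥0∞) (hE : Measurable E) {ρ : ℝ} (hρ : 0 < ρ) :
    ∫⁻ r in Ioi (0 : ℝ), E (r * ρ) * schurWeight r =
      schurWeight ρ * ∫⁻ s in Ioi (0 : ℝ), E s * schurWeight s := by
  have hmap := lintegral_map (μ := (volume : Measure ℝ))
    (f := (Ioi (0 : ℝ)).indicator fun s => E s * schurWeight s)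
    ((hE.mul measurable_schurWeight).indicator measurableSet_Ioi) (measurable_const_mul ρ)
  rw [Real.map_volume_mul_left hρ.ne', lintegral_smul_measure, lintegral_indicator measurableSet_Ioi,
    smul_eq_mul] at hmap
  have e : ∀ r : ℝ, (Ioi (0 : ℝ)).indicator (fun s => E s * schurWeight s) (ρ * r) =
      (Ioi (0 : ℝ)).indicator (fun r => schurWeight ρ * (E (r * ρ) * schurWeight r)) r := by
    intro r
    by_cases hr : 0 < r
    · rw [indicator_of_mem (mem_Ioi.2 (mul_pos hρ hr)), indicator_of_mem (mem_Ioi.2 hr), mul_comm ρ r]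
      rw [schurWeight, Real.mul_rpow hr.le hρ.le, ENNReal.ofReal_mul (by positivity)]
      simp only [schurWeight]
      ring
    · rw [indicator_of_notMem (fun h : ρ * r ∈ Ioi (0 : ℝ) => hr ((mul_pos_iff_of_pos_left hρ).1 h)),
        indicator_of_notMem (fun h : r ∈ Ioi (0 : ℝ) => hr h)]
  simp only [e] at hmap
  rw [lintegral_indicator measurableSet_Ioi, lintegral_const_mul' (schurWeight ρ) _ ENNReal.ofReal_ne_top] at hmap
  have hw : schurWeight ρ * schurWeight ρ = ENNReal.ofReal |ρ⁻¹| := by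
    rw [schurWeight, ← ENNReal.ofReal_mul (by positivity), ← Real.rpow_add hρ,
      abs_of_pos (by positivity)]
    norm_num [Real.rpow_neg_one]
  have hw0 : schurWeight ρ ≠ 0 := by
    rw [schurWeight]
    exact (ENNReal.ofReal_pos.2 (by positivity)).ne'
  rw [← hw, mul_assoc] at hmap
  exact ((ENNReal.mul_right_inj hw0 ENNReal.ofReal_ne_top).1 hmap).symm

/-- Schur's test for kernels depending on the product of the variables. -/
theorem lintegral_sq_schur (E : ℝ → ℝ≥0∞) (hE : Measurable E) (f : ℝ → ℝ≥0∞) (hf : Measurable f) :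
    ∫⁻ r in Ioi (0 : ℝ), (∫⁻ ρ in Ioi (0 : ℝ), E (r * ρ) * f ρ) ^ 2 ≤
      (∫⁻ s in Ioi (0 : ℝ), E s * schurWeight s) ^ 2 * ∫⁻ ρ in Ioi (0 : ℝ), f ρ ^ 2 := by
  set B := ∫⁻ s in Ioi (0 : ℝ), E s * schurWeight s with hB
  have hw0 : ∀ ρ : ℝ, 0 < ρ → schurWeight ρ ≠ 0 := fun ρ hρ => by
    rw [schurWeight]
    exact (ENNReal.ofReal_pos.2 (by positivity)).ne'
  have hwt : ∀ ρ : ℝ, schurWeight ρ ≠ ⊤ := fun ρ => ENNReal.ofReal_ne_top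
  have hmw := measurable_schurWeight
  have hcs : ∀ r : ℝ, 0 < r → (∫⁻ ρ in Ioi (0 : ℝ), E (r * ρ) * f ρ) ^ 2 ≤
      schurWeight r * B * ∫⁻ ρ in Ioi (0 : ℝ), E (r * ρ) * ((schurWeight ρ)⁻¹ * f ρ ^ 2) := by
    intro r hr
    -- Cauchy–Schwarz for Ef = (Eω)^{1/2} (Eω⁻¹f²)^{1/2}, with ω the Schur weight and E taken at rρ.
    have h1 := ENNReal.lintegral_mul_norm_pow_le (μ := volume.restrict (Ioi (0 : ℝ)))
      (f := fun ρ => E (r * ρ) * schurWeight ρ)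
      (g := fun ρ => E (r * ρ) * ((schurWeight ρ)⁻¹ * f ρ ^ 2))
      (by fun_prop) (by fun_prop) (p := 1 / 2) (q := 1 / 2)
      (by norm_num) (by norm_num) (by norm_num)
    have h2 : ∫⁻ ρ in Ioi (0 : ℝ), E (r * ρ) * schurWeight ρ = schurWeight r * B := by
      rw [hB, ← lintegral_schurWeight E hE hr]
      simp only [mul_comm r]
    have h3 : ∫⁻ ρ in Ioi (0 : ℝ), E (r * ρ) * f ρ =
        ∫⁻ ρ in Ioi (0 : ℝ), (E (r * ρ) * schurWeight ρ) ^ (1 / 2 : ℝ) *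
          (E (r * ρ) * ((schurWeight ρ)⁻¹ * f ρ ^ 2)) ^ (1 / 2 : ℝ) := by
      refine setLIntegral_congr_fun measurableSet_Ioi fun ρ hρ => ?_
      rw [← ENNReal.mul_rpow_of_nonneg _ _ (by norm_num)]
      have : E (r * ρ) * schurWeight ρ * (E (r * ρ) * ((schurWeight ρ)⁻¹ * f ρ ^ 2)) =
          (E (r * ρ) * f ρ) ^ 2 := by
        calc _ = (schurWeight ρ * (schurWeight ρ)⁻¹) * (E (r * ρ) * f ρ) ^ 2 := by ring
          _ = _ := by rw [ENNReal.mul_inv_cancel (hw0 ρ hρ) (hwt ρ), one_mul]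
      rw [this, ← ENNReal.rpow_natCast, ← ENNReal.rpow_mul]
      norm_num
    rw [h3, ← h2]
    refine (pow_le_pow_left' h1 2).trans (le_of_eq ?_)
    rw [mul_pow, ← ENNReal.rpow_natCast, ← ENNReal.rpow_natCast, ← ENNReal.rpow_mul,
      ← ENNReal.rpow_mul]
    norm_num
  calc ∫⁻ r in Ioi (0 : ℝ), (∫⁻ ρ in Ioi (0 : ℝ), E (r * ρ) * f ρ) ^ 2
      ≤ ∫⁻ r in Ioi (0 : ℝ), schurWeight r * B *
          ∫⁻ ρ in Ioi (0 : ℝ), E (r * ρ) * ((schurWeight ρ)⁻¹ * f ρ ^ 2) :=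
        setLIntegral_mono' measurableSet_Ioi fun r hr => hcs r hr
    _ = ∫⁻ r in Ioi (0 : ℝ), ∫⁻ ρ in Ioi (0 : ℝ),
          schurWeight r * B * (E (r * ρ) * ((schurWeight ρ)⁻¹ * f ρ ^ 2)) := by
        refine setLIntegral_congr_fun measurableSet_Ioi fun r _ => ?_
        exact (lintegral_const_mul _ (by fun_prop)).symm
    _ = ∫⁻ ρ in Ioi (0 : ℝ), ∫⁻ r in Ioi (0 : ℝ),
          schurWeight r * B * (E (r * ρ) * ((schurWeight ρ)⁻¹ * f ρ ^ 2)) := by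
        refine lintegral_lintegral_swap (Measurable.aemeasurable ?_)
        have : Measurable fun p : ℝ × ℝ => E (p.1 * p.2) := hE.comp (measurable_fst.mul measurable_snd)
        exact ((hmw.comp measurable_fst).mul_const B).mul (this.mul
          ((hmw.comp measurable_snd).inv.mul ((hf.comp measurable_snd).pow_const 2)))
    _ = ∫⁻ ρ in Ioi (0 : ℝ), B ^ 2 * f ρ ^ 2 := by
        refine setLIntegral_congr_fun measurableSet_Ioi fun ρ hρ => ?_
        calc _ = ∫⁻ r in Ioi (0 : ℝ), (B * ((schurWeight ρ)⁻¹ * f ρ ^ 2)) *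
              (E (r * ρ) * schurWeight r) := by
              refine lintegral_congr fun r => by ring
          _ = (B * ((schurWeight ρ)⁻¹ * f ρ ^ 2)) * (schurWeight ρ * B) := by
              rw [lintegral_const_mul _ (by fun_prop), lintegral_schurWeight E hE hρ]
          _ = (schurWeight ρ * (schurWeight ρ)⁻¹) * (B ^ 2 * f ρ ^ 2) := by ring
          _ = _ := by rw [ENNReal.mul_inv_cancel (hw0 ρ hρ) (hwt ρ), one_mul]
    _ = _ := lintegral_const_mul _ (by fun_prop)

/-! ### The leading asymptotics of the Hankel function -/

theorem norm_cpow_sub_le {u : ℝ} (hu : 0 ≤ u) :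
    ‖((u : ℂ) - 2 * Complex.I) ^ ((-(1 / 2) : ℝ) : ℂ) -
      (((0 : ℝ) : ℂ) - 2 * Complex.I) ^ ((-(1 / 2) : ℝ) : ℂ)‖ ≤ u := by
  -- On the line Im z = -2 the power is smooth with derivative of norm ½|z|^{-3/2} ≤ 1, so the mean
  -- value inequality gives Lipschitz constant 1.
  have hsl : ∀ v : ℝ, ((v : ℂ) - 2 * Complex.I) ∈ Complex.slitPlane := fun v => by
    refine Or.inr ?_
    simp
  have hn : ∀ v : ℝ, 1 ≤ ‖(v : ℂ) - 2 * Complex.I‖ := fun v => by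
    refine le_trans ?_ (Complex.abs_im_le_norm _)
    simp
  have hd : ∀ v : ℝ, HasDerivAt (fun v : ℝ => ((v : ℂ) - 2 * Complex.I) ^ ((-(1 / 2) : ℝ) : ℂ))
      (((-(1 / 2) : ℝ) : ℂ) * ((v : ℂ) - 2 * Complex.I) ^ (((-(1 / 2) : ℝ) : ℂ) - 1)) v := fun v => by
    have h0 : HasDerivAt (fun v : ℝ => (v : ℂ) - 2 * Complex.I) 1 v :=
      (Complex.ofRealCLM.hasDerivAt (x := v)).sub_const _
    have h1 : HasDerivAt (fun z : ℂ => z ^ ((-(1 / 2) : ℝ) : ℂ))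
        (((-(1 / 2) : ℝ) : ℂ) * ((v : ℂ) - 2 * Complex.I) ^ (((-(1 / 2) : ℝ) : ℂ) - 1) * 1)
        ((v : ℂ) - 2 * Complex.I) := (hasDerivAt_id _).cpow_const (hsl v)
    refine (h1.comp (h₂ := fun z : ℂ => z ^ ((-(1 / 2) : ℝ) : ℂ)) v h0).congr_deriv ?_
    ring
  have hb : ∀ v : ℝ, ‖((-(1 / 2) : ℝ) : ℂ) *
      ((v : ℂ) - 2 * Complex.I) ^ (((-(1 / 2) : ℝ) : ℂ) - 1)‖ ≤ 1 := fun v => by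
    rw [show ((-(1 / 2) : ℝ) : ℂ) - 1 = ((-(3 / 2) : ℝ) : ℂ) by push_cast; ring, norm_mul,
      Complex.norm_cpow_real, Complex.norm_real]
    have h1 := Real.rpow_le_one_of_one_le_of_nonpos (hn v) (by norm_num : (-(3 / 2) : ℝ) ≤ 0)
    have h2 : 0 ≤ ‖(v : ℂ) - 2 * Complex.I‖ ^ (-(3 / 2) : ℝ) := by positivity
    norm_num
    norm_num at h1 h2
    linarith
  have := convex_univ.norm_image_sub_le_of_norm_hasDerivWithin_le
    (fun v _ => (hd v).hasDerivWithinAt) (fun v _ => hb v) (mem_univ (0 : ℝ)) (mem_univ u)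
  rw [one_mul, sub_zero, Real.norm_of_nonneg hu] at this
  exact this

/-- The leading coefficient of the weight at the origin. -/
noncomputable def weightCoeff : ℂ :=
  -(2 * Complex.I / Real.pi) * (((0 : ℝ) : ℂ) - 2 * Complex.I) ^ ((-(1 / 2) : ℝ) : ℂ)

/-- Here 1 - (1 + iu)² = u(u - 2i), and the principal power of a product splits when one factor is
positive. The second factor is then frozen at u = 0. -/
theorem norm_hankelWeight_sub_le {u : ℝ} (hu : 0 < u) :
    ‖hankelWeight u - weightCoeff * ((u ^ (-(1 / 2) : ℝ) : ℝ) : ℂ)‖ ≤ 1 * u ^ (1 / 2 : ℝ) := by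
  have e : (1 - (((1 : ℝ) : ℂ) + u * Complex.I) ^ 2) = (u : ℂ) * ((u : ℂ) - 2 * Complex.I) := by
    push_cast
    linear_combination (-(u : ℂ) ^ 2) * Complex.I_sq
  have hne : ((u : ℂ) - 2 * Complex.I) ≠ 0 := fun h => by
    have := congrArg Complex.im h
    simp at this
  have e2 : ((u : ℂ) * ((u : ℂ) - 2 * Complex.I)) ^ ((-(1 / 2) : ℝ) : ℂ) =
      ((u ^ (-(1 / 2) : ℝ) : ℝ) : ℂ) * ((u : ℂ) - 2 * Complex.I) ^ ((-(1 / 2) : ℝ) : ℂ) := by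
    have hu' : (u : ℂ) ≠ 0 := by exact_mod_cast hu.ne'
    rw [Complex.ofReal_cpow hu.le, Complex.cpow_def_of_ne_zero (mul_ne_zero hu' hne),
      Complex.cpow_def_of_ne_zero hu', Complex.cpow_def_of_ne_zero hne, Complex.log_ofReal_mul hu hne,
      add_mul, Complex.exp_add, Complex.ofReal_log hu.le]
  have e3 : hankelWeight u - weightCoeff * ((u ^ (-(1 / 2) : ℝ) : ℝ) : ℂ) =
      -(2 * Complex.I / Real.pi) * ((u ^ (-(1 / 2) : ℝ) : ℝ) : ℂ) *
        (((u : ℂ) - 2 * Complex.I) ^ ((-(1 / 2) : ℝ) : ℂ) -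
      (((0 : ℝ) : ℂ) - 2 * Complex.I) ^ ((-(1 / 2) : ℝ) : ℂ)) := by
    rw [hankelWeight, e, e2, weightCoeff]
    ring
  rw [e3, norm_mul, norm_mul, norm_neg, norm_div, norm_mul, Complex.norm_I,
    Complex.norm_real, Complex.norm_real, Real.norm_of_nonneg Real.pi_pos.le, Complex.norm_ofNat,
    mul_one, Real.norm_of_nonneg (by positivity)]
  have h2 : 2 / Real.pi ≤ 1 := (div_le_one Real.pi_pos).2 Real.two_le_pi
  calc _ ≤ 1 * u ^ (-(1 / 2) : ℝ) * u := by
        gcongr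
        exact norm_cpow_sub_le hu.le
    _ = 1 * (u ^ (-(1 / 2) : ℝ) * u ^ (1 : ℝ)) := by rw [Real.rpow_one, mul_assoc]
    _ = _ := by
      rw [← Real.rpow_add hu]
      norm_num

/-- The leading term of `s^{1/2} H₀⁽¹⁾(s)` at infinity. -/
theorem exists_norm_hankel1_sub_le : ∃ (c : ℂ) (C : ℝ), 0 ≤ C ∧ ∀ s : ℝ, 0 < s →
    ‖((s ^ (1 / 2 : ℝ) : ℝ) : ℂ) * hankel1 s - c * Complex.exp (Complex.I * s)‖ ≤
      C * min 1 s⁻¹ := by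
  obtain ⟨C₀, hC₀, hC₀'⟩ := exists_norm_hankel1_le
  set c : ℂ := weightCoeff * (Real.Gamma (1 / 2) : ℂ) with hc
  set C₁ : ℝ := Real.Gamma (3 / 2) with hC₁
  have hC₁0 : 0 ≤ C₁ := (Real.Gamma_pos_of_pos (by norm_num)).le
  refine ⟨c, max (C₀ + ‖c‖) C₁, le_max_of_le_right hC₁0, fun s hs => ?_⟩
  have hexp : ‖Complex.exp (Complex.I * s)‖ = 1 := by
    rw [mul_comm, Complex.norm_exp_ofReal_mul_I]
  rw [mul_min_of_nonneg _ _ (le_max_of_le_right hC₁0)]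
  -- The constant bound comes from |H₀⁽¹⁾(s)| ≤ C₀ s^{-1/2}. The decay is Watson's lemma: the weight
  -- u^{-1/2} contributes Γ(1/2)s^{-1/2} exactly, and an O(u^{1/2}) error contributes at most
  -- Γ(3/2)s^{-3/2}.
  refine le_min ?_ ?_
  · rw [mul_one]
    refine (norm_sub_le _ _).trans (le_max_of_le_left ?_)
    rw [norm_mul, norm_mul, hexp, mul_one, Complex.norm_real, Real.norm_of_nonneg (by positivity)]
    gcongr
    calc _ ≤ s ^ (1 / 2 : ℝ) * (C₀ * s ^ (-(1 / 2) : ℝ)) := by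
          gcongr
          exact hC₀' s hs
      _ = C₀ * (s ^ (1 / 2 : ℝ) * s ^ (-(1 / 2) : ℝ)) := by ring
      _ = C₀ := by rw [← Real.rpow_add hs]; norm_num
  · have hi1 : IntegrableOn (fun u : ℝ => (Real.exp (-(s * u)) : ℂ) * hankelWeight u) (Ioi 0) :=
      integrableOn_laplace (C := 1) (s := -(1 / 2)) (by norm_num) measurable_hankelWeight
        (fun u hu => by rw [one_mul]; exact norm_hankelWeight_le u hu) hs
    have hi2 : IntegrableOn (fun u : ℝ => (Real.exp (-(s * u)) : ℂ) *
        (weightCoeff * ((u ^ (-(1 / 2) : ℝ) : ℝ) : ℂ))) (Ioi 0) := by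
      have := ((integrableOn_exp_mul_rpow hs (by norm_num : (-1 : ℝ) < -(1 / 2))).ofReal
        (𝕜 := ℂ)).const_mul weightCoeff
      refine this.congr (Eventually.of_forall fun u => ?_)
      simp only [RCLike.ofReal_mul, Complex.coe_algebraMap]
      change weightCoeff * (((Real.exp (-(s * u)) : ℝ) : ℂ) * ((u ^ (-(1 / 2) : ℝ) : ℝ) : ℂ)) = _
      ring
    have hGam : ∀ a : ℝ, 0 < a → ∫ u in Ioi (0 : ℝ), Real.exp (-(s * u)) * u ^ (a - 1) =
        s ^ (-a) * Real.Gamma a := fun a ha => by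
      have := Real.integral_rpow_mul_exp_neg_mul_Ioi ha hs
      rw [one_div, Real.inv_rpow hs.le, ← Real.rpow_neg hs.le] at this
      rw [← this]
      simp only [mul_comm]
    have hL : laplace hankelWeight s - c * ((s ^ (-(1 / 2) : ℝ) : ℝ) : ℂ) =
        laplace (fun u => hankelWeight u - weightCoeff * ((u ^ (-(1 / 2) : ℝ) : ℝ) : ℂ)) s := by
      have e1 : ∫ u in Ioi (0 : ℝ), (Real.exp (-(s * u)) : ℂ) *
          (weightCoeff * ((u ^ (-(1 / 2) : ℝ) : ℝ) : ℂ)) = c * ((s ^ (-(1 / 2) : ℝ) : ℝ) : ℂ) := by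
        have h1 := hGam (1 / 2) (by norm_num)
        rw [show (1 / 2 - 1 : ℝ) = -(1 / 2) by norm_num] at h1
        have h2 := congrArg (fun x : ℝ => weightCoeff * (x : ℂ)) h1
        simp only [Complex.ofReal_mul] at h2
        rw [← integral_complex_ofReal, ← integral_const_mul] at h2
        rw [hc, mul_assoc, mul_comm (Real.Gamma (1 / 2) : ℂ), ← h2]
        refine integral_congr_ae (Eventually.of_forall fun u => ?_)
        simp only [Complex.ofReal_mul]
        ring
      rw [← e1, laplace, laplace, ← integral_sub hi1 hi2]
      refine integral_congr_ae (Eventually.of_forall fun u => ?_)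
      simp only
      ring
    have hN := norm_laplace_le (C := 1) (s := 1 / 2) (r := s) (by norm_num)
      (fun u hu => norm_hankelWeight_sub_le hu) hs
    rw [one_mul, show (1 / 2 : ℝ) = 3 / 2 - 1 by norm_num, hGam (3 / 2) (by norm_num)] at hN
    rw [show (3 / 2 - 1 : ℝ) = 1 / 2 by norm_num, ← hL] at hN
    have hss : ((s ^ (1 / 2 : ℝ) : ℝ) : ℂ) * ((s ^ (-(1 / 2) : ℝ) : ℝ) : ℂ) = 1 := by
      rw [← Complex.ofReal_mul, ← Real.rpow_add hs]
      norm_num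
    have e : ((s ^ (1 / 2 : ℝ) : ℝ) : ℂ) * hankel1 s - c * Complex.exp (Complex.I * s) =
        Complex.exp (Complex.I * s) * (((s ^ (1 / 2 : ℝ) : ℝ) : ℂ) *
          (laplace hankelWeight s - c * ((s ^ (-(1 / 2) : ℝ) : ℝ) : ℂ))) := by
      rw [hankel1_eq hs]
      linear_combination c * Complex.exp (Complex.I * s) * hss
    rw [e, norm_mul, hexp, one_mul, norm_mul, Complex.norm_real, Real.norm_of_nonneg (by positivity)]
    calc _ ≤ s ^ (1 / 2 : ℝ) * (s ^ (-(3 / 2) : ℝ) * C₁) := by gcongr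
      _ = C₁ * (s ^ (1 / 2 : ℝ) * s ^ (-(3 / 2) : ℝ)) := by ring
      _ = C₁ * s⁻¹ := by
        rw [← Real.rpow_add hs]
        norm_num [Real.rpow_neg_one]
      _ ≤ _ := by
        gcongr
        exact le_max_right _ _

/-- Proved from the defining integrals, since the Laplace representation is available only for r >
0. -/
theorem measurable_hankel1 : Measurable hankel1 := by
  have h1 : Measurable fun r : ℝ => ∫ s in Ioi (0 : ℝ), Real.exp (-(r * Real.sinh s)) := by
    have hm : StronglyMeasurable (Function.uncurry fun r s : ℝ => Real.exp (-(r * Real.sinh s))) :=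
      (by fun_prop : Continuous fun p : ℝ × ℝ => Real.exp (-(p.1 * Real.sinh p.2))).stronglyMeasurable
    exact (hm.integral_prod_right (ν := volume.restrict (Ioi 0))).measurable
  have h2 : Continuous fun r : ℝ => ∫ θ in (0 : ℝ)..Real.pi, Real.sin (r * Real.sin θ) :=
    intervalIntegral.continuous_parametric_intervalIntegral_of_continuous' (by fun_prop) _ _
  have h3 := h2.measurable
  have h4 := continuous_besselJ0.measurable
  have h5 : Measurable besselY0 := by
    unfold besselY0
    fun_prop
  unfold hankel1
  fun_prop

/-- The integrand is comparable to s^{-1/2} at 0 and to s^{-3/2} at infinity, both integrable. -/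
theorem lintegral_min_schurWeight_ne_top (C : ℝ) :
    ∫⁻ s in Ioi (0 : ℝ), ENNReal.ofReal (C * min 1 s⁻¹) * schurWeight s ≠ ⊤ := by
  have hint : IntegrableOn (fun s : ℝ => |C| * (min 1 s⁻¹ * s ^ (-(1 / 2) : ℝ))) (Ioi 0) := by
    refine Integrable.const_mul ?_ |C|
    change IntegrableOn (fun s : ℝ => min 1 s⁻¹ * s ^ (-(1 / 2) : ℝ)) (Ioi 0)
    rw [← Ioc_union_Ioi_eq_Ioi zero_le_one]
    refine IntegrableOn.union ?_ ?_
    · have h := (intervalIntegral.intervalIntegrable_rpow' (a := 0) (b := 1)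
        (r := -(1 / 2)) (by norm_num)).1
      refine h.congr_fun (fun s hs => ?_) measurableSet_Ioc
      rw [min_eq_left ((one_le_inv₀ hs.1).2 hs.2), one_mul]
    · refine (integrableOn_Ioi_rpow_of_lt (by norm_num : (-(3 / 2) : ℝ) < -1) one_pos).congr_fun
        (fun s hs => ?_) measurableSet_Ioi
      have hs' : (1 : ℝ) < s := hs
      simp only
      rw [min_eq_right (inv_le_one_of_one_le₀ hs'.le), ← Real.rpow_neg_one,
        ← Real.rpow_add (by linarith)]
      norm_num
  refine ne_top_of_le_ne_top hint.2.ne (setLIntegral_mono' measurableSet_Ioi fun s hs => ?_)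
  have hs' : (0 : ℝ) < s := hs
  have h0 : 0 ≤ min 1 s⁻¹ := le_min zero_le_one (by positivity)
  have h1 : 0 ≤ |C| * (min 1 s⁻¹ * s ^ (-(1 / 2) : ℝ)) := by positivity
  rw [schurWeight, Real.enorm_of_nonneg h1, ← mul_assoc,
    ENNReal.ofReal_mul (mul_nonneg (abs_nonneg C) h0)]
  refine mul_le_mul_left (ENNReal.ofReal_le_ofReal (mul_le_mul_of_nonneg_right ?_ h0)) _
  exact le_abs_self C

/-- The Hankel transform is bounded on `L²` of the half-line. -/
theorem exists_eLpNorm_hankelTransform_le : ∃ C : ℝ≥0∞, C ≠ ⊤ ∧ ∀ h : ℝ → ℂ, Measurable h →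
    IntegrableOn h (Ioi 0) → MemLp h 2 (volume.restrict (Ioi 0)) →
    eLpNorm (fun r : ℝ => ∫ ρ in Ioi (0 : ℝ),
      (((r * ρ) ^ (1 / 2 : ℝ) : ℝ) : ℂ) * hankel1 (r * ρ) * h ρ) 2 (volume.restrict (Ioi 0)) ≤
      C * eLpNorm h 2 (volume.restrict (Ioi 0)) := by
  obtain ⟨c, C, hC0, hC⟩ := exists_norm_hankel1_sub_le
  set B := ∫⁻ s in Ioi (0 : ℝ), ENNReal.ofReal (C * min 1 s⁻¹) * schurWeight s with hB
  refine ⟨‖c‖ₑ * ENNReal.ofReal (2 * Real.pi) + B, ?_, fun h hm h1 h2 => ?_⟩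
  · exact ENNReal.add_ne_top.2 ⟨ENNReal.mul_ne_top enorm_ne_top ENNReal.ofReal_ne_top,
      lintegral_min_schurWeight_ne_top C⟩
  have hmH := measurable_hankel1
  -- The kernel is split into c e^{irρ}, a Fourier transform, and D(rρ), to which Schur's test
  -- applies.
  let D : ℝ → ℂ := fun s => ((s ^ (1 / 2 : ℝ) : ℝ) : ℂ) * hankel1 s - c * Complex.exp (Complex.I * s)
  have hmD : Measurable D := by
    simp only [D]
    fun_prop
  let F : ℝ → ℂ := fun r => ∫ ρ in Ioi (0 : ℝ), Complex.exp (Complex.I * (r * ρ : ℝ)) * h ρ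
  let R : ℝ → ℂ := fun r => ∫ ρ in Ioi (0 : ℝ), D (r * ρ) * h ρ
  have hmF : StronglyMeasurable F := by
    refine StronglyMeasurable.integral_prod_right (ν := volume.restrict (Ioi 0))
      (f := fun r ρ : ℝ => Complex.exp (Complex.I * (r * ρ : ℝ)) * h ρ)
      (Measurable.stronglyMeasurable ?_)
    simp only [Function.uncurry_def]
    fun_prop
  have hmR : StronglyMeasurable R := by
    refine StronglyMeasurable.integral_prod_right (ν := volume.restrict (Ioi 0))
      (f := fun r ρ : ℝ => D (r * ρ) * h ρ) (Measurable.stronglyMeasurable ?_)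
    simp only [Function.uncurry_def]
    fun_prop
  have hE : Integrable (fun ρ : ℝ => h ρ) (volume.restrict (Ioi 0)) := h1
  have hsplit : (fun r : ℝ => ∫ ρ in Ioi (0 : ℝ),
      (((r * ρ) ^ (1 / 2 : ℝ) : ℝ) : ℂ) * hankel1 (r * ρ) * h ρ)
      =ᵐ[volume.restrict (Ioi 0)] (fun r => c * F r) + R := by
    refine (ae_restrict_iff' measurableSet_Ioi).2 (Eventually.of_forall fun r hr => ?_)
    have hr' : (0 : ℝ) < r := hr
    have hiF : Integrable (fun ρ : ℝ => Complex.exp (Complex.I * (r * ρ : ℝ)) * h ρ)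
        (volume.restrict (Ioi 0)) := by
      refine hE.bdd_mul (c := 1) (by fun_prop) (Eventually.of_forall fun ρ => ?_)
      rw [mul_comm, Complex.norm_exp_ofReal_mul_I]
    have hiR : Integrable (fun ρ : ℝ => D (r * ρ) * h ρ) (volume.restrict (Ioi 0)) := by
      refine hE.bdd_mul (c := C) (hmD.comp (measurable_const_mul r)).aestronglyMeasurable ?_
      refine (ae_restrict_iff' measurableSet_Ioi).2 (Eventually.of_forall fun ρ hρ => ?_)
      refine (hC (r * ρ) (mul_pos hr' hρ)).trans ?_
      exact mul_le_of_le_one_right hC0 (min_le_left _ _)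
    simp only [Pi.add_apply, F, R]
    rw [← integral_const_mul, ← integral_add (hiF.const_mul c) hiR]
    refine integral_congr_ae (Eventually.of_forall fun ρ => ?_)
    simp only [D]
    push_cast
    ring
  rw [eLpNorm_congr_ae hsplit, add_mul]
  refine (eLpNorm_add_le (hmF.aestronglyMeasurable.const_mul c) hmR.aestronglyMeasurable
    (by norm_num)).trans (add_le_add ?_ ?_)
  · have := eLpNorm_const_smul c F 2 (volume.restrict (Ioi (0 : ℝ)))
    refine (le_of_eq this).trans ?_
    rw [mul_assoc]
    gcongr
    exact eLpNorm_integral_exp_le h1 h2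
  · refine eLpNorm_two_le_of_sq_le (le_trans ?_ (lintegral_sq_schur
      (fun s => ENNReal.ofReal (C * min 1 s⁻¹)) (by fun_prop) (fun ρ => ‖h ρ‖ₑ) (by fun_prop)))
    refine setLIntegral_mono' measurableSet_Ioi fun r hr => ?_
    gcongr
    refine (enorm_integral_le_lintegral_enorm _).trans
      (setLIntegral_mono' measurableSet_Ioi fun ρ hρ => ?_)
    rw [enorm_mul]
    gcongr
    rw [← ofReal_norm]
    exact ENNReal.ofReal_le_ofReal (hC (r * ρ) (mul_pos hr hρ))

/-! ### Polar coordinates in the plane -/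

/-- The identification of `ℂ` with the plane. -/
noncomputable def planeEquiv : ℂ ≃ₗᵢ[ℝ] Plane := Complex.orthonormalBasisOneI.repr

/-- The point of the plane with given polar coordinates. -/
noncomputable def polarPoint (r θ : ℝ) : Plane :=
  planeEquiv ((r : ℂ) * (Real.cos θ + Real.sin θ * Complex.I))

theorem continuous_polarPoint : Continuous fun p : ℝ × ℝ => polarPoint p.1 p.2 := by
  unfold polarPoint
  exact planeEquiv.continuous.comp (by fun_prop)

theorem measurable_comp_polarPoint {β : Type*} [MeasurableSpace β] {f : Plane → β}
    (hf : Measurable f) : Measurable fun p : ℝ × ℝ => f (polarPoint p.1 p.2) :=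
  hf.comp continuous_polarPoint.measurable

theorem continuous_polarPoint_right (r : ℝ) : Continuous fun θ : ℝ => polarPoint r θ := by
  unfold polarPoint
  exact planeEquiv.continuous.comp (by fun_prop)

theorem measurable_comp_polarPoint_right {β : Type*} [MeasurableSpace β] {f : Plane → β}
    (hf : Measurable f) (r : ℝ) : Measurable fun θ : ℝ => f (polarPoint r θ) :=
  hf.comp (continuous_polarPoint_right r).measurable

theorem norm_polarPoint (r θ : ℝ) : ‖polarPoint r θ‖ = |r| := by
  rw [polarPoint, LinearIsometryEquiv.norm_map, norm_mul, Complex.norm_real, Complex.ofReal_cos,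
    Complex.ofReal_sin, ← Complex.exp_mul_I, Complex.norm_exp_ofReal_mul_I, mul_one,
    Real.norm_eq_abs]

theorem inner_polarPoint (r s θ α : ℝ) :
    ⟪polarPoint r θ, polarPoint s α⟫_ℝ = r * s * Real.cos (θ - α) := by
  rw [polarPoint, polarPoint, LinearIsometryEquiv.inner_map_map, Complex.inner, Real.cos_sub]
  simp [Complex.cos_ofReal_re, Complex.sin_ofReal_re]
  ring

theorem exists_eq_polarPoint (x : Plane) : ∃ θ : ℝ, x = polarPoint ‖x‖ θ := by
  refine ⟨Complex.arg (planeEquiv.symm x), ?_⟩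
  rw [polarPoint, ← planeEquiv.symm.norm_map x, Complex.ofReal_cos, Complex.ofReal_sin,
    Complex.norm_mul_cos_add_sin_mul_I, LinearIsometryEquiv.apply_symm_apply]

/-- The domain of the polar coordinates. -/
abbrev polarDomain : Set (ℝ × ℝ) := Ioi 0 ×ˢ Ioo (-Real.pi) Real.pi

theorem restrict_polarDomain : (volume : Measure (ℝ × ℝ)).restrict polarDomain =
    (volume.restrict (Ioi (0 : ℝ))).prod (volume.restrict (Ioo (-Real.pi) Real.pi)) := by
  rw [Measure.prod_restrict, ← Measure.volume_eq_prod]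

theorem integral_polar (f : Plane → ℂ) :
    ∫ x, f x = ∫ p in polarDomain, (p.1 : ℂ) * f (polarPoint p.1 p.2) := by
  rw [← planeEquiv.measurePreserving.integral_comp
    planeEquiv.toHomeomorph.measurableEmbedding, ← Complex.integral_comp_polarCoord_symm]
  refine integral_congr_ae (Eventually.of_forall fun p => ?_)
  simp only [Complex.polarCoord_symm_apply, Complex.real_smul]
  rfl

theorem lintegral_polar (f : Plane → ℝ≥0∞) (hf : Measurable f) :
    ∫⁻ x, f x = ∫⁻ r in Ioi (0 : ℝ), ENNReal.ofReal r *
      ∫⁻ θ in Ioo (-Real.pi) Real.pi, f (polarPoint r θ) := by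
  have hm := measurable_comp_polarPoint hf
  rw [← planeEquiv.measurePreserving.lintegral_comp_emb
    planeEquiv.toHomeomorph.measurableEmbedding, ← Complex.lintegral_comp_polarCoord_symm]
  have e : ∫⁻ p in polarCoord.target, ENNReal.ofReal p.1 •
      f (planeEquiv (Complex.polarCoord.symm p)) =
      ∫⁻ p in polarDomain, ENNReal.ofReal p.1 * f (polarPoint p.1 p.2) := by
    refine lintegral_congr fun p => ?_
    simp only [Complex.polarCoord_symm_apply, smul_eq_mul]
    rfl
  rw [e, restrict_polarDomain, lintegral_prod
    (fun p : ℝ × ℝ => ENNReal.ofReal p.1 * f (polarPoint p.1 p.2))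
    (measurable_fst.ennreal_ofReal.mul hm).aemeasurable]
  refine lintegral_congr fun r => ?_
  simp only
  exact lintegral_const_mul _ (measurable_comp_polarPoint_right hf r)

theorem lintegral_radial (g : ℝ → ℝ≥0∞) (hg : Measurable g) :
    ∫⁻ x : Plane, g ‖x‖ =
      ENNReal.ofReal (2 * Real.pi) * ∫⁻ r in Ioi (0 : ℝ), ENNReal.ofReal r * g r := by
  rw [lintegral_polar (fun x => g ‖x‖) (hg.comp measurable_norm),
    ← lintegral_const_mul' _ _ ENNReal.ofReal_ne_top]
  refine setLIntegral_congr_fun measurableSet_Ioi fun r hr => ?_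
  simp only [norm_polarPoint]
  rw [abs_of_pos hr, lintegral_const, Measure.restrict_apply_univ, Real.volume_Ioo,
    show Real.pi - -Real.pi = 2 * Real.pi by ring]
  ring

theorem integrableOn_polar {f : Plane → ℂ} (hm : Measurable f) (hf : Integrable f) :
    IntegrableOn (fun p : ℝ × ℝ => (p.1 : ℂ) * f (polarPoint p.1 p.2)) polarDomain := by
  have hmp := measurable_comp_polarPoint hm
  have hmm : Measurable fun p : ℝ × ℝ => (p.1 : ℂ) * f (polarPoint p.1 p.2) :=
    (Complex.measurable_ofReal.comp measurable_fst).mul hmp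
  refine ⟨hmm.aestronglyMeasurable, ?_⟩
  have h := hf.2
  rw [HasFiniteIntegral, lintegral_polar (fun x => ‖f x‖ₑ) hm.enorm] at h
  rw [HasFiniteIntegral, restrict_polarDomain, lintegral_prod _
    hmm.enorm.aemeasurable]
  refine lt_of_le_of_lt (setLIntegral_mono' measurableSet_Ioi fun r hr => ?_) h
  rw [← lintegral_const_mul _ (measurable_comp_polarPoint_right hm.enorm r)]
  refine lintegral_mono fun θ => ?_
  rw [enorm_mul, ← ofReal_norm, Complex.norm_real, Real.norm_of_nonneg (le_of_lt hr)]

theorem integral_polar_iterated {f : Plane → ℂ} (hm : Measurable f) (hf : Integrable f) :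
    ∫ x, f x = ∫ r in Ioi (0 : ℝ), (r : ℂ) *
      ∫ θ in Ioo (-Real.pi) Real.pi, f (polarPoint r θ) := by
  have h := integrableOn_polar hm hf
  rw [IntegrableOn, restrict_polarDomain] at h
  rw [integral_polar, restrict_polarDomain, integral_prod _ h]
  refine integral_congr_ae (Eventually.of_forall fun r => ?_)
  exact integral_const_mul (r : ℂ) fun θ => f (polarPoint r θ)

/-! ### The Hankel transform in the plane -/

/-- The condition on `F` for the absolute convergence of its Hankel transform. -/
structure IsHankelAdmissible (F : Plane → ℂ) : Prop where
  measurable : Measurable F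
  integrable : Integrable fun ξ : Plane => ((‖ξ‖ ^ (-(1 / 2) : ℝ) : ℝ) : ℂ) * F ξ
  memLp : MemLp F 2

/-- The circular integrals of `F`. -/
noncomputable def angularIntegral (F : Plane → ℂ) (r : ℝ) : ℂ :=
  ∫ θ in Ioo (-Real.pi) Real.pi, F (polarPoint r θ)

theorem measurable_angularIntegral {F : Plane → ℂ} (hF : Measurable F) :
    Measurable (angularIntegral F) := by
  have hmp := measurable_comp_polarPoint hF
  exact (StronglyMeasurable.integral_prod_right (ν := volume.restrict (Ioo (-Real.pi) Real.pi))
    (f := fun r θ : ℝ => F (polarPoint r θ)) hmp.stronglyMeasurable).measurable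

theorem enorm_angularIntegral_sq_le {F : Plane → ℂ} (hF : Measurable F) (r : ℝ) :
    ‖angularIntegral F r‖ₑ ^ 2 ≤
      ENNReal.ofReal (2 * Real.pi) * ∫⁻ θ in Ioo (-Real.pi) Real.pi, ‖F (polarPoint r θ)‖ₑ ^ 2 := by
  have hm := measurable_comp_polarPoint_right hF r
  have h1 := ENNReal.lintegral_mul_norm_pow_le (μ := volume.restrict (Ioo (-Real.pi) Real.pi))
    (f := fun _ => 1) (g := fun θ => ‖F (polarPoint r θ)‖ₑ ^ 2) 
    aemeasurable_const (hm.enorm.pow_const 2).aemeasurable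
    (p := 1 / 2) (q := 1 / 2) (by norm_num) (by norm_num) (by norm_num)
  have h2 : ∀ θ : ℝ, (1 : ℝ≥0∞) ^ (1 / 2 : ℝ) * (‖F (polarPoint r θ)‖ₑ ^ 2) ^ (1 / 2 : ℝ) =
      ‖F (polarPoint r θ)‖ₑ := fun θ => by
    rw [ENNReal.one_rpow, one_mul, ← ENNReal.rpow_natCast, ← ENNReal.rpow_mul]
    norm_num
  simp only [h2] at h1
  rw [lintegral_const, Measure.restrict_apply_univ, Real.volume_Ioo,
    show Real.pi - -Real.pi = 2 * Real.pi by ring, one_mul] at h1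
  have h3 := pow_le_pow_left' ((enorm_integral_le_lintegral_enorm _).trans h1) 2
  refine h3.trans (le_of_eq ?_)
  rw [mul_pow, ← ENNReal.rpow_natCast, ← ENNReal.rpow_natCast, ← ENNReal.rpow_mul,
    ← ENNReal.rpow_mul]
  norm_num

theorem IsHankelAdmissible.integrable_mul {F : Plane → ℂ} (hF : IsHankelAdmissible F) {H : ℝ → ℂ}
    (hHm : Measurable H) {C : ℝ} (hC : ∀ s, 0 < s → ‖H s‖ ≤ C * s ^ (-(1 / 2) : ℝ)) {r : ℝ}
    (hr : 0 < r) : Integrable fun ξ : Plane => H (‖ξ‖ * r) * F ξ := by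
  have hmF := hF.measurable
  refine (hF.integrable.norm.const_mul (C * r ^ (-(1 / 2) : ℝ))).mono'
    (Measurable.aestronglyMeasurable (by fun_prop)) ?_
  have h0 : ∀ᵐ ξ : Plane, ξ ≠ 0 := by
    rw [ae_iff]
    simp
  filter_upwards [h0] with ξ hξ
  have hξ' : 0 < ‖ξ‖ := norm_pos_iff.2 hξ
  rw [norm_mul, norm_mul, Complex.norm_real, Real.norm_of_nonneg (by positivity)]
  calc _ ≤ C * (‖ξ‖ * r) ^ (-(1 / 2) : ℝ) * ‖F ξ‖ := by
        gcongr
        exact hC _ (by positivity)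
    _ = _ := by
      rw [Real.mul_rpow hξ'.le hr.le]
      ring

/-- Polar coordinates, with the Jacobian written as ρ = r^{-1/2}(rρ)^{1/2}ρ^{1/2} so that the
half-line transform with its natural L² normalisation appears. -/
theorem IsHankelAdmissible.integral_eq {F : Plane → ℂ} (hF : IsHankelAdmissible F) {r : ℝ}
    (hr : 0 < r) : ∫ ξ : Plane, hankel1 (‖ξ‖ * r) * F ξ =
      ((r ^ (-(1 / 2) : ℝ) : ℝ) : ℂ) * ∫ ρ in Ioi (0 : ℝ),
        (((r * ρ) ^ (1 / 2 : ℝ) : ℝ) : ℂ) * hankel1 (r * ρ) *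
          (((ρ ^ (1 / 2 : ℝ) : ℝ) : ℂ) * angularIntegral F ρ) := by
  obtain ⟨C, -, hC⟩ := exists_norm_hankel1_le
  have hmF := hF.measurable
  have hmH := measurable_hankel1
  rw [integral_polar_iterated (by fun_prop) (hF.integrable_mul measurable_hankel1 hC hr),
    ← integral_const_mul]
  refine setIntegral_congr_fun measurableSet_Ioi fun ρ hρ => ?_
  have hρ' : (0 : ℝ) < ρ := hρ
  simp only [norm_polarPoint, abs_of_pos hρ']
  rw [integral_const_mul, angularIntegral, mul_comm ρ r]
  have e : ((r ^ (-(1 / 2) : ℝ) : ℝ) : ℂ) * (((r * ρ) ^ (1 / 2 : ℝ) : ℝ) : ℂ) *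
      ((ρ ^ (1 / 2 : ℝ) : ℝ) : ℂ) = ρ := by
    rw [← Complex.ofReal_mul, ← Complex.ofReal_mul]
    congr 1
    rw [Real.mul_rpow hr.le hρ'.le, ← mul_assoc, ← Real.rpow_add hr, mul_assoc, ← Real.rpow_add hρ']
    norm_num
  rw [← e]
  ring

/-- Reduction to the half-line function ρ^{1/2}∫F dθ. Its L² norm is controlled by that of F through
Cauchy–Schwarz on circles, and on the output side r^{-1/2} cancels the area element r dr. -/
theorem exists_eLpNorm_hankel1_le : ∃ C : ℝ≥0∞, C ≠ ⊤ ∧ ∀ F : Plane → ℂ, IsHankelAdmissible F →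
    eLpNorm (fun x : Plane => ∫ ξ : Plane, hankel1 (‖ξ‖ * ‖x‖) * F ξ) 2 volume ≤
      C * eLpNorm F 2 volume := by
  obtain ⟨C, hC, hbd⟩ := exists_eLpNorm_hankelTransform_le
  refine ⟨ENNReal.ofReal (2 * Real.pi) * C, ENNReal.mul_ne_top ENNReal.ofReal_ne_top hC,
    fun F hF => ?_⟩
  have hmF := hF.measurable
  have hmH := measurable_hankel1
  have hmc := measurable_angularIntegral hmF
  let h : ℝ → ℂ := fun ρ => ((ρ ^ (1 / 2 : ℝ) : ℝ) : ℂ) * angularIntegral F ρ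
  have hmh : Measurable h := by
    simp only [h]
    fun_prop
  have hF2 : ∫⁻ ρ in Ioi (0 : ℝ), ‖h ρ‖ₑ ^ 2 ≤ ENNReal.ofReal (2 * Real.pi) * ∫⁻ ξ, ‖F ξ‖ₑ ^ 2 := by
    rw [lintegral_polar (fun ξ => ‖F ξ‖ₑ ^ 2) (hmF.enorm.pow_const 2),
      ← lintegral_const_mul' _ _ ENNReal.ofReal_ne_top]
    refine setLIntegral_mono' measurableSet_Ioi fun ρ hρ => ?_
    have hρ' : (0 : ℝ) < ρ := hρ
    have e : ‖((ρ ^ (1 / 2 : ℝ) : ℝ) : ℂ)‖ₑ ^ 2 = ENNReal.ofReal ρ := by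
      rw [← ofReal_norm, Complex.norm_real, Real.norm_of_nonneg (by positivity),
        ← ENNReal.ofReal_pow (by positivity), ← Real.rpow_natCast, ← Real.rpow_mul hρ'.le]
      norm_num
    simp only [h]
    rw [enorm_mul, mul_pow, e, mul_left_comm]
    gcongr
    exact enorm_angularIntegral_sq_le hmF ρ
  have hF2' : ∫⁻ ξ, ‖F ξ‖ₑ ^ 2 ≠ ⊤ := by
    rw [← eLpNorm_two_sq]
    exact ENNReal.pow_ne_top hF.memLp.2.ne
  have hh2 : MemLp h 2 (volume.restrict (Ioi 0)) := by
    refine ⟨hmh.aestronglyMeasurable, ?_⟩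
    have : eLpNorm h 2 (volume.restrict (Ioi 0)) ^ 2 < ⊤ := by
      rw [eLpNorm_two_sq]
      exact hF2.trans_lt (ENNReal.mul_lt_top ENNReal.ofReal_lt_top hF2'.lt_top)
    exact (ENNReal.pow_lt_top_iff.1 this).resolve_right two_ne_zero
  have hh1 : IntegrableOn h (Ioi 0) := by
    refine ⟨hmh.aestronglyMeasurable, ?_⟩
    have hfin := hF.integrable.2
    rw [HasFiniteIntegral, lintegral_polar
      (fun ξ => ‖((‖ξ‖ ^ (-(1 / 2) : ℝ) : ℝ) : ℂ) * F ξ‖ₑ) (by fun_prop)] at hfin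
    refine lt_of_le_of_lt (setLIntegral_mono' measurableSet_Ioi fun ρ hρ => ?_) hfin
    have hρ' : (0 : ℝ) < ρ := hρ
    have hm := measurable_comp_polarPoint_right hmF ρ
    simp only [h, norm_polarPoint, abs_of_pos hρ', enorm_mul]
    rw [lintegral_const_mul _ hm.enorm, ← mul_assoc]
    refine mul_le_mul' (le_of_eq ?_) (enorm_integral_le_lintegral_enorm _)
    rw [← ofReal_norm, Complex.norm_real, Real.norm_of_nonneg (by positivity), ← ofReal_norm,
      Complex.norm_real, Real.norm_of_nonneg (by positivity), ← ENNReal.ofReal_mul hρ'.le]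
    congr 1
    rw [← Real.rpow_one_add' hρ'.le (by norm_num)]
    norm_num
  have hV := hbd h hmh hh1 hh2
  have hV2 := pow_le_pow_left' hV 2
  rw [mul_pow, eLpNorm_two_sq, eLpNorm_two_sq] at hV2
  refine eLpNorm_two_le_of_sq_le ?_
  let V : ℝ → ℂ := fun r => ∫ ρ in Ioi (0 : ℝ),
      (((r * ρ) ^ (1 / 2 : ℝ) : ℝ) : ℂ) * hankel1 (r * ρ) * h ρ
  have hmG : Measurable fun r : ℝ => ∫ ξ : Plane, hankel1 (‖ξ‖ * r) * F ξ := by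
    refine (StronglyMeasurable.integral_prod_right (ν := (volume : Measure Plane))
      (f := fun (r : ℝ) (ξ : Plane) => hankel1 (‖ξ‖ * r) * F ξ)
      (Measurable.stronglyMeasurable ?_)).measurable
    simp only [Function.uncurry_def]
    fun_prop
  calc ∫⁻ x : Plane, ‖∫ ξ : Plane, hankel1 (‖ξ‖ * ‖x‖) * F ξ‖ₑ ^ 2
      = ENNReal.ofReal (2 * Real.pi) * ∫⁻ r in Ioi (0 : ℝ), ENNReal.ofReal r *
          ‖∫ ξ : Plane, hankel1 (‖ξ‖ * r) * F ξ‖ₑ ^ 2 :=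
        lintegral_radial (fun r => ‖∫ ξ : Plane, hankel1 (‖ξ‖ * r) * F ξ‖ₑ ^ 2) (by fun_prop)
    _ = ENNReal.ofReal (2 * Real.pi) * ∫⁻ r in Ioi (0 : ℝ), ‖V r‖ₑ ^ 2 := by
        congr 1
        refine setLIntegral_congr_fun measurableSet_Ioi fun r hr => ?_
        have hr' : (0 : ℝ) < r := hr
        rw [hF.integral_eq hr', enorm_mul, mul_pow, ← mul_assoc]
        have e : ENNReal.ofReal r * ‖((r ^ (-(1 / 2) : ℝ) : ℝ) : ℂ)‖ₑ ^ 2 = 1 := by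
          rw [← ofReal_norm, Complex.norm_real, Real.norm_of_nonneg (by positivity),
            ← ENNReal.ofReal_pow (by positivity), ← Real.rpow_natCast, ← Real.rpow_mul hr'.le,
            ← ENNReal.ofReal_mul hr'.le,
            show (-(1 / 2) : ℝ) * ((2 : ℕ) : ℝ) = -1 by norm_num, Real.rpow_neg_one,
            mul_inv_cancel₀ hr'.ne', ENNReal.ofReal_one]
        rw [e, one_mul]
    _ ≤ ENNReal.ofReal (2 * Real.pi) * (C ^ 2 * ∫⁻ ρ in Ioi (0 : ℝ), ‖h ρ‖ₑ ^ 2) := by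
        gcongr
    _ ≤ ENNReal.ofReal (2 * Real.pi) *
          (C ^ 2 * (ENNReal.ofReal (2 * Real.pi) * ∫⁻ ξ, ‖F ξ‖ₑ ^ 2)) := by gcongr
    _ = _ := by ring

/-! ### The operators defined by Hankel functions -/

theorem fourierHat_eq (f : Plane → ℂ) (ξ : Plane) :
    fourierHat f ξ = (2 * Real.pi : ℂ)⁻¹ * 𝓕 f ((2 * Real.pi)⁻¹ • ξ) := by
  rw [fourierHat, Real.fourier_eq']
  congr 1
  refine integral_congr_ae (Eventually.of_forall fun x => ?_)
  simp only [smul_eq_mul, inner_smul_right]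
  congr 2
  have := Real.pi_ne_zero
  rw [mul_comm, mul_neg, ← neg_mul, ← Complex.ofReal_neg]
  congr 2
  field_simp

theorem two_pi_inv_ne_zero : (2 * Real.pi)⁻¹ ≠ 0 :=
  inv_ne_zero (mul_ne_zero two_ne_zero Real.pi_ne_zero)

/-- The Fourier transform `f ↦ f̂` on Schwartz functions. -/
noncomputable def fourierHatCLM : 𝓢(Plane, ℂ) →L[ℂ] 𝓢(Plane, ℂ) :=
  (2 * Real.pi : ℂ)⁻¹ • (SchwartzMap.compCLMOfContinuousLinearEquiv ℂ
    (ContinuousLinearEquiv.smulLeft (Units.mk0 _ two_pi_inv_ne_zero) : Plane ≃L[ℝ] Plane)) ∘L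
    FourierTransform.fourierCLM ℂ 𝓢(Plane, ℂ)

theorem fourierHatCLM_apply (f : 𝓢(Plane, ℂ)) (ξ : Plane) :
    fourierHatCLM f ξ = fourierHat f ξ := by
  rw [fourierHat_eq]
  rfl

theorem lintegral_comp_smul_plane (g : Plane → ℝ≥0∞) (hg : Measurable g) {c : ℝ} (hc : 0 < c) :
    ∫⁻ x, g (c • x) = ENNReal.ofReal (c ^ 2)⁻¹ * ∫⁻ x, g x := by
  have h := lintegral_map (μ := (volume : Measure Plane)) hg (measurable_const_smul c)
  rw [Measure.map_addHaar_smul _ hc.ne', lintegral_smul_measure, smul_eq_mul] at h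
  rw [← h, finrank_euclideanSpace_fin, abs_of_pos (by positivity)]

theorem eLpNorm_schwartz_ne_top (f : 𝓢(Plane, ℂ)) : eLpNorm f 2 volume ≠ ⊤ :=
  MemLp.eLpNorm_ne_top (f.memLp 2 volume)

/-- Plancherel: the prefactor (2π)⁻¹, squared, exactly offsets the Jacobian of the dilation in
dimension two. -/
theorem eLpNorm_fourierHat (f : 𝓢(Plane, ℂ)) :
    eLpNorm (fourierHat f) 2 volume = eLpNorm f 2 volume := by
  have hpi := Real.pi_pos
  have hm : Measurable fun ξ : Plane => ‖(𝓕 f) ξ‖ₑ ^ 2 := by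
    have := (𝓕 f).continuous.measurable
    fun_prop
  have h1 : eLpNorm (fourierHat f) 2 volume ^ 2 = eLpNorm (𝓕 f : 𝓢(Plane, ℂ)) 2 volume ^ 2 := by
    rw [eLpNorm_two_sq, eLpNorm_two_sq]
    have e : ∀ ξ, ‖fourierHat f ξ‖ₑ ^ 2 =
        ENNReal.ofReal ((2 * Real.pi)⁻¹ ^ 2) * ‖(𝓕 f) ((2 * Real.pi)⁻¹ • ξ)‖ₑ ^ 2 := by
      intro ξ
      rw [fourierHat_eq, enorm_mul, mul_pow, ENNReal.ofReal_pow (by positivity), ← ofReal_norm,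
        SchwartzMap.fourier_coe]
      congr 3
      rw [norm_inv, norm_mul, Complex.norm_real, Real.norm_of_nonneg hpi.le, Complex.norm_ofNat]
    simp only [e]
    rw [lintegral_const_mul' _ _ ENNReal.ofReal_ne_top,
      lintegral_comp_smul_plane _ hm (c := (2 * Real.pi)⁻¹) (by positivity), ← mul_assoc,
      ← ENNReal.ofReal_mul (by positivity), mul_inv_cancel₀ (by positivity), ENNReal.ofReal_one,
      one_mul]
  have h2 := (ENNReal.pow_right_strictMono two_ne_zero).injective h1
  rw [h2]
  have h3 := SchwartzMap.norm_fourier_toL2_eq f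
  rw [SchwartzMap.norm_toLp, SchwartzMap.norm_toLp, ENNReal.toReal_eq_toReal_iff'
    (eLpNorm_schwartz_ne_top _) (eLpNorm_schwartz_ne_top f)] at h3
  exact h3

/-- In polar coordinates the singularity |ξ|^{-1/2} is absorbed by the area element, and cubic decay
of F leaves the integrable majorant (1 + r)^{-2}. -/
theorem isHankelAdmissible_schwartz (F : 𝓢(Plane, ℂ)) : IsHankelAdmissible F := by
  have hm := F.continuous.measurable
  refine ⟨hm, ?_, F.memLp 2⟩
  refine ⟨Measurable.aestronglyMeasurable (by fun_prop), ?_⟩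
  obtain ⟨C, hC⟩ : ∃ C : ℝ, ∀ ξ, (1 + ‖ξ‖) ^ 3 * ‖F ξ‖ ≤ C := by
    refine ⟨2 ^ 3 * ((Finset.Iic (3, 0)).sup fun m => SchwartzMap.seminorm ℝ m.1 m.2) F,
      fun ξ => ?_⟩
    have := SchwartzMap.one_add_le_sup_seminorm_apply (𝕜 := ℝ) (m := (3, 0)) (k := 3) (n := 0)
      le_rfl le_rfl F ξ
    rwa [norm_iteratedFDeriv_zero] at this
  have hC0 : 0 ≤ C := (mul_nonneg (by positivity) (norm_nonneg _)).trans (hC 0)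
  have hbd : ∀ ξ : Plane, ‖((‖ξ‖ ^ (-(1 / 2) : ℝ) : ℝ) : ℂ) * F ξ‖ₑ ≤
      ENNReal.ofReal (‖ξ‖ ^ (-(1 / 2) : ℝ) * (C * ((1 + ‖ξ‖) ^ 3)⁻¹)) := by
    intro ξ
    rw [← ofReal_norm, norm_mul, Complex.norm_real, Real.norm_of_nonneg (by positivity)]
    refine ENNReal.ofReal_le_ofReal (mul_le_mul_of_nonneg_left ?_ (by positivity))
    rw [← div_eq_mul_inv, le_div_iff₀ (by positivity), mul_comm]
    exact hC ξ
  refine lt_of_le_of_lt (lintegral_mono hbd) ?_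
  rw [lintegral_radial (fun r => ENNReal.ofReal (r ^ (-(1 / 2) : ℝ) * (C * ((1 + r) ^ 3)⁻¹)))
    (by fun_prop)]
  refine ENNReal.mul_lt_top ENNReal.ofReal_lt_top ?_
  have hi : Integrable fun r : ℝ => C * (1 + ‖r‖) ^ (-2 : ℝ) :=
    (integrable_one_add_norm (by norm_num)).const_mul C
  refine lt_of_le_of_lt ?_ (hi.integrableOn (s := Ioi 0)).2
  refine setLIntegral_mono' measurableSet_Ioi fun r hr => ?_
  have hr' : (0 : ℝ) < r := hr
  rw [← ENNReal.ofReal_mul hr'.le, ← ofReal_norm]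
  refine ENNReal.ofReal_le_ofReal (le_trans ?_ (le_abs_self _))
  simp only [Real.norm_of_nonneg hr'.le]
  have h1 : r * r ^ (-(1 / 2) : ℝ) ≤ 1 + r := by
    rw [← Real.rpow_one_add' hr'.le (by norm_num)]
    calc r ^ (1 + -(1 / 2) : ℝ) ≤ (1 + r) ^ (1 + -(1 / 2) : ℝ) :=
          Real.rpow_le_rpow hr'.le (by linarith) (by norm_num)
      _ ≤ (1 + r) ^ (1 : ℝ) := Real.rpow_le_rpow_of_exponent_le (by linarith) (by norm_num)
      _ = 1 + r := Real.rpow_one _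
  have h2 : (1 + r) ^ (-2 : ℝ) = (1 + r) * ((1 + r) ^ 3)⁻¹ := by
    rw [Real.rpow_neg (by positivity), Real.rpow_two]
    field_simp
  rw [h2]
  calc _ = C * ((r * r ^ (-(1 / 2) : ℝ)) * ((1 + r) ^ 3)⁻¹) := by ring
    _ ≤ _ := by gcongr

theorem isHankelAdmissible_fourierHat (f : 𝓢(Plane, ℂ)) : IsHankelAdmissible (fourierHat f) := by
  have := isHankelAdmissible_schwartz (fourierHatCLM f)
  rwa [show (fourierHatCLM f : Plane → ℂ) = fourierHat f from
    funext fun ξ => fourierHatCLM_apply f ξ] at this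

theorem IsHankelAdmissible.conj {F : Plane → ℂ} (hF : IsHankelAdmissible F) :
    IsHankelAdmissible fun ξ => starRingEnd ℂ (F ξ) := by
  refine ⟨Complex.continuous_conj.measurable.comp hF.measurable, ?_, ?_⟩
  · refine hF.integrable.congr' ?_ (Eventually.of_forall fun ξ => by simp)
    have := Complex.continuous_conj.measurable.comp hF.measurable
    have h2 : Measurable fun ξ : Plane => ((‖ξ‖ ^ (-(1 / 2) : ℝ) : ℝ) : ℂ) := by fun_prop
    exact (h2.mul this).aestronglyMeasurable
  · exact hF.memLp.star

theorem exists_eLpNorm_hankel2_le : ∃ C : ℝ≥0∞, C ≠ ⊤ ∧ ∀ F : Plane → ℂ, IsHankelAdmissible F →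
    eLpNorm (fun x : Plane => ∫ ξ : Plane, hankel2 (‖ξ‖ * ‖x‖) * F ξ) 2 volume ≤
      C * eLpNorm F 2 volume := by
  obtain ⟨C, hC, h⟩ := exists_eLpNorm_hankel1_le
  refine ⟨C, hC, fun F hF => ?_⟩
  have h1 := h _ hF.conj
  have e1 : eLpNorm (fun ξ => starRingEnd ℂ (F ξ)) 2 volume = eLpNorm F 2 volume :=
    eLpNorm_congr_norm_ae (Eventually.of_forall fun ξ => by simp)
  rw [e1] at h1
  refine le_trans (le_of_eq (eLpNorm_congr_norm_ae (Eventually.of_forall fun x => ?_))) h1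
  rw [← RCLike.norm_conj, ← integral_conj]
  congr 2
  ext ξ
  rw [map_mul, hankel2, Complex.conj_conj]

theorem measurable_hankel2 : Measurable hankel2 :=
  Complex.continuous_conj.measurable.comp measurable_hankel1

theorem ae_ne_zero_plane : ∀ᵐ x : Plane, x ≠ 0 := by
  rw [ae_iff]
  simp

theorem schwartz_denseRange : DenseRange (SchwartzMap.toLpCLM ℂ ℂ 2 (volume : Measure Plane)) :=
  SchwartzMap.denseRange_toLpCLM (F := ℂ) (μ := (volume : Measure Plane)) (p := 2) (by norm_num)

theorem measurable_hankelIntegral {H : ℝ → ℂ} (hm : Measurable H) {F : Plane → ℂ}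
    (hF : Measurable F) : Measurable fun x : Plane => ∫ ξ : Plane, H (‖ξ‖ * ‖x‖) * F ξ := by
  refine (StronglyMeasurable.integral_prod_right (ν := (volume : Measure Plane))
    (f := fun (x : Plane) (ξ : Plane) => H (‖ξ‖ * ‖x‖) * F ξ)
    (Measurable.stronglyMeasurable ?_)).measurable
  simp only [Function.uncurry_def]
  fun_prop

/-- The operator `F ↦ ½ (2π)⁻¹ ∫ H(|ξ||x|) F(ξ) dξ`. -/
noncomputable def hankelOp (H : ℝ → ℂ) (F : Plane → ℂ) (x : Plane) : ℂ :=
  (1 / 2 : ℂ) * (2 * Real.pi : ℂ)⁻¹ * ∫ ξ : Plane, H (‖ξ‖ * ‖x‖) * F ξ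

theorem measurable_hankelOp {H : ℝ → ℂ} (hm : Measurable H) {F : Plane → ℂ} (hF : Measurable F) :
    Measurable (hankelOp H F) := by
  have := measurable_hankelIntegral hm hF
  unfold hankelOp
  exact this.const_mul _

theorem eLpNorm_hankelOp_le {H : ℝ → ℂ} {F : Plane → ℂ} {C : ℝ≥0∞}
    (h : eLpNorm (fun x : Plane => ∫ ξ : Plane, H (‖ξ‖ * ‖x‖) * F ξ) 2 volume ≤ C) :
    eLpNorm (hankelOp H F) 2 volume ≤ C := by
  refine (eLpNorm_mono fun x => ?_).trans h
  rw [hankelOp, norm_mul]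
  refine mul_le_of_le_one_left (norm_nonneg _) ?_
  have := Real.pi_gt_three
  rw [norm_mul, norm_inv, norm_mul, Complex.norm_real, Real.norm_of_nonneg (by positivity),
    Complex.norm_ofNat, norm_div, norm_one, Complex.norm_ofNat]
  rw [← div_eq_mul_inv, div_le_one (by positivity)]
  linarith

theorem hankelOp_add {H : ℝ → ℂ} {F G : Plane → ℂ} {x : Plane}
    (hF : Integrable fun ξ : Plane => H (‖ξ‖ * ‖x‖) * F ξ)
    (hG : Integrable fun ξ : Plane => H (‖ξ‖ * ‖x‖) * G ξ) :
    hankelOp H (fun ξ => F ξ + G ξ) x = hankelOp H F x + hankelOp H G x := by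
  simp only [hankelOp, mul_add]
  rw [integral_add hF hG, mul_add]

theorem hankelOp_const_mul (H : ℝ → ℂ) (c : ℂ) (F : Plane → ℂ) (x : Plane) :
    hankelOp H (fun ξ => c * F ξ) x = c * hankelOp H F x := by
  simp only [hankelOp, mul_left_comm _ c]
  rw [integral_const_mul, mul_left_comm]

theorem fourierHat_add (f g : 𝓢(Plane, ℂ)) :
    fourierHat (f + g : 𝓢(Plane, ℂ)) = fun ξ => fourierHat f ξ + fourierHat g ξ := by
  ext ξ
  simp only [← fourierHatCLM_apply, map_add, add_apply]

theorem fourierHat_smul (c : ℂ) (f : 𝓢(Plane, ℂ)) :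
    fourierHat (c • f : 𝓢(Plane, ℂ)) = fun ξ => c * fourierHat f ξ := by
  ext ξ
  simp only [← fourierHatCLM_apply, map_smul, smul_apply, smul_eq_mul]

/-- The size bound on H gives absolute convergence at every x ≠ 0; the L² bound and Plancherel allow
extension by density from Schwartz functions. -/
theorem exists_isHankelProjection {H : ℝ → ℂ} (hm : Measurable H) {B : ℝ}
    (hB : ∀ s, 0 < s → ‖H s‖ ≤ B * s ^ (-(1 / 2) : ℝ)) {C : ℝ≥0∞} (hC : C ≠ ⊤)
    (hbd : ∀ F : Plane → ℂ, IsHankelAdmissible F →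
      eLpNorm (fun x : Plane => ∫ ξ : Plane, H (‖ξ‖ * ‖x‖) * F ξ) 2 volume ≤
        C * eLpNorm F 2 volume) :
    ∃ P : L2 →L[ℂ] L2, IsHankelProjection H P := by
  have hadm := isHankelAdmissible_fourierHat
  have hle : ∀ f : 𝓢(Plane, ℂ), eLpNorm (hankelOp H (fourierHat f)) 2 volume ≤
      C * eLpNorm f 2 volume := fun f => by
    rw [← eLpNorm_fourierHat f]
    exact eLpNorm_hankelOp_le (hbd _ (hadm f))
  have hmem : ∀ f : 𝓢(Plane, ℂ), MemLp (hankelOp H (fourierHat f)) 2 := fun f =>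
    ⟨(measurable_hankelOp hm (hadm f).measurable).aestronglyMeasurable,
      (hle f).trans_lt (ENNReal.mul_lt_top hC.lt_top (eLpNorm_schwartz_ne_top f).lt_top)⟩
  have hint : ∀ (f : 𝓢(Plane, ℂ)) (x : Plane), x ≠ 0 →
      Integrable fun ξ : Plane => H (‖ξ‖ * ‖x‖) * fourierHat f ξ := fun f x hx =>
    (hadm f).integrable_mul hm hB (norm_pos_iff.2 hx)
  let T : 𝓢(Plane, ℂ) →ₗ[ℂ] L2 :=
    { toFun := fun f => (hmem f).toLp _
      map_add' := fun f g => by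
        rw [← MemLp.toLp_add, MemLp.toLp_eq_toLp_iff]
        filter_upwards [ae_ne_zero_plane] with x hx
        rw [Pi.add_apply, ← hankelOp_add (hint f x hx) (hint g x hx), fourierHat_add]
      map_smul' := fun c f => by
        rw [RingHom.id_apply, ← MemLp.toLp_const_smul, MemLp.toLp_eq_toLp_iff]
        refine Eventually.of_forall fun x => ?_
        rw [Pi.smul_apply, smul_eq_mul, ← hankelOp_const_mul, fourierHat_smul] }
  have hT : ∃ D, ∀ f, ‖T f‖ ≤
      D * ‖(SchwartzMap.toLpCLM ℂ ℂ 2 (volume : Measure Plane)).toLinearMap f‖ := by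
    refine ⟨C.toReal, fun f => ?_⟩
    change ‖(hmem f).toLp _‖ ≤ C.toReal * ‖f.toLp 2 volume‖
    rw [Lp.norm_toLp, SchwartzMap.norm_toLp, ← ENNReal.toReal_mul]
    exact ENNReal.toReal_mono (ENNReal.mul_ne_top hC (eLpNorm_schwartz_ne_top f)) (hle f)
  refine ⟨T.extendOfNorm (SchwartzMap.toLpCLM ℂ ℂ 2 (volume : Measure Plane)).toLinearMap,
    fun f => ?_⟩
  have he : T.extendOfNorm (SchwartzMap.toLpCLM ℂ ℂ 2 (volume : Measure Plane)).toLinearMap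
      (f.toLp 2 volume) = (hmem f).toLp _ :=
    LinearMap.extendOfNorm_eq (f := T) schwartz_denseRange hT f
  rw [he]
  filter_upwards [ae_ne_zero_plane, (hmem f).coeFn_toLp] with x hx hx'
  exact ⟨hint f x hx, hx'⟩

theorem exists_isHankelProjection_hankel1 : ∃ P : L2 →L[ℂ] L2, IsHankelProjection hankel1 P := by
  obtain ⟨B, -, hB⟩ := exists_norm_hankel1_le
  obtain ⟨C, hC, hbd⟩ := exists_eLpNorm_hankel1_le
  exact exists_isHankelProjection measurable_hankel1 hB hC hbd

theorem exists_isHankelProjection_hankel2 : ∃ P : L2 →L[ℂ] L2, IsHankelProjection hankel2 P := by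
  obtain ⟨B, -, hB⟩ := exists_norm_hankel1_le
  obtain ⟨C, hC, hbd⟩ := exists_eLpNorm_hankel2_le
  exact exists_isHankelProjection measurable_hankel2
    (fun s hs => (norm_hankel2 s).trans_le (hB s hs)) hC hbd

/-! ### The projection onto the radial functions -/

theorem hankel1_add_hankel2 (r : ℝ) : hankel1 r + hankel2 r = 2 * besselJ0 r := by
  rw [hankel2, hankel1, map_add, map_mul, Complex.conj_I, Complex.conj_ofReal,
    Complex.conj_eq_iff_im.2 (besselJ0_im r)]
  ring

theorem besselJ0_norm_mul (r : ℝ) (ξ : Plane) :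
    2 * Real.pi * besselJ0 (‖ξ‖ * r) = ∫ θ in Ioo (-Real.pi) Real.pi,
      Complex.exp (Complex.I * (⟪polarPoint r θ, ξ⟫_ℝ : ℝ)) := by
  obtain ⟨β, hβ⟩ := exists_eq_polarPoint ξ
  rw [← integral_exp_cos_add (‖ξ‖ * r) (-β), intervalIntegral.integral_of_le
    (by linarith [Real.pi_pos]), integral_Ioc_eq_integral_Ioo]
  refine integral_congr_ae (Eventually.of_forall fun θ => ?_)
  simp only
  rw [show ⟪polarPoint r θ, ξ⟫_ℝ = ⟪polarPoint r θ, polarPoint ‖ξ‖ β⟫_ℝ by rw [← hβ],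
    inner_polarPoint, mul_comm r, sub_eq_add_neg]

/-- Fourier inversion. -/
theorem integral_exp_mul_fourierHat (f : 𝓢(Plane, ℂ)) (z : Plane) :
    ∫ ξ : Plane, Complex.exp (Complex.I * (⟪z, ξ⟫_ℝ : ℝ)) * fourierHat f ξ =
      2 * Real.pi * f z := by
  have hpi := Real.pi_pos
  have h : (𝓕⁻ (𝓕 f : 𝓢(Plane, ℂ)) : 𝓢(Plane, ℂ)) z = f z := by
    rw [FourierTransform.fourierInv_fourier_eq]
  rw [SchwartzMap.fourierInv_coe, Real.fourierInv_eq'] at h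
  have hs := Measure.integral_comp_smul (volume : Measure Plane)
    (fun v : Plane => Complex.exp (((2 * Real.pi * ⟪v, z⟫_ℝ : ℝ) : ℂ) * Complex.I) • (𝓕 f) v)
    (2 * Real.pi)⁻¹
  rw [h, finrank_euclideanSpace_fin, abs_of_pos (by positivity)] at hs
  have e : ∀ ξ : Plane, Complex.exp (Complex.I * (⟪z, ξ⟫_ℝ : ℝ)) * fourierHat f ξ =
      (2 * Real.pi : ℂ)⁻¹ * (Complex.exp (((2 * Real.pi * ⟪(2 * Real.pi)⁻¹ • ξ, z⟫_ℝ : ℝ) : ℂ) *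
        Complex.I) • (𝓕 f) ((2 * Real.pi)⁻¹ • ξ)) := by
    intro ξ
    rw [fourierHat_eq, SchwartzMap.fourier_coe, inner_smul_left, real_inner_comm, smul_eq_mul,
      mul_comm Complex.I, mul_left_comm]
    congr 5
    simp only [conj_trivial]
    field_simp
  simp only [e]
  rw [integral_const_mul, hs, Complex.real_smul]
  push_cast
  have : (Real.pi : ℂ) ≠ 0 := Complex.ofReal_ne_zero.2 hpi.ne'
  field_simp

theorem integrable_fourierHat (f : 𝓢(Plane, ℂ)) : Integrable (fourierHat f) := by
  have := (fourierHatCLM f).integrable (μ := volume)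
  rwa [show (fourierHatCLM f : Plane → ℂ) = fourierHat f from
    funext fun ξ => fourierHatCLM_apply f ξ] at this

/-- Writing 2πJ₀ as a circular integral of plane waves, Fubini and Fourier inversion return the
circular integral of f. -/
theorem integral_besselJ0_mul_fourierHat (f : 𝓢(Plane, ℂ)) (r : ℝ) :
    ∫ ξ : Plane, besselJ0 (‖ξ‖ * r) * fourierHat f ξ = angularIntegral f r := by
  have hpi : (2 * Real.pi : ℂ) ≠ 0 :=
    mul_ne_zero two_ne_zero (Complex.ofReal_ne_zero.2 Real.pi_ne_zero)
  have hF := integrable_fourierHat f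
  have hcp := continuous_polarPoint_right r
  have hint : Integrable (Function.uncurry fun (ξ : Plane) (θ : ℝ) =>
      Complex.exp (Complex.I * (⟪polarPoint r θ, ξ⟫_ℝ : ℝ)) * fourierHat f ξ)
      (volume.prod (volume.restrict (Ioo (-Real.pi) Real.pi))) := by
    have h1 := hF.mul_prod (ν := volume.restrict (Ioo (-Real.pi) Real.pi))
      (integrable_const (1 : ℂ))
    refine h1.congr' ?_ (Eventually.of_forall fun p => ?_)
    · have hm := (isHankelAdmissible_fourierHat f).measurable
      refine Measurable.aestronglyMeasurable (Measurable.mul ?_ (hm.comp measurable_fst))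
      exact Continuous.measurable (by fun_prop)
    · simp only [Function.uncurry_def]
      rw [norm_mul, norm_mul, norm_one, mul_one, mul_comm Complex.I, Complex.norm_exp_ofReal_mul_I,
        one_mul]
  have e : (2 * Real.pi : ℂ) * ∫ ξ : Plane, besselJ0 (‖ξ‖ * r) * fourierHat f ξ =
      2 * Real.pi * angularIntegral f r := by
    rw [← integral_const_mul]
    simp only [← mul_assoc, besselJ0_norm_mul]
    simp only [← integral_mul_const]
    rw [integral_integral_swap hint]
    simp only [integral_exp_mul_fourierHat]
    rw [integral_const_mul]
    rfl
  exact mul_left_cancel₀ hpi e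

theorem add_projection_schwartz {Pp Pm : L2 →L[ℂ] L2} (hp : IsHankelProjection hankel1 Pp)
    (hm : IsHankelProjection hankel2 Pm) (f : 𝓢(Plane, ℂ)) :
    ∀ᵐ x : Plane, (Pp + Pm) (f.toLp 2) x = (2 * Real.pi : ℂ)⁻¹ * angularIntegral f ‖x‖ := by
  filter_upwards [hp f, hm f, Lp.coeFn_add (Pp (f.toLp 2)) (Pm (f.toLp 2))] with x h1 h2 h3
  rw [add_apply, h3, Pi.add_apply, h1.2, h2.2, ← mul_add,
    ← integral_add h1.1 h2.1, ← integral_besselJ0_mul_fourierHat]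
  simp only [← add_mul, hankel1_add_hankel2, mul_assoc]
  rw [integral_const_mul]
  ring

/-- Composition with the norm embeds the L² space of the image measure on ℝ isometrically, and its
range is exactly the radial subspace. -/
theorem isClosed_radialL2 : IsClosed (radialL2 : Set L2) := by
  have hmp : MeasurePreserving (fun x : Plane => ‖x‖) volume
      (Measure.map (fun x : Plane => ‖x‖) volume) := measurable_norm.measurePreserving _
  have e : (radialL2 : Set L2) = range (Lp.compMeasurePreserving (E := ℂ) (p := 2) _ hmp) := by
    ext f
    constructor
    · rintro ⟨g, hg, hf⟩
      have hmem : MemLp g 2 (Measure.map (fun x : Plane => ‖x‖) volume) := by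
        rw [memLp_map_measure_iff hg.aestronglyMeasurable measurable_norm.aemeasurable]
        exact (memLp_congr_ae hf).1 (Lp.memLp f)
      refine ⟨hmem.toLp g, ?_⟩
      refine Lp.ext ?_
      filter_upwards [Lp.coeFn_compMeasurePreserving (hmem.toLp g) hmp,
        hmp.quasiMeasurePreserving.ae_eq_comp hmem.coeFn_toLp, hf] with x h1 h2 h3
      rw [h1, h2, h3]
      rfl
    · rintro ⟨g, rfl⟩
      exact ⟨g, (Lp.stronglyMeasurable g).measurable, Lp.coeFn_compMeasurePreserving g hmp⟩
  rw [e]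
  exact (Lp.isometry_compMeasurePreserving hmp).isClosedEmbedding.isClosed_range

/-- In polar coordinates a radial u leaves the angular integral, so f may be replaced by its
circular means. -/
theorem inner_radial_eq {f : 𝓢(Plane, ℂ)} {u : L2} {w : L2} (hu : u ∈ radialL2)
    (hw : ∀ᵐ x : Plane, w x = (2 * Real.pi : ℂ)⁻¹ * angularIntegral f ‖x‖) :
    ⟪u, f.toLp 2 volume⟫_ℂ = ⟪u, w⟫_ℂ := by
  obtain ⟨g, hg, hug⟩ := hu
  have hmf := f.continuous.measurable
  have hma := measurable_angularIntegral hmf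
  have hgc : Measurable fun r => starRingEnd ℂ (g r) := Complex.continuous_conj.measurable.comp hg
  have h1 : (fun x => ⟪u x, f.toLp 2 volume x⟫_ℂ) =ᵐ[volume]
      fun x => starRingEnd ℂ (g ‖x‖) * f x := by
    filter_upwards [hug, f.coeFn_toLp 2 volume] with x h1 h2
    rw [h1, h2, RCLike.inner_apply, mul_comm]
  have h2 : (fun x => ⟪u x, w x⟫_ℂ) =ᵐ[volume]
      fun x => starRingEnd ℂ (g ‖x‖) * ((2 * Real.pi : ℂ)⁻¹ * angularIntegral f ‖x‖) := by
    filter_upwards [hug, hw] with x h1 h2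
    rw [h1, h2, RCLike.inner_apply, mul_comm]
  have i1 := (integrable_congr h1).1 (L2.integrable_inner u (f.toLp 2 volume))
  have i2 := (integrable_congr h2).1 (L2.integrable_inner u w)
  rw [L2.inner_def, L2.inner_def, integral_congr_ae h1, integral_congr_ae h2,
    integral_polar_iterated (by fun_prop) i1, integral_polar_iterated (by fun_prop) i2]
  refine setIntegral_congr_fun measurableSet_Ioi fun r hr => ?_
  simp only [norm_polarPoint, abs_of_pos (mem_Ioi.1 hr)]
  congr 1
  have hpi := Real.pi_pos
  have hpi' : (Real.pi : ℂ) ≠ 0 := Complex.ofReal_ne_zero.2 hpi.ne'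
  rw [integral_const_mul, setIntegral_const, Real.volume_real_Ioo_of_le (by linarith),
    Complex.real_smul]
  change _ * angularIntegral f r = _
  push_cast
  field_simp
  ring

theorem isOrthogonalProjection_radial {Pp Pm : L2 →L[ℂ] L2} (hp : IsHankelProjection hankel1 Pp)
    (hm : IsHankelProjection hankel2 Pm) (f : L2) :
    (Pp + Pm) f ∈ radialL2 ∧ f - (Pp + Pm) f ∈ radialL2ᗮ := by
  -- Both conditions are closed in f, so it suffices to verify them on Schwartz functions.
  have hcl : IsClosed {f : L2 | (Pp + Pm) f ∈ radialL2 ∧ f - (Pp + Pm) f ∈ radialL2ᗮ} :=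
    (isClosed_radialL2.preimage (Pp + Pm).continuous).inter
      ((Submodule.isClosed_orthogonal radialL2).preimage
        (continuous_id.sub (Pp + Pm).continuous))
  refine schwartz_denseRange.induction_on (p := fun f : L2 =>
    (Pp + Pm) f ∈ radialL2 ∧ f - (Pp + Pm) f ∈ radialL2ᗮ) f hcl fun f => ?_
  have h := add_projection_schwartz hp hm f
  refine ⟨⟨fun r => (2 * Real.pi : ℂ)⁻¹ * angularIntegral f r,
    (measurable_angularIntegral f.continuous.measurable).const_mul _, h⟩, ?_⟩
  rw [Submodule.mem_orthogonal]
  intro u hu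
  rw [inner_sub_right, sub_eq_zero]
  exact inner_radial_eq hu h

/-! ### Integral kernels of Hankel operators composed with multipliers -/

theorem fourier_fourierMultiplier (m : Plane → ℂ) (hc : Continuous m)
    (hb : ∃ C : ℝ, ∀ ξ, ‖m ξ‖ ≤ C) (f : L2) :
    ∀ᵐ ξ : Plane, (𝓕 (fourierMultiplier m hc hb f) : L2) ξ =
      m ((2 * Real.pi) • ξ) * (𝓕 f : L2) ξ := by
  have e : (𝓕 (fourierMultiplier m hc hb f) : L2) =
      (ContinuousLinearMap.mul ℂ ℂ).holder 2 ((memLp_dilate hc hb).toLp _) (𝓕 f : L2) :=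
    (Lp.fourierTransformₗᵢ Plane ℂ).apply_symm_apply _
  rw [e]
  filter_upwards [ContinuousLinearMap.coeFn_holder (r := 2) (ContinuousLinearMap.mul ℂ ℂ)
    ((memLp_dilate hc hb).toLp _) (𝓕 f : L2), (memLp_dilate hc hb).coeFn_toLp] with ξ h1 h2
  rw [h1, h2]
  rfl

/-- On Schwartz functions, the composition of two multipliers whose product is smooth with compact
support takes values in Schwartz functions. -/
theorem exists_schwartz_fourierMultiplier {m₁ m₂ : Plane → ℂ} (hc₁ : Continuous m₁)
    (hb₁ : ∃ C : ℝ, ∀ ξ, ‖m₁ ξ‖ ≤ C) (hc₂ : Continuous m₂) (hb₂ : ∃ C : ℝ, ∀ ξ, ‖m₂ ξ‖ ≤ C)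
    (hs : ContDiff ℝ ∞ fun ξ => m₁ ξ * m₂ ξ) (hcs : HasCompactSupport fun ξ => m₁ ξ * m₂ ξ)
    (f : 𝓢(Plane, ℂ)) :
    ∃ g : 𝓢(Plane, ℂ), fourierMultiplier m₁ hc₁ hb₁ (fourierMultiplier m₂ hc₂ hb₂ (f.toLp 2)) =
      g.toLp 2 ∧ ∀ ξ, fourierHat g ξ = m₁ ξ * m₂ ξ * fourierHat f ξ := by
  have hpi : (2 * Real.pi) ≠ 0 := mul_ne_zero two_ne_zero Real.pi_ne_zero
  let G : Plane → ℂ := fun ξ =>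
    (m₁ ((2 * Real.pi) • ξ) * m₂ ((2 * Real.pi) • ξ)) * (𝓕 f : 𝓢(Plane, ℂ)) ξ
  have hGs : ContDiff ℝ ∞ G :=
    (hs.comp (contDiff_const_smul (2 * Real.pi))).mul ((𝓕 f : 𝓢(Plane, ℂ)).smooth ⊤)
  have hGc : HasCompactSupport G := (hcs.comp_smul hpi).mul_right
  let G' : 𝓢(Plane, ℂ) := hGc.toSchwartzMap hGs
  have hG' : ∀ ξ, G' ξ = G ξ := fun ξ => rfl
  have hF : (𝓕 (𝓕⁻ G' : 𝓢(Plane, ℂ)) : 𝓢(Plane, ℂ)) = G' := FourierTransform.fourier_fourierInv_eq _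
  refine ⟨𝓕⁻ G', ?_, fun ξ => ?_⟩
  · have h : (𝓕 (fourierMultiplier m₁ hc₁ hb₁ (fourierMultiplier m₂ hc₂ hb₂ (f.toLp 2))) : L2) =
        𝓕 ((𝓕⁻ G' : 𝓢(Plane, ℂ)).toLp 2 volume) := by
      rw [SchwartzMap.toLp_fourier_eq, hF]
      refine Lp.ext ?_
      have h3 : (𝓕 (f.toLp 2 volume) : L2) =ᵐ[volume] (𝓕 f : 𝓢(Plane, ℂ)) := by
        rw [SchwartzMap.toLp_fourier_eq]
        exact (𝓕 f : 𝓢(Plane, ℂ)).coeFn_toLp 2 volume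
      filter_upwards [fourier_fourierMultiplier m₁ hc₁ hb₁
        (fourierMultiplier m₂ hc₂ hb₂ (f.toLp 2)), fourier_fourierMultiplier m₂ hc₂ hb₂ (f.toLp 2),
        h3, G'.coeFn_toLp 2 volume] with ξ e1 e2 e3 e4
      rw [e1, e2, e3, e4, hG', ← mul_assoc]
    exact (Lp.fourierTransformₗᵢ Plane ℂ).injective h
  · rw [fourierHat_eq, fourierHat_eq, ← SchwartzMap.fourier_coe, ← SchwartzMap.fourier_coe, hF, hG']
    simp only [G]
    rw [smul_smul, mul_inv_cancel₀ hpi, one_smul]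
    ring

/-- The kernel of the Hankel operator composed with the multiplier `m`. -/
noncomputable def hankelKernel (H : ℝ → ℂ) (m : Plane → ℂ) (x y : Plane) : ℂ :=
  (2 * Real.pi : ℂ)⁻¹ * hankelOp H (fun ξ => m ξ * Complex.exp (-Complex.I * (⟪y, ξ⟫_ℝ : ℝ))) x

theorem norm_exp_neg_I_mul (s : ℝ) : ‖Complex.exp (-Complex.I * (s : ℂ))‖ = 1 := by
  rw [neg_mul, mul_comm, ← neg_mul, ← Complex.ofReal_neg, Complex.norm_exp_ofReal_mul_I]

section

variable {H : ℝ → ℂ} {m : Plane → ℂ} {B : ℝ}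

/-- Dominated convergence: while |x| stays above half its value at the base point, |H(|ξ||x|) m(ξ)|
is bounded by a constant times |ξ|^{-1/2}|m(ξ)|. -/
theorem continuousAt_hankelKernel (hm : Measurable H) (hH : ContinuousOn H (Ioi 0))
    (hB : ∀ s, 0 < s → ‖H s‖ ≤ B * s ^ (-(1 / 2) : ℝ)) (ham : IsHankelAdmissible m)
    {p₀ : Plane × Plane} (hp : p₀.1 ≠ 0) :
    ContinuousAt (fun p : Plane × Plane => hankelKernel H m p.1 p.2) p₀ := by
  unfold hankelKernel hankelOp
  refine continuousAt_const.mul (continuousAt_const.mul ?_)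
  have hr : 0 < ‖p₀.1‖ := norm_pos_iff.2 hp
  have hmm := ham.measurable
  have hev : ∀ᶠ p : Plane × Plane in 𝓝 p₀, ‖p₀.1‖ / 2 < ‖p.1‖ :=
    (continuous_fst.norm.tendsto p₀).eventually (lt_mem_nhds (by linarith))
  have hB0 : 0 ≤ B := by simpa using (norm_nonneg _).trans (hB 1 one_pos)
  refine continuousAt_of_dominated
    (bound := fun ξ => B * (‖p₀.1‖ / 2) ^ (-(1 / 2) : ℝ) *
      ‖((‖ξ‖ ^ (-(1 / 2) : ℝ) : ℝ) : ℂ) * m ξ‖)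
    (Eventually.of_forall fun p => ?_) ?_ (ham.integrable.norm.const_mul _) ?_
  · have h1 : Measurable fun ξ : Plane => Complex.exp (-Complex.I * (⟪p.2, ξ⟫_ℝ : ℝ)) :=
      Continuous.measurable (by fun_prop)
    have h2 : Measurable fun ξ : Plane => H (‖ξ‖ * ‖p.1‖) := by fun_prop
    exact (h2.mul (hmm.mul h1)).aestronglyMeasurable
  · filter_upwards [hev] with p hp'
    filter_upwards [ae_ne_zero_plane] with ξ hξ
    have hξ' : 0 < ‖ξ‖ := norm_pos_iff.2 hξ
    have hp1 : 0 < ‖p.1‖ := lt_trans (by positivity) hp'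
    rw [norm_mul, norm_mul, norm_exp_neg_I_mul, mul_one, norm_mul, Complex.norm_real,
      Real.norm_of_nonneg (by positivity), ← mul_assoc]
    refine mul_le_mul_of_nonneg_right ((hB _ (by positivity)).trans ?_) (norm_nonneg _)
    rw [Real.mul_rpow hξ'.le hp1.le, mul_assoc, mul_comm (‖ξ‖ ^ _)]
    gcongr B * (?_ * _)
    exact Real.rpow_le_rpow_of_nonpos (by positivity) hp'.le (by norm_num)
  · filter_upwards [ae_ne_zero_plane] with ξ hξ
    have hξ' : 0 < ‖ξ‖ := norm_pos_iff.2 hξ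
    refine ContinuousAt.mul ?_ (Continuous.continuousAt (by fun_prop))
    exact ContinuousAt.comp (f := fun p : Plane × Plane => ‖ξ‖ * ‖p.1‖)
      (hH.continuousAt (Ioi_mem_nhds (by positivity)))
      (Continuous.continuousAt (by fun_prop))

theorem continuous_hankelKernel (hm : Measurable H) (hH : ContinuousOn H (Ioi 0))
    (hB : ∀ s, 0 < s → ‖H s‖ ≤ B * s ^ (-(1 / 2) : ℝ)) (ham : IsHankelAdmissible m)
    {x : Plane} (hx : x ≠ 0) : Continuous fun y : Plane => hankelKernel H m x y := by
  refine continuous_iff_continuousAt.2 fun y => ?_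
  exact ContinuousAt.comp (f := fun y : Plane => (x, y))
    (continuousAt_hankelKernel hm hH hB ham (p₀ := (x, y)) hx) (by fun_prop)

theorem integral_hankelKernel_mul (hm : Measurable H)
    (hB : ∀ s, 0 < s → ‖H s‖ ≤ B * s ^ (-(1 / 2) : ℝ)) (ham : IsHankelAdmissible m)
    {x : Plane} (hx : x ≠ 0) (f : 𝓢(Plane, ℂ)) :
    ∫ y, hankelKernel H m x y * f y = hankelOp H (fun ξ => m ξ * fourierHat f ξ) x := by
  have hi := ham.integrable_mul hm hB (norm_pos_iff.2 hx)
  have hint : Integrable (Function.uncurry fun (y ξ : Plane) =>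
      H (‖ξ‖ * ‖x‖) * (m ξ * Complex.exp (-Complex.I * (⟪y, ξ⟫_ℝ : ℝ))) * f y)
      (volume.prod volume) := by
    refine ((f.integrable (μ := volume)).mul_prod hi).congr' ?_ (Eventually.of_forall fun p => ?_)
    · have h1 : Measurable fun p : Plane × Plane =>
          Complex.exp (-Complex.I * (⟪p.1, p.2⟫_ℝ : ℝ)) := Continuous.measurable (by fun_prop)
      have h2 : Measurable fun p : Plane × Plane => H (‖p.2‖ * ‖x‖) := by fun_prop
      exact ((h2.mul ((ham.measurable.comp measurable_snd).mul h1)).mul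
        (f.continuous.measurable.comp measurable_fst)).aestronglyMeasurable
    · simp only [Function.uncurry_def, norm_mul, norm_exp_neg_I_mul, mul_one]
      ring
  have e1 : ∀ y, hankelKernel H m x y * f y = (2 * Real.pi : ℂ)⁻¹ * ((1 / 2 : ℂ) *
      (2 * Real.pi : ℂ)⁻¹) * ∫ ξ : Plane,
        H (‖ξ‖ * ‖x‖) * (m ξ * Complex.exp (-Complex.I * (⟪y, ξ⟫_ℝ : ℝ))) * f y := by
    intro y
    rw [hankelKernel, hankelOp, integral_mul_const]
    ring
  have e2 : ∀ ξ, H (‖ξ‖ * ‖x‖) * (m ξ * fourierHat f ξ) = (2 * Real.pi : ℂ)⁻¹ * ∫ y : Plane,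
      H (‖ξ‖ * ‖x‖) * (m ξ * Complex.exp (-Complex.I * (⟪y, ξ⟫_ℝ : ℝ))) * f y := by
    intro ξ
    simp only [fourierHat, mul_assoc]
    rw [integral_const_mul, integral_const_mul]
    ring
  simp only [hankelOp, e1, e2]
  rw [integral_const_mul, integral_const_mul, integral_integral_swap hint]
  ring

/-- Fubini gives the formula on Schwartz functions. Square integrability of the kernel in y makes
its right-hand side continuous in f ∈ L² for every fixed x ≠ 0. -/
theorem isIntegralKernel_hankelKernel (hm : Measurable H) (hH : ContinuousOn H (Ioi 0))
    (hB : ∀ s, 0 < s → ‖H s‖ ≤ B * s ^ (-(1 / 2) : ℝ)) (ham : IsHankelAdmissible m)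
    (hmem : ∀ x, x ≠ 0 → MemLp (fun y => hankelKernel H m x y) 2) {P M : L2 →L[ℂ] L2}
    (hP : IsHankelProjection H P)
    (hM : ∀ f : 𝓢(Plane, ℂ), ∃ g : 𝓢(Plane, ℂ), M (f.toLp 2) = g.toLp 2 ∧
      ∀ ξ, fourierHat g ξ = m ξ * fourierHat f ξ) :
    IsIntegralKernel (P ∘L M) (hankelKernel H m) := by
  refine ⟨fun p hp => (continuousAt_hankelKernel hm hH hB ham hp).continuousWithinAt, fun f => ?_⟩
  have hint : ∀ x, x ≠ 0 → ∀ g : L2, Integrable fun y => hankelKernel H m x y * g y :=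
    fun x hx g => (hmem x hx).integrable_mul (Lp.memLp g)
  have hschwartz : ∀ g : 𝓢(Plane, ℂ), ∀ᵐ x : Plane,
      (P ∘L M) (g.toLp 2) x = ∫ y, hankelKernel H m x y * (g.toLp 2 volume) y := by
    intro g
    obtain ⟨u, hu, hu'⟩ := hM g
    filter_upwards [hP u, ae_ne_zero_plane] with x hx hx0
    rw [ContinuousLinearMap.comp_apply, hu, hx.2]
    have e : ∫ y, hankelKernel H m x y * (g.toLp 2 volume) y = ∫ y, hankelKernel H m x y * g y :=
      integral_congr_ae (by
        filter_upwards [g.coeFn_toLp 2 volume] with y hy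
        rw [hy])
    rw [e, integral_hankelKernel_mul hm hB ham hx0, hankelOp]
    simp only [hu']
  obtain ⟨v, hv, hvf⟩ := mem_closure_iff_seq_limit.1 (schwartz_denseRange f)
  choose u hu using hv
  have hT : Tendsto (fun n => (P ∘L M) (v n)) atTop (𝓝 ((P ∘L M) f)) :=
    ((P ∘L M).continuous.tendsto f).comp hvf
  -- Convergence in L² gives convergence almost everywhere only along a subsequence; the right-hand
  -- sides converge for every x ≠ 0, so the limits can be compared.
  obtain ⟨ns, hns, hae⟩ := (tendstoInMeasure_of_tendsto_Lp hT).exists_seq_tendsto_ae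
  filter_upwards [hae, ae_all_iff.2 fun n => hschwartz (u n), ae_ne_zero_plane] with x h1 h2 hx
  refine ⟨hint x hx f, tendsto_nhds_unique h1 ?_⟩
  have hk : MemLp (fun y => starRingEnd ℂ (hankelKernel H m x y)) 2 := (hmem x hx).star
  have hin : ∀ g : L2, ⟪hk.toLp _, g⟫_ℂ = ∫ y, hankelKernel H m x y * g y := by
    intro g
    rw [L2.inner_def]
    refine integral_congr_ae ?_
    filter_upwards [hk.coeFn_toLp] with y hy
    rw [hy, RCLike.inner_apply, Complex.conj_conj, mul_comm]
  have h3 : ∀ n, (P ∘L M) (v n) x = ⟪hk.toLp _, v n⟫_ℂ := fun n => by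
    rw [hin, ← hu n]
    exact h2 n
  simp only [h3, ← hin]
  exact ((continuous_const.inner continuous_id).tendsto f).comp (hvf.comp hns.tendsto_atTop)

end

/-! ### The frequency-localised kernels -/

/-- The radial profile of the Littlewood-Paley symbol. -/
noncomputable def profile (φ : Plane → ℝ) (σ : ℝ) : ℝ :=
  φ (σ • EuclideanSpace.single 0 1) - φ ((2 * σ) • EuclideanSpace.single 0 1)

theorem norm_smul_single (σ : ℝ) : ‖σ • (EuclideanSpace.single 0 1 : Plane)‖ = |σ| := by
  rw [norm_smul, PiLp.norm_single, norm_one, mul_one, Real.norm_eq_abs]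

/-- The boundary circle |ξ| = 11/10 is reached by continuity along rays. -/
theorem IsCutoff.eq_zero_of_le {φ : Plane → ℝ} (hφ : IsCutoff φ) {ξ : Plane}
    (h : 11 / 10 ≤ ‖ξ‖) : φ ξ = 0 := by
  have h0 : ξ ≠ 0 := fun h0 => by
    rw [h0, norm_zero] at h
    norm_num at h
  have ht : Tendsto (fun s : ℝ => φ (s • ξ)) (𝓝[>] 1) (𝓝 (φ ((1 : ℝ) • ξ))) := by
    have hc : Continuous fun s : ℝ => φ (s • ξ) := hφ.smooth.continuous.comp (by fun_prop)
    exact (hc.tendsto 1).mono_left nhdsWithin_le_nhds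
  have hz : Tendsto (fun s : ℝ => φ (s • ξ)) (𝓝[>] 1) (𝓝 0) := by
    refine tendsto_const_nhds.congr' ?_
    filter_upwards [self_mem_nhdsWithin] with s hs
    have hs' : (1 : ℝ) < s := hs
    refine (hφ.eq_zero _ ?_).symm
    rw [norm_smul, Real.norm_of_nonneg (by linarith)]
    exact h.trans_lt (lt_mul_of_one_lt_left (norm_pos_iff.2 h0) hs')
  simpa using tendsto_nhds_unique ht hz

theorem IsCutoff.isProfile {φ : Plane → ℝ} (hφ : IsCutoff φ) : IsProfile (profile φ) := by
  refine ⟨?_, fun σ h0 h1 => ?_, fun σ h => ?_⟩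
  · have hs := hφ.smooth
    unfold profile
    exact (hs.comp (by fun_prop)).sub (hs.comp (by fun_prop))
  · rw [profile, hφ.eq_one, hφ.eq_one, sub_self]
    · rw [norm_smul_single, abs_of_nonneg (by linarith)]
      linarith
    · rw [norm_smul_single, abs_of_nonneg h0]
      linarith
  · rw [profile, hφ.eq_zero_of_le, hφ.eq_zero_of_le, sub_self]
    · rw [norm_smul_single, abs_of_nonneg (by linarith)]
      linarith
    · rwa [norm_smul_single, abs_of_nonneg (by linarith)]

theorem IsCutoff.sub_eq_profile {φ : Plane → ℝ} (hφ : IsCutoff φ) (N : ℝ) (ξ : Plane) :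
    φ (N⁻¹ • ξ) - φ ((2 * N⁻¹) • ξ) = profile φ (N⁻¹ * ‖ξ‖) := by
  rw [profile]
  congr 1
  · refine hφ.radial _ _ ?_
    rw [norm_smul_single, norm_smul, Real.norm_eq_abs, abs_mul, abs_norm]
  · refine hφ.radial _ _ ?_
    rw [norm_smul_single, norm_smul, Real.norm_eq_abs, ← mul_assoc, abs_mul _ ‖ξ‖, abs_norm]

/-- The symbol of `P_N e^{itΔ}`. -/
noncomputable def localSymbol (φ : Plane → ℝ) (N t : ℝ) (ξ : Plane) : ℂ :=
  ((φ (N⁻¹ • ξ) - φ ((2 * N⁻¹) • ξ) : ℝ) : ℂ) * Complex.exp (-Complex.I * (t * ‖ξ‖ ^ 2 : ℝ))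

theorem contDiff_localSymbol {φ : Plane → ℝ} (hφ : IsCutoff φ) (N t : ℝ) :
    ContDiff ℝ ∞ (localSymbol φ N t) := by
  have hs := hφ.smooth
  have h1 : ContDiff ℝ ∞ fun ξ : Plane => φ (N⁻¹ • ξ) - φ ((2 * N⁻¹) • ξ) :=
    (hs.comp (by fun_prop)).sub (hs.comp (by fun_prop))
  have h2 : ContDiff ℝ ∞ fun ξ : Plane => t * ‖ξ‖ ^ 2 := contDiff_const.mul (contDiff_norm_sq ℝ)
  unfold localSymbol
  exact (Complex.ofRealCLM.contDiff.comp h1).mul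
    (contDiff_const.mul (Complex.ofRealCLM.contDiff.comp h2)).cexp

theorem hasCompactSupport_localSymbol {φ : Plane → ℝ} (hφ : IsCutoff φ) {N : ℝ} (hN : 0 < N)
    (t : ℝ) : HasCompactSupport (localSymbol φ N t) := by
  refine HasCompactSupport.intro (isCompact_closedBall (0 : Plane) (11 / 10 * N)) fun ξ hξ => ?_
  have hξ' : 11 / 10 * N < ‖ξ‖ := by simpa using hξ
  rw [localSymbol, hφ.sub_eq_profile, hφ.isProfile.eq_zero_high, Complex.ofReal_zero, zero_mul]
  rw [inv_mul_eq_div, le_div_iff₀ hN]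
  exact hξ'.le

theorem isHankelAdmissible_localSymbol {φ : Plane → ℝ} (hφ : IsCutoff φ) {N : ℝ} (hN : 0 < N)
    (t : ℝ) : IsHankelAdmissible (localSymbol φ N t) :=
  isHankelAdmissible_schwartz
    ((hasCompactSupport_localSymbol hφ hN t).toSchwartzMap (contDiff_localSymbol hφ N t))

theorem exists_schwartz_localSymbol {φ : Plane → ℝ} (hφ : IsCutoff φ) {N : ℝ} (hN : 0 < N) (t : ℝ)
    (f : 𝓢(Plane, ℂ)) :
    ∃ g : 𝓢(Plane, ℂ), (littlewoodPaley φ hφ N ∘L propagator t) (f.toLp 2) = g.toLp 2 ∧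
      ∀ ξ, fourierHat g ξ = localSymbol φ N t ξ * fourierHat f ξ := by
  have hc := hφ.smooth.continuous
  obtain ⟨C, hC⟩ := hφ.bounded
  exact exists_schwartz_fourierMultiplier
    (m₁ := fun ξ => ((φ (N⁻¹ • ξ) - φ ((2 * N⁻¹) • ξ) : ℝ) : ℂ))
    (m₂ := fun ξ => Complex.exp (-Complex.I * (t * ‖ξ‖ ^ 2 : ℝ))) (by fun_prop)
    ⟨C + C, fun ξ => (Complex.norm_real _).trans_le
      ((norm_sub_le _ _).trans (add_le_add (hC _) (hC _)))⟩ (by fun_prop)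
    ⟨1, fun ξ => (norm_exp_neg_I_mul _).le⟩ (contDiff_localSymbol hφ N t)
    (hasCompactSupport_localSymbol hφ hN t) f

theorem radialKernel_eq_integral_Ioi {ψ : ℝ → ℝ} (hψ : IsProfile ψ) (X Y T : ℝ) :
    radialKernel ψ X Y T = ∫ σ in Ioi (0 : ℝ), hankel1 (σ * X) * besselJ0 (σ * Y) *
      (Complex.exp (Complex.I * (T * σ ^ 2 : ℝ)) * (ψ σ * σ : ℝ)) := by
  rw [radialKernel, intervalIntegral.integral_of_le (by norm_num)]
  refine (setIntegral_eq_of_subset_of_forall_sdiff_eq_zero measurableSet_Ioi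
    (fun σ hσ => lt_trans (by norm_num) hσ.1) fun σ hσ => ?_).symm
  rw [hψ.eq_zero (le_of_lt hσ.1) fun h => hσ.2 ⟨h.1, h.2.le⟩, zero_mul, Complex.ofReal_zero,
    mul_zero, mul_zero]

/-- The symbol is radial, so the angular integral acts on e^{-iy·ξ} alone and produces 2πJ₀(ρ|y|).
The scaling ρ = Nσ contributes N², and the prefactors combine to 1/(4π). -/
theorem hankelKernel_eq {φ : Plane → ℝ} (hφ : IsCutoff φ) {N : ℝ} (hN : 0 < N) (t : ℝ)
    {x : Plane} (hx : x ≠ 0) (y : Plane) :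
    hankelKernel hankel1 (localSymbol φ N (-t)) x y =
      ((N ^ 2 / (4 * Real.pi) : ℝ) : ℂ) *
        radialKernel (profile φ) (N * ‖x‖) (N * ‖y‖) (N ^ 2 * t) := by
  obtain ⟨B, -, hB⟩ := exists_norm_hankel1_le
  have ham := isHankelAdmissible_localSymbol hφ hN (-t)
  have hi := ham.integrable_mul measurable_hankel1 hB (norm_pos_iff.2 hx)
  have hme : Measurable fun ξ : Plane => Complex.exp (-Complex.I * (⟪y, ξ⟫_ℝ : ℝ)) :=
    Continuous.measurable (by fun_prop)
  have hmH : Measurable fun ξ : Plane => hankel1 (‖ξ‖ * ‖x‖) := by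
    have := measurable_hankel1
    fun_prop
  have hmt : Measurable fun ξ : Plane => hankel1 (‖ξ‖ * ‖x‖) *
      (localSymbol φ N (-t) ξ * Complex.exp (-Complex.I * (⟪y, ξ⟫_ℝ : ℝ))) :=
    hmH.mul (ham.measurable.mul hme)
  have hit : Integrable fun ξ : Plane => hankel1 (‖ξ‖ * ‖x‖) *
      (localSymbol φ N (-t) ξ * Complex.exp (-Complex.I * (⟪y, ξ⟫_ℝ : ℝ))) :=
    hi.congr' hmt.aestronglyMeasurable (Eventually.of_forall fun ξ => by
      simp only [norm_mul, norm_exp_neg_I_mul, mul_one])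
  let G : ℝ → ℂ := fun ρ => 2 * Real.pi * (hankel1 (ρ * ‖x‖) * besselJ0 (ρ * ‖y‖) *
      (Complex.exp (Complex.I * (t * ρ ^ 2 : ℝ)) * (profile φ (N⁻¹ * ρ) * ρ : ℝ)))
  have e1 : ∫ ξ : Plane, hankel1 (‖ξ‖ * ‖x‖) *
      (localSymbol φ N (-t) ξ * Complex.exp (-Complex.I * (⟪y, ξ⟫_ℝ : ℝ))) =
      ∫ ρ in Ioi (0 : ℝ), G ρ := by
    rw [integral_polar_iterated hmt hit]
    refine setIntegral_congr_fun measurableSet_Ioi fun ρ hρ => ?_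
    have hρ' : (0 : ℝ) < ρ := hρ
    have hJ := besselJ0_norm_mul ρ (-y)
    rw [norm_neg, mul_comm ‖y‖] at hJ
    have hJ' : ∫ θ in Ioo (-Real.pi) Real.pi,
        Complex.exp (-Complex.I * (⟪y, polarPoint ρ θ⟫_ℝ : ℝ)) =
        2 * Real.pi * besselJ0 (ρ * ‖y‖) := by
      rw [hJ]
      refine integral_congr_ae (Eventually.of_forall fun θ => ?_)
      simp only
      rw [inner_neg_right, real_inner_comm, Complex.ofReal_neg, neg_mul, mul_neg]
    simp only [localSymbol, hφ.sub_eq_profile, norm_polarPoint, abs_of_pos hρ']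
    rw [integral_const_mul, integral_const_mul, hJ']
    simp only [G]
    rw [show -Complex.I * ((-t * ρ ^ 2 : ℝ) : ℂ) = Complex.I * ((t * ρ ^ 2 : ℝ) : ℂ) by
      push_cast; ring, Complex.ofReal_mul (profile φ (N⁻¹ * ρ)) ρ]
    ring
  have e2 := integral_comp_mul_left_Ioi G 0 hN
  rw [mul_zero] at e2
  have e3 : ∫ ρ in Ioi (0 : ℝ), G ρ = N * ∫ σ in Ioi (0 : ℝ), G (N * σ) := by
    rw [e2, Complex.real_smul, ← mul_assoc, ← Complex.ofReal_mul, mul_inv_cancel₀ hN.ne',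
      Complex.ofReal_one, one_mul]
  have e4 : ∀ σ : ℝ, G (N * σ) = 2 * Real.pi * N * (hankel1 (σ * (N * ‖x‖)) *
      besselJ0 (σ * (N * ‖y‖)) * (Complex.exp (Complex.I * ((N ^ 2 * t) * σ ^ 2 : ℝ)) *
        (profile φ σ * σ : ℝ))) := by
    intro σ
    simp only [G]
    rw [← mul_assoc N⁻¹, inv_mul_cancel₀ hN.ne', one_mul, show N * σ * ‖x‖ = σ * (N * ‖x‖) by ring,
      show N * σ * ‖y‖ = σ * (N * ‖y‖) by ring, show t * (N * σ) ^ 2 = N ^ 2 * t * σ ^ 2 by ring]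
    push_cast
    ring
  have hpi : (Real.pi : ℂ) ≠ 0 := Complex.ofReal_ne_zero.2 Real.pi_ne_zero
  rw [hankelKernel, hankelOp, e1, e3, radialKernel_eq_integral_Ioi hφ.isProfile]
  simp only [e4]
  rw [integral_const_mul]
  generalize (∫ σ in Ioi (0 : ℝ), hankel1 (σ * (N * ‖x‖)) * besselJ0 (σ * (N * ‖y‖)) *
    (Complex.exp (Complex.I * ((N ^ 2 * t) * σ ^ 2 : ℝ)) * (profile φ σ * σ : ℝ))) = J
  push_cast
  field_simp
  ring

/-- Conjugation exchanges the two Hankel functions and reverses time; the reflection ξ ↦ -ξ restores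
the plane wave. -/
theorem hankelKernel_hankel2 {φ : Plane → ℝ} (hφ : IsCutoff φ) (N t : ℝ)
    (x y : Plane) : hankelKernel hankel2 (localSymbol φ N t) x y =
      starRingEnd ℂ (hankelKernel hankel1 (localSymbol φ N (-t)) x y) := by
  simp only [hankelKernel, hankelOp, map_mul, ← integral_conj]
  have e : (∫ ξ : Plane, hankel2 (‖ξ‖ * ‖x‖) *
      (localSymbol φ N t ξ * Complex.exp (-Complex.I * (⟪y, ξ⟫_ℝ : ℝ)))) =
      ∫ ξ : Plane, starRingEnd ℂ (hankel1 (‖ξ‖ * ‖x‖)) * (starRingEnd ℂ (localSymbol φ N (-t) ξ) *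
        starRingEnd ℂ (Complex.exp (-Complex.I * (⟪y, ξ⟫_ℝ : ℝ)))) := by
    rw [← integral_neg_eq_self]
    congr 1
    ext ξ
    simp only [localSymbol, hφ.sub_eq_profile, norm_neg, hankel2, map_mul, ← Complex.exp_conj,
      Complex.conj_ofReal, map_neg, Complex.conj_I, inner_neg_right]
    congr 3
    · congr 1
      push_cast
      ring
    · push_cast
      ring
  rw [e]
  simp only [map_inv₀, map_mul, map_div₀, map_one, map_ofNat, Complex.conj_ofReal]

theorem norm_hankelKernel_eq {φ : Plane → ℝ} (hφ : IsCutoff φ) {N : ℝ} (hN : 0 < N) (t : ℝ)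
    {x : Plane} (hx : x ≠ 0) (y : Plane) :
    ‖hankelKernel hankel1 (localSymbol φ N (-t)) x y‖ = N ^ 2 / (4 * Real.pi) *
      ‖radialKernel (profile φ) (N * ‖x‖) (N * ‖y‖) (N ^ 2 * t)‖ := by
  have := Real.pi_pos
  rw [hankelKernel_eq hφ hN t hx y, norm_mul, Complex.norm_real, Real.norm_of_nonneg (by positivity)]

theorem norm_hankelKernel_hankel2 {φ : Plane → ℝ} (hφ : IsCutoff φ) (N t : ℝ)
    (x y : Plane) : ‖hankelKernel hankel2 (localSymbol φ N t) x y‖ =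
      ‖hankelKernel hankel1 (localSymbol φ N (-t)) x y‖ := by
  rw [hankelKernel_hankel2 hφ, RCLike.norm_conj]

theorem memLp_one_add_norm_rpow :
    MemLp (fun y : Plane => (1 + ‖y‖) ^ (-2 : ℝ)) 2 (volume : Measure Plane) := by
  rw [memLp_two_iff_integrable_sq_norm (Measurable.aestronglyMeasurable (by fun_prop))]
  have h := integrable_one_add_norm (E := Plane) (μ := volume) (r := 4)
    (by rw [finrank_euclideanSpace_fin]; norm_num)
  refine h.congr (Eventually.of_forall fun y => ?_)
  simp only
  rw [Real.norm_of_nonneg (by positivity), ← Real.rpow_natCast, ← Real.rpow_mul (by positivity)]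
  norm_num

theorem one_add_le_mul_bracket {N X Y : ℝ} (hN : 0 < N) (hX : 0 ≤ X) (hY : 0 ≤ Y) :
    1 + Y ≤ 2 * (1 + N⁻¹) * (1 + X) * bracket (X - N * Y) := by
  have h1 := one_le_bracket (X - N * Y)
  have h2 : |X - N * Y| ≤ bracket (X - N * Y) := Real.abs_le_sqrt (by linarith)
  have h3 : N * Y ≤ X + bracket (X - N * Y) := by
    have := neg_abs_le (X - N * Y)
    linarith
  have hN' : 0 < N⁻¹ := by positivity
  have h4 : Y ≤ N⁻¹ * (X + bracket (X - N * Y)) := by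
    rw [inv_mul_eq_div, le_div_iff₀ hN, mul_comm]
    exact h3
  set b := bracket (X - N * Y)
  nlinarith [mul_nonneg hX (sub_nonneg.2 h1), mul_nonneg hN'.le (mul_nonneg hX (sub_nonneg.2 h1)),
    mul_nonneg hN'.le hX, mul_nonneg hN'.le (sub_nonneg.2 h1)]

/-- For fixed N and t the rescaled time is bounded, so the small-time estimate applies whatever its
size. Exponent 2 gives decay (1 + |y|)^{-2}, which is square integrable in the plane. -/
theorem memLp_hankelKernel {φ : Plane → ℝ} (hφ : IsCutoff φ) {N : ℝ} (hN : 0 < N) (t : ℝ)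
    {x : Plane} (hx : x ≠ 0) :
    MemLp (fun y => hankelKernel hankel1 (localSymbol φ N (-t)) x y) 2 := by
  obtain ⟨B, -, hB⟩ := exists_norm_hankel1_le
  have ham := isHankelAdmissible_localSymbol hφ hN (-t)
  have hcont := continuous_hankelKernel measurable_hankel1 continuousOn_hankel1 hB ham hx
  obtain ⟨C, hC0, hC⟩ := exists_radialKernel_small hφ.isProfile |N ^ 2 * t| (m := 2) (by norm_num)
  have hX : 0 < N * ‖x‖ := mul_pos hN (norm_pos_iff.2 hx)
  set X := N * ‖x‖
  have hpi := Real.pi_pos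
  let A : ℝ := 2 * (1 + N⁻¹) * (1 + X)
  have hA : 0 < A := by positivity
  refine MemLp.of_le (memLp_one_add_norm_rpow.const_mul
    (N ^ 2 / (4 * Real.pi) * (C * X ^ (-(1 / 2) : ℝ) * A ^ (2 : ℝ))))
    hcont.aestronglyMeasurable (Eventually.of_forall fun y => ?_)
  rw [norm_hankelKernel_eq hφ hN t hx y, Real.norm_of_nonneg (by positivity), mul_assoc]
  refine mul_le_mul_of_nonneg_left ?_ (by positivity)
  refine (hC X (N * ‖y‖) (N ^ 2 * t) hX (by positivity) le_rfl).trans ?_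
  have h1 : bracket (N * ‖y‖) ^ (-(1 / 2) : ℝ) ≤ 1 :=
    Real.rpow_le_one_of_one_le_of_nonpos (one_le_bracket _) (by norm_num)
  have h2 : bracket (X - N * ‖y‖) ^ (-2 : ℝ) ≤ A ^ (2 : ℝ) * (1 + ‖y‖) ^ (-2 : ℝ) := by
    have h3 := one_add_le_mul_bracket hN hX.le (norm_nonneg y)
    have hb := bracket_pos (X - N * ‖y‖)
    rw [Real.rpow_neg hb.le, Real.rpow_neg (by positivity), ← div_eq_mul_inv,
      inv_le_comm₀ (by positivity) (by positivity), inv_div, div_le_iff₀ (by positivity),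
      ← Real.mul_rpow hb.le hA.le]
    refine Real.rpow_le_rpow (by positivity) ?_ (by norm_num)
    rw [mul_comm]
    exact h3
  calc C * (X ^ (-(1 / 2) : ℝ) * bracket (N * ‖y‖) ^ (-(1 / 2) : ℝ) *
        bracket (X - N * ‖y‖) ^ (-2 : ℝ))
      ≤ C * (X ^ (-(1 / 2) : ℝ) * 1 * (A ^ (2 : ℝ) * (1 + ‖y‖) ^ (-2 : ℝ))) := by
        gcongr
        exact (Real.rpow_nonneg (bracket_pos _).le _)
    _ = _ := by ring

theorem isIntegralKernel_plus {φ : Plane → ℝ} (hφ : IsCutoff φ) {N : ℝ} (hN : 0 < N) (t : ℝ)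
    {P : L2 →L[ℂ] L2} (hP : IsHankelProjection hankel1 P) :
    IsIntegralKernel (P ∘L littlewoodPaley φ hφ N ∘L propagator (-t))
      (hankelKernel hankel1 (localSymbol φ N (-t))) := by
  obtain ⟨B, -, hB⟩ := exists_norm_hankel1_le
  exact isIntegralKernel_hankelKernel measurable_hankel1 continuousOn_hankel1 hB
    (isHankelAdmissible_localSymbol hφ hN (-t)) (fun x hx => memLp_hankelKernel hφ hN t hx) hP
    (exists_schwartz_localSymbol hφ hN (-t))

theorem isIntegralKernel_minus {φ : Plane → ℝ} (hφ : IsCutoff φ) {N : ℝ} (hN : 0 < N) (t : ℝ)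
    {P : L2 →L[ℂ] L2} (hP : IsHankelProjection hankel2 P) :
    IsIntegralKernel (P ∘L littlewoodPaley φ hφ N ∘L propagator t)
      (hankelKernel hankel2 (localSymbol φ N t)) := by
  obtain ⟨B, -, hB⟩ := exists_norm_hankel1_le
  refine isIntegralKernel_hankelKernel measurable_hankel2
    (Complex.continuous_conj.comp_continuousOn continuousOn_hankel1)
    (fun s hs => (norm_hankel2 s).trans_le (hB s hs))
    (isHankelAdmissible_localSymbol hφ hN t) (fun x hx => ?_) hP
    (exists_schwartz_localSymbol hφ hN t)
  simp only [hankelKernel_hankel2 hφ]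
  exact (memLp_hankelKernel hφ hN t hx).star

/-! ### The kernel estimates -/

theorem exists_hankelKernel_stationary {φ : Plane → ℝ} (hφ : IsCutoff φ) :
    ∃ C : ℝ, 0 ≤ C ∧ ∀ (N t : ℝ) (x y : Plane), 0 < N → x ≠ 0 → y ≠ 0 → 0 < t →
      ‖hankelKernel hankel1 (localSymbol φ N (-t)) x y‖ ≤
        C * (‖x‖ * ‖y‖ * |t|) ^ (-(1 / 2) : ℝ) := by
  obtain ⟨C, hC0, hC⟩ := exists_radialKernel_stationary hφ.isProfile
  have hpi := Real.pi_pos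
  refine ⟨(4 * Real.pi)⁻¹ * C, by positivity, fun N t x y hN hx hy ht => ?_⟩
  have hx' : 0 < ‖x‖ := norm_pos_iff.2 hx
  have hy' : 0 < ‖y‖ := norm_pos_iff.2 hy
  rw [norm_hankelKernel_eq hφ hN t hx y, abs_of_pos ht]
  have h := hC (N * ‖x‖) (N * ‖y‖) (N ^ 2 * t) (by positivity) (by positivity) (by positivity)
  have e : (N ^ 4) ^ (-(1 / 2) : ℝ) = (N ^ 2)⁻¹ := by
    rw [← Real.rpow_natCast, ← Real.rpow_mul hN.le,
      show ((4 : ℕ) : ℝ) * (-(1 / 2)) = -2 by norm_num, Real.rpow_neg hN.le, Real.rpow_two]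
  rw [show N * ‖x‖ * (N * ‖y‖) * (N ^ 2 * t) = N ^ 4 * (‖x‖ * ‖y‖ * t) by ring,
    Real.mul_rpow (by positivity) (by positivity), e] at h
  calc _ ≤ N ^ 2 / (4 * Real.pi) * (C * ((N ^ 2)⁻¹ * (‖x‖ * ‖y‖ * t) ^ (-(1 / 2) : ℝ))) := by
        gcongr
    _ = _ := by
        field_simp

/-- The common form of the two rapidly decaying bounds. -/
theorem norm_hankelKernel_le {φ : Plane → ℝ} (hφ : IsCutoff φ) {N t C D : ℝ} (hN : 0 < N)
    {x y : Plane} (hx : x ≠ 0)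
    (h : ‖radialKernel (profile φ) (N * ‖x‖) (N * ‖y‖) (N ^ 2 * t)‖ ≤
      C * ((N * ‖x‖) ^ (-(1 / 2) : ℝ) * bracket (N * ‖y‖) ^ (-(1 / 2) : ℝ) * D)) :
    ‖hankelKernel hankel1 (localSymbol φ N (-t)) x y‖ ≤ (4 * Real.pi)⁻¹ * C *
      (N ^ 2 / ((N * ‖x‖) ^ (1 / 2 : ℝ) * bracket (N * ‖y‖) ^ (1 / 2 : ℝ)) * D) := by
  have hpi := Real.pi_pos
  have hb := bracket_pos (N * ‖y‖)
  rw [norm_hankelKernel_eq hφ hN t hx y]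
  refine (mul_le_mul_of_nonneg_left h (by positivity)).trans (le_of_eq ?_)
  rw [Real.rpow_neg (by positivity), Real.rpow_neg hb.le, div_eq_mul_inv, div_eq_mul_inv, mul_inv]
  ring

end InOut

/-! ### Assembly of the theorem -/

theorem mainTheorem9 :
    ∃ Pplus Pminus : InOut.L2 →L[ℂ] InOut.L2,
      -- the operators `P^±` are bounded on `L²`
      InOut.IsHankelProjection InOut.hankel1 Pplus ∧
      InOut.IsHankelProjection InOut.hankel2 Pminus ∧
      -- `P⁺ + P⁻` is the orthogonal projection onto the radial functions
      (∀ f : InOut.L2,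
        (Pplus + Pminus) f ∈ InOut.radialL2 ∧ f - (Pplus + Pminus) f ∈ InOut.radialL2ᗮ) ∧
      -- kernel estimates
      ∀ (φ : InOut.Plane → ℝ) (hφ : InOut.IsCutoff φ),
        ∃ Kplus Kminus : ℝ → ℝ → InOut.Plane → InOut.Plane → ℂ,
          (∀ N : ℝ, 0 < N → ∀ t : ℝ,
            InOut.IsIntegralKernel
              (Pplus ∘L InOut.littlewoodPaley φ hφ N ∘L InOut.propagator (-t)) (Kplus N t) ∧
            InOut.IsIntegralKernel
              (Pminus ∘L InOut.littlewoodPaley φ hφ N ∘L InOut.propagator t) (Kminus N t)) ∧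
          -- large times, `|y| - |x| ∼ N t`
          (∀ c > (0 : ℝ), ∀ a b : ℝ, 0 < a → a < 1 → 11 / 5 < b →
            ∃ C : ℝ, ∀ (N t : ℝ) (x y : InOut.Plane), 0 < N →
              c * N⁻¹ ≤ ‖x‖ → c * (N ^ 2)⁻¹ ≤ t →
              a * (N * t) ≤ ‖y‖ - ‖x‖ → ‖y‖ - ‖x‖ ≤ b * (N * t) →
              ‖Kplus N t x y‖ ≤ C * (‖x‖ * ‖y‖ * |t|) ^ (-(1 / 2) : ℝ) ∧
              ‖Kminus N t x y‖ ≤ C * (‖x‖ * ‖y‖ * |t|) ^ (-(1 / 2) : ℝ)) ∧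
          -- large times, otherwise
          (∀ c > (0 : ℝ), ∀ a b : ℝ, 0 < a → a < 1 → 11 / 5 < b → ∀ m : ℝ, 0 ≤ m →
            ∃ C : ℝ, ∀ (N t : ℝ) (x y : InOut.Plane), 0 < N →
              c * N⁻¹ ≤ ‖x‖ → c * (N ^ 2)⁻¹ ≤ t →
              ¬ (a * (N * t) ≤ ‖y‖ - ‖x‖ ∧ ‖y‖ - ‖x‖ ≤ b * (N * t)) →
              ‖Kplus N t x y‖ ≤
                C * (N ^ 2 / ((N * ‖x‖) ^ (1 / 2 : ℝ) * InOut.bracket (N * ‖y‖) ^ (1 / 2 : ℝ)) *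
                  InOut.bracket (N ^ 2 * t + N * ‖x‖ - N * ‖y‖) ^ (-m)) ∧
              ‖Kminus N t x y‖ ≤
                C * (N ^ 2 / ((N * ‖x‖) ^ (1 / 2 : ℝ) * InOut.bracket (N * ‖y‖) ^ (1 / 2 : ℝ)) *
                  InOut.bracket (N ^ 2 * t + N * ‖x‖ - N * ‖y‖) ^ (-m))) ∧
          -- small times
          (∀ c > (0 : ℝ), ∀ c' > (0 : ℝ), ∀ m : ℝ, 0 ≤ m →
            ∃ C : ℝ, ∀ (N t : ℝ) (x y : InOut.Plane), 0 < N →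
              c * N⁻¹ ≤ ‖x‖ → |t| ≤ c' * (N ^ 2)⁻¹ →
              ‖Kplus N t x y‖ ≤
                C * (N ^ 2 / ((N * ‖x‖) ^ (1 / 2 : ℝ) * InOut.bracket (N * ‖y‖) ^ (1 / 2 : ℝ)) *
                  InOut.bracket (N * ‖x‖ - N * ‖y‖) ^ (-m)) ∧
              ‖Kminus N t x y‖ ≤
                C * (N ^ 2 / ((N * ‖x‖) ^ (1 / 2 : ℝ) * InOut.bracket (N * ‖y‖) ^ (1 / 2 : ℝ)) *
                  InOut.bracket (N * ‖x‖ - N * ‖y‖) ^ (-m))) := by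
  obtain ⟨Pp, hPp⟩ := InOut.exists_isHankelProjection_hankel1
  obtain ⟨Pm, hPm⟩ := InOut.exists_isHankelProjection_hankel2
  refine ⟨Pp, Pm, hPp, hPm, InOut.isOrthogonalProjection_radial hPp hPm, fun φ hφ =>
    ⟨fun N t => InOut.hankelKernel InOut.hankel1 (InOut.localSymbol φ N (-t)),
      fun N t => InOut.hankelKernel InOut.hankel2 (InOut.localSymbol φ N t),
      fun N hN t => ⟨InOut.isIntegralKernel_plus hφ hN t hPp,
        InOut.isIntegralKernel_minus hφ hN t hPm⟩, ?_, ?_, ?_⟩⟩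
  · intro c hc a b ha _ _
    obtain ⟨C, -, hC⟩ := InOut.exists_hankelKernel_stationary hφ
    refine ⟨C, fun N t x y hN hx ht h1 _ => ?_⟩
    have hx0 : 0 < ‖x‖ := lt_of_lt_of_le (by positivity) hx
    have ht0 : 0 < t := lt_of_lt_of_le (by positivity) ht
    -- In the stationary region |y| ≥ |x| + aNt > 0, so the splitting of J₀ is legitimate.
    have hy0 : 0 < ‖y‖ := by
      have : 0 < a * (N * t) := by positivity
      linarith
    rw [InOut.norm_hankelKernel_hankel2 hφ, and_self]
    exact hC N t x y hN (norm_pos_iff.1 hx0) (norm_pos_iff.1 hy0) ht0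
  · intro c hc a b ha0 ha hb m hm
    obtain ⟨C, -, hC⟩ := InOut.exists_radialKernel_nonstationary hφ.isProfile hc ha0 ha hb hm
    refine ⟨(4 * Real.pi)⁻¹ * C, fun N t x y hN hx ht h => ?_⟩
    have hx0 : 0 < ‖x‖ := lt_of_lt_of_le (by positivity) hx
    rw [InOut.norm_hankelKernel_hankel2 hφ, and_self]
    refine InOut.norm_hankelKernel_le hφ hN (norm_pos_iff.1 hx0)
      (hC (N * ‖x‖) (N * ‖y‖) (N ^ 2 * t) (by positivity) (by positivity) ?_ fun h' => h ?_)
    · rwa [← div_eq_mul_inv, div_le_iff₀ (by positivity), mul_comm] at ht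
    -- The region in X, Y, T is the original one multiplied by N.
    · rw [show a * (N ^ 2 * t) = N * (a * (N * t)) by ring,
        show b * (N ^ 2 * t) = N * (b * (N * t)) by ring, ← mul_sub] at h'
      exact ⟨le_of_mul_le_mul_left h'.1 hN, le_of_mul_le_mul_left h'.2 hN⟩
  · intro c hc c' hc' m hm
    obtain ⟨C, -, hC⟩ := InOut.exists_radialKernel_small hφ.isProfile c' hm
    refine ⟨(4 * Real.pi)⁻¹ * C, fun N t x y hN hx ht => ?_⟩
    have hx0 : 0 < ‖x‖ := lt_of_lt_of_le (by positivity) hx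
    rw [InOut.norm_hankelKernel_hankel2 hφ, and_self]
    refine InOut.norm_hankelKernel_le hφ hN (norm_pos_iff.1 hx0)
      (hC (N * ‖x‖) (N * ‖y‖) (N ^ 2 * t) (by positivity) (by positivity) ?_)
    rw [← div_eq_mul_inv, le_div_iff₀ (by positivity)] at ht
    rwa [abs_mul, abs_of_pos (by positivity), mul_comm]
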